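/- **Fractional capacity-constrained facility location (CCFL).** There are $m\ge 2$ facilities with opening costs $c_i\ge 0$, given up-front. Clients $j=1,2,\dots$ arrive online; client $j$ reveals, for every facility $i$, an assignment cost $a_{ij}\ge 0$ and a load $p_{ij}\ge 0$. (Capacities play no role in the program below.) Fix constants $0<\alpha\le\beta$ and let $p\ge 1$ be a real number with $\alpha\log m\le p\le\beta\log m$, i.e. $p=\Theta(\log m)$. For the first $n$ clients, the fractional CCFL problem is $$\min\; f(x,y)=\Big(\sum_{i=1}^m c_ix_i\Big)^p+\Big(\sum_{i=1}^m\sum_{j=1}^n a_{ij}y_{ij}\Big)^p+\sum_{i=1}^m\Big(\sum_{j=1}^n p_{ij}y_{ij}\Big)^p$$ subject to $x,y\ge 0$ and the covering constraints $$\sum_{i\in S}x_i+\sum_{i\notin S}y_{ij}\ge 1\qquad\text{for all } j\le n \text{ and all } S\subseteq\{1,\dots,m\}.$$ **Theorem.** There is an $O(\log^2 m)$-competitive polynomial-time online algorithm for fractional CCFL. More precisely, for all $\alpha,\beta$ there are a constant $C$, a polynomial $Q$ and an online algorithm, depending only on $\alpha,\beta$, with the following properties for all $m$, $p$ and all instances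 as above. The algorithm keeps a vector $(x,y)\ge 0$, initially $0$, in which no variable ever decreases. When client $j$ arrives, it runs the following procedure: as long as some $S$ has $\sum_{i\in S}x_i+\sum_{i\notin S}y_{ij}<\frac12$, add the constraint $\sum_{i\in S}x_i+\sum_{i\notin S}y_{ij}\ge 1$ for one such $S$ and increase $(x,y)$ so that it holds. Moreover: 1. The set is found by a separation oracle that returns the set $S=\{i : x_i<y_{ij}\}$, which minimizes $\sum_{i\in S}x_i+\sum_{i\notin S}y_{ij}$ over all $S$, and compares this minimum with $\frac12$. 2. The procedure makes at most $4m$ iterations for each client. 3. The running time for the $n$-th client, including all calls of the oracle and all updates, is at most $Q(m+n)$, measured in exact real-number operations ($+,-,\times,\div$, comparisons; real-RAM model, without rounding or floor operations), memory accesses and additions, subtractions and comparisons of natural numbers. 4. After the $n$-th client has been served, all constraints of the first $n$ clients hold with right-hand side $\frac12$; hence $(2x,2y)$ is feasible for the fractional CCFL problem on these clients. 5. At that time $f(2x,2y)^{1/p}\le C\,\log^2 m\cdot f(x^*,y^*)^{1/p}$ for every feasible solution $(x^*,y^*)$ for the first $n$ clients. -/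

import Mathlib

open scoped BigOperators

noncomputable section

namespace CCFL

/-! ## The fractional problem -/

/-- An instance with `m` facilities and an online stream of clients `0, 1, 2, …`:
opening costs, assignment costs and loads, all nonnegative. -/
structure Instance (m : ℕ) where
  opening : Fin m → ℝ
  assign : Fin m → ℕ → ℝ
  load : Fin m → ℕ → ℝ
  opening_nonneg : ∀ i, 0 ≤ opening i
  assign_nonneg : ∀ i j, 0 ≤ assign i j
  load_nonneg : ∀ i j, 0 ≤ load i j

/-- The convex objective `f(x, y)` for the first `n` clients. -/
def objective {m : ℕ} (I : Instance m) (p : ℝ) (n : ℕ)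
    (x : Fin m → ℝ) (y : Fin m → ℕ → ℝ) : ℝ :=
  (∑ i, I.opening i * x i) ^ p
    + (∑ i, ∑ j ∈ Finset.range n, I.assign i j * y i j) ^ p
    + ∑ i, (∑ j ∈ Finset.range n, I.load i j * y i j) ^ p

/-- Left-hand side of the covering constraint of client `j` for the set `S`. -/
def coverage {m : ℕ} (x : Fin m → ℝ) (y : Fin m → ℕ → ℝ) (j : ℕ) (S : Finset (Fin m)) : ℝ :=
  ∑ i ∈ S, x i + ∑ i ∈ Sᶜ, y i j

/-- Feasibility for the first `n` clients: nonnegativity and all `2 ^ m` covering constraints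
of each of these clients. -/
def Feasible {m : ℕ} (n : ℕ) (x : Fin m → ℝ) (y : Fin m → ℕ → ℝ) : Prop :=
  (∀ i, 0 ≤ x i) ∧ (∀ i, ∀ j < n, 0 ≤ y i j) ∧
    ∀ j < n, ∀ S : Finset (Fin m), 1 ≤ coverage x y j S

/-! ## A real RAM with unit-cost steps

Programs manipulate natural-number registers (constants, addition, truncated subtraction,
comparison) and two-dimensional arrays of exact real numbers (rational constants, the four field
operations, comparison).  There is no rounding or floor operation and no transcendental function.
The only loops are counted loops, so every program terminates on every memory. -/

/-- The memory: `reg r` is a natural-number register, `mem arr i j` an array cell. -/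
structure Memory where
  reg : ℕ → ℕ
  mem : ℕ → ℕ → ℕ → ℝ

/-- Overwrite a register. -/
def Memory.setReg (s : Memory) (r v : ℕ) : Memory :=
  { s with reg := Function.update s.reg r v }

/-- Overwrite an array cell. -/
def Memory.setCell (s : Memory) (arr i j : ℕ) (v : ℝ) : Memory :=
  { s with mem := fun arr' i' j' =>
      if arr' = arr ∧ i' = i ∧ j' = j then v else s.mem arr' i' j' }

/-- Natural-number expressions. -/
inductive NExpr where
  | const (k : ℕ)
  | reg (r : ℕ)
  | add (e₁ e₂ : NExpr)
  | sub (e₁ e₂ : NExpr)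

def NExpr.eval (s : Memory) : NExpr → ℕ
  | .const k => k
  | .reg r => s.reg r
  | .add e₁ e₂ => e₁.eval s + e₂.eval s
  | .sub e₁ e₂ => e₁.eval s - e₂.eval s

/-- Number of steps needed to evaluate an expression: one for each node. -/
def NExpr.cost : NExpr → ℕ
  | .const _ => 1
  | .reg _ => 1
  | .add e₁ e₂ => e₁.cost + e₂.cost + 1
  | .sub e₁ e₂ => e₁.cost + e₂.cost + 1

/-- Real expressions.  Division by zero returns zero. -/
inductive RExpr where
  | const (q : ℚ)
  | ofNat (e : NExpr)
  | cell (arr : ℕ) (i j : NExpr)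
  | add (e₁ e₂ : RExpr)
  | sub (e₁ e₂ : RExpr)
  | mul (e₁ e₂ : RExpr)
  | div (e₁ e₂ : RExpr)

def RExpr.eval (s : Memory) : RExpr → ℝ
  | .const q => (q : ℝ)
  | .ofNat e => (e.eval s : ℝ)
  | .cell arr i j => s.mem arr (i.eval s) (j.eval s)
  | .add e₁ e₂ => e₁.eval s + e₂.eval s
  | .sub e₁ e₂ => e₁.eval s - e₂.eval s
  | .mul e₁ e₂ => e₁.eval s * e₂.eval s
  | .div e₁ e₂ => e₁.eval s / e₂.eval s

def RExpr.cost : RExpr → ℕ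
  | .const _ => 1
  | .ofNat e => e.cost + 1
  | .cell _ i j => i.cost + j.cost + 1
  | .add e₁ e₂ => e₁.cost + e₂.cost + 1
  | .sub e₁ e₂ => e₁.cost + e₂.cost + 1
  | .mul e₁ e₂ => e₁.cost + e₂.cost + 1
  | .div e₁ e₂ => e₁.cost + e₂.cost + 1

/-- Tests. -/
inductive Test where
  | natLt (e₁ e₂ : NExpr)
  | realLt (e₁ e₂ : RExpr)

def Test.holds (s : Memory) : Test → Prop
  | .natLt e₁ e₂ => e₁.eval s < e₂.eval s
  | .realLt e₁ e₂ => e₁.eval s < e₂.eval s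

def Test.cost : Test → ℕ
  | .natLt e₁ e₂ => e₁.cost + e₂.cost + 1
  | .realLt e₁ e₂ => e₁.cost + e₂.cost + 1

/-- Programs.  `loop r e c` runs `c` with `r = 0, 1, …, N - 1`, where `N` is the value of `e`
when the loop is entered. -/
inductive Program where
  | skip
  | setReg (r : ℕ) (e : NExpr)
  | setCell (arr : ℕ) (i j : NExpr) (e : RExpr)
  | seq (c₁ c₂ : Program)
  | ite (t : Test) (c₁ c₂ : Program)
  | loop (r : ℕ) (e : NExpr) (c : Program)

open Classical in
/-- Run a program: the resulting memory together with the number of steps. -/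
def Program.run : Program → Memory → Memory × ℕ
  | .skip, s => (s, 1)
  | .setReg r e, s => (s.setReg r (e.eval s), e.cost + 1)
  | .setCell arr i j e, s =>
      (s.setCell arr (i.eval s) (j.eval s) (e.eval s), i.cost + j.cost + e.cost + 1)
  | .seq c₁ c₂, s =>
      ((c₂.run (c₁.run s).1).1, (c₁.run s).2 + (c₂.run (c₁.run s).1).2)
  | .ite t c₁ c₂, s =>
      if t.holds s then ((c₁.run s).1, t.cost + (c₁.run s).2)
      else ((c₂.run s).1, t.cost + (c₂.run s).2)
  | .loop r e c, s =>
      Nat.rec (motive := fun _ => Memory × ℕ) (s, e.cost + 1)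
        (fun k t => ((c.run (t.1.setReg r k)).1, t.2 + (c.run (t.1.setReg r k)).2 + 1))
        (e.eval s)

/-- The resulting memory. -/
def Program.exec (c : Program) (s : Memory) : Memory := (c.run s).1

/-- The number of steps. -/
def Program.steps (c : Program) (s : Memory) : ℕ := (c.run s).2

/-! ## Memory layout -/

/-- Register that holds the number of facilities. -/
def regM : ℕ := 0
/-- Register that holds the index of the current client. -/
def regClient : ℕ := 1
/-- Register that holds the answer of the separation oracle (nonzero: violated set found). -/
def regVerdict : ℕ := 2
/-- Array whose cell `(0, 0)` holds the exponent. -/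
def arrExponent : ℕ := 0
/-- Array of the opening costs, at `(i, 0)`. -/
def arrOpening : ℕ := 1
/-- Array of the assignment costs of the clients that have arrived, at `(i, j)`. -/
def arrAssign : ℕ := 2
/-- Array of the loads of the clients that have arrived, at `(i, j)`. -/
def arrLoad : ℕ := 3
/-- Array of the current `x`, at `(i, 0)`. -/
def arrX : ℕ := 4
/-- Array of the current `y`, at `(i, j)`. -/
def arrY : ℕ := 5
/-- Array of the set found by the separation oracle; `i` is in the set if `(i, 0)` is nonzero. -/
def arrSet : ℕ := 6

/-- The current `x` in memory. -/
def Memory.x (m : ℕ) (s : Memory) (i : Fin m) : ℝ := s.mem arrX i 0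

/-- The current `y` in memory. -/
def Memory.y (m : ℕ) (s : Memory) (i : Fin m) (j : ℕ) : ℝ := s.mem arrY i j

open Classical in
/-- The set currently stored in memory. -/
def Memory.set (m : ℕ) (s : Memory) : Finset (Fin m) :=
  Finset.univ.filter fun i : Fin m => s.mem arrSet i 0 ≠ 0

/-- The memory before the first client: `m`, the exponent, the opening costs, and zeros. -/
def initial {m : ℕ} (I : Instance m) (p : ℝ) : Memory where
  reg r := if r = regM then m else 0
  mem arr i j :=
    if arr = arrExponent ∧ i = 0 ∧ j = 0 then p
    else if h : i < m then
      if arr = arrOpening ∧ j = 0 then I.opening ⟨i, h⟩ else 0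
    else 0

/-- Client `n` arrives: its index and its data are written to memory, and its variables `y i n`
are created with value `0`.  Nothing else changes. -/
def arrive {m : ℕ} (I : Instance m) (n : ℕ) (s : Memory) : Memory where
  reg := Function.update s.reg regClient n
  mem arr i j :=
    if h : i < m then
      if arr = arrAssign ∧ j = n then I.assign ⟨i, h⟩ n
      else if arr = arrLoad ∧ j = n then I.load ⟨i, h⟩ n
      else if arr = arrY ∧ j = n then 0
      else s.mem arr i j
    else s.mem arr i j

/-! ## Online algorithms -/

/-- An online algorithm that adds violated constraints one by one.  When a client has arrived, it
runs the loop `while separate finds a violated set do update`. -/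
structure Algorithm where
  separate : Program
  update : Program

/-- The execution of the algorithm on an instance: `state n k` is the memory while client `n` is
served, after `k` iterations of the loop and before the next call of the separation oracle, and
`iters n` is the number of iterations made for client `n`. -/
structure Execution {m : ℕ} (A : Algorithm) (I : Instance m) (p : ℝ) where
  iters : ℕ → ℕ
  state : ℕ → ℕ → Memory
  first : state 0 0 = arrive I 0 (initial I p)
  iterate : ∀ n, ∀ k < iters n,
    (A.separate.exec (state n k)).reg regVerdict ≠ 0 ∧
      state n (k + 1) = A.update.exec (A.separate.exec (state n k))
  finish : ∀ n, (A.separate.exec (state n (iters n))).reg regVerdict = 0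
  next : ∀ n, state (n + 1) 0 = arrive I (n + 1) (A.separate.exec (state n (iters n)))

/-- Steps made for client `n`: all separations, including the last one, and all updates. -/
def Execution.steps {m : ℕ} {A : Algorithm} {I : Instance m} {p : ℝ}
    (R : Execution A I p) (n : ℕ) : ℕ :=
  (∑ k ∈ Finset.range (R.iters n),
      (A.separate.steps (R.state n k) + A.update.steps (A.separate.exec (R.state n k))))
    + A.separate.steps (R.state n (R.iters n))

open Classical in
/-- In the memory `s`, the separation program leaves the solution alone, returns the set
`S = {i | x i < y i j}`, which minimizes the left-hand sides of the constraints of client `j`, and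
reports a violation exactly if the constraint of `S` is below `1 / 2`. -/
def SeparatesAt (m : ℕ) (A : Algorithm) (j : ℕ) (s : Memory) : Prop :=
  let s' := A.separate.exec s
  s'.x m = s.x m ∧ (∀ i, ∀ l ≤ j, s'.y m i l = s.y m i l) ∧
    s'.set m = (Finset.univ.filter fun i => s.x m i < s.y m i j) ∧
    (∀ S, coverage (s.x m) (s.y m) j (s'.set m) ≤ coverage (s.x m) (s.y m) j S) ∧
    (s'.reg regVerdict ≠ 0 ↔ coverage (s.x m) (s.y m) j (s'.set m) < 1 / 2)

/-- One iteration for client `j` in memory `s`: the update never decreases a variable, and it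
raises the left-hand side of the constraint of the violated set to at least `1`. -/
def UpdatesAt (m : ℕ) (A : Algorithm) (j : ℕ) (s : Memory) : Prop :=
  let s' := A.separate.exec s
  let s'' := A.update.exec s'
  (∀ i, s.x m i ≤ s''.x m i) ∧ (∀ i, ∀ l ≤ j, s.y m i l ≤ s''.y m i l) ∧
    1 ≤ coverage (s''.x m) (s''.y m) j (s'.set m)

end CCFL

end

/-! The objective has m + 2 rows: the opening cost, the assignment cost and the load of each
facility. Its p-th root is the p-norm of the rows, which agrees with the largest row up to the
factor (m + 2)^(1/p), and this factor is bounded because p ≥ a log m. It therefore suffices to keep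
every row below O(log² m) · b whenever b bounds all rows of some feasible solution. The algorithm
works with its own exponent t + 1, where t = ⌈log₂ (2m)⌉, so that m + 2 ≤ 2^t.

The method is primal-dual for the power sum Σ u_r^(t+1), where u_r is row r plus a floor θ. As long
as Σ_i min(x_i, y_in) < 1, the smaller of x_i and y_in moves for every facility i, at a speed (value
+ 1/m) / (gradient of the power sum, up to the factor t + 1). Per unit of time the power sum grows
by O(t + 1). In the same time `potential`, the sum of (comparison value) · gradient · log(m ·
variable + 1), grows by at least a constant, because the comparison solution satisfies the
constraint of S = {x < y}. Gradients never decrease, so the inequality Σ u^(t+1) ≤ (t+1) θ Σ u^t + 8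
(t+1) · `potential` persists (`Ready.step`, `Inv.raise_floor`). All variables stay at most 4, so the
potential is at most log(4m+1) · b · Σ u^t (`potential_le`). Hence Σ u^(t+1) ≤ D Σ u^t with D =
O(log² m) · b, and since there are at most 2^t rows, every u_r is at most 2D
(`le_of_sum_pow_succ_le`).

The continuous motion is cut into steps that are short enough for first-order estimates and long
enough for inverse polynomial progress (`multiplicative_step`). Polynomially many steps suffice if
the ratios of rows to θ are polynomial, and this is the purpose of the floor. It is raised to μ /
(2m), where μ is the cost of the cheapest facility for the client. This never exceeds b
(`cheapest_le`), yet each client that has been accounted for can be served at cost 2mθ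
(`exists_cheap_cover`). Inserting that cheap solution into the bound on the rows gives
`Ready.progress_le`. Variables without cost are set to 4 at once, so that all gradients used in a
step are positive.

An update continues until the least left-hand side for the client reaches 1, so one iteration per
client is enough. The programs are verified with a frame rule (`exec_agree`), induction over loop
rounds (`exec_loop`) and a syntactic time bound (`steps_le`). Nested counted loops replace the
missing while loop (`exec_times`). -/

open scoped BigOperators

noncomputable section

namespace CCFL

/-! ## Frames, loops and running time -/

/-- The arrays a program may write. -/
def Program.arrays : Program → List ℕ
  | .skip => []
  | .setReg _ _ => []
  | .setCell arr _ _ _ => [arr]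
  | .seq c₁ c₂ => c₁.arrays ++ c₂.arrays
  | .ite _ c₁ c₂ => c₁.arrays ++ c₂.arrays
  | .loop _ _ c => c.arrays

/-- The registers a program may write. -/
def Program.regs : Program → List ℕ
  | .skip => []
  | .setReg r _ => [r]
  | .setCell _ _ _ _ => []
  | .seq c₁ c₂ => c₁.regs ++ c₂.regs
  | .ite _ c₁ c₂ => c₁.regs ++ c₂.regs
  | .loop r _ c => r :: c.regs

/-- Two memories agree outside what `c` may write. -/
structure Agree (c : Program) (s s' : Memory) : Prop where
  mem : ∀ arr, arr ∉ c.arrays → s'.mem arr = s.mem arr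
  reg : ∀ r, r ∉ c.regs → s'.reg r = s.reg r

@[simp] theorem Memory.setReg_mem (s : Memory) (r v : ℕ) : (s.setReg r v).mem = s.mem := rfl

theorem Memory.setReg_reg (s : Memory) (r v r' : ℕ) :
    (s.setReg r v).reg r' = if r' = r then v else s.reg r' := by
  simp [Memory.setReg, Function.update_apply]

@[simp] theorem Memory.setCell_reg (s : Memory) (arr i j : ℕ) (v : ℝ) :
    (s.setCell arr i j v).reg = s.reg := rfl

theorem Memory.setCell_mem (s : Memory) (arr i j : ℕ) (v : ℝ) (arr' i' j' : ℕ) :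
    (s.setCell arr i j v).mem arr' i' j' =
      if arr' = arr ∧ i' = i ∧ j' = j then v else s.mem arr' i' j' := rfl

theorem exec_skip (s : Memory) : Program.skip.exec s = s := rfl

theorem exec_setReg (r : ℕ) (e : NExpr) (s : Memory) :
    (Program.setReg r e).exec s = s.setReg r (e.eval s) := rfl

theorem exec_setCell (arr : ℕ) (i j : NExpr) (e : RExpr) (s : Memory) :
    (Program.setCell arr i j e).exec s = s.setCell arr (i.eval s) (j.eval s) (e.eval s) := rfl

theorem exec_seq (c₁ c₂ : Program) (s : Memory) :
    (Program.seq c₁ c₂).exec s = c₂.exec (c₁.exec s) := rfl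

open Classical in
theorem exec_ite (b : Test) (c₁ c₂ : Program) (s : Memory) :
    (Program.ite b c₁ c₂).exec s = if b.holds s then c₁.exec s else c₂.exec s := by
  by_cases h : b.holds s <;> simp [Program.exec, Program.run, h]

/-- The memory and the clock after `k` rounds of a loop. -/
def rounds (r : ℕ) (c : Program) (s : Memory) (T : ℕ) : ℕ → Memory × ℕ
  | 0 => (s, T)
  | k + 1 => ((c.run ((rounds r c s T k).1.setReg r k)).1,
      (rounds r c s T k).2 + (c.run ((rounds r c s T k).1.setReg r k)).2 + 1)

theorem run_loop (r : ℕ) (e : NExpr) (c : Program) (s : Memory) :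
    (Program.loop r e c).run s = rounds r c s (e.cost + 1) (e.eval s) := by
  simp only [Program.run]
  generalize e.eval s = N
  induction N with
  | zero => rfl
  | succ k ih => simp only [rounds, ih]

theorem Agree.refl (c : Program) (s : Memory) : Agree c s s := ⟨fun _ _ => rfl, fun _ _ => rfl⟩

/-- This is the frame rule. The write sets are syntactic, so for concrete programs its side
conditions are settled by `decide`. -/
theorem exec_agree (c : Program) (s : Memory) : Agree c s (c.exec s) := by
  induction c generalizing s with
  | skip => exact Agree.refl _ _
  | setReg r e =>
      refine ⟨fun _ _ => rfl, fun r' h => ?_⟩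
      simp only [Program.regs, List.mem_singleton] at h
      simp [exec_setReg, Memory.setReg_reg, h]
  | setCell arr i j e =>
      refine ⟨fun arr' h => ?_, fun _ _ => rfl⟩
      simp only [Program.arrays, List.mem_singleton] at h
      funext i' j'
      simp [exec_setCell, Memory.setCell_mem, h]
  | seq c₁ c₂ h₁ h₂ =>
      refine ⟨fun arr h => ?_, fun r h => ?_⟩
      · simp only [Program.arrays, List.mem_append, not_or] at h
        rw [exec_seq, (h₂ _).mem arr h.2, (h₁ _).mem arr h.1]
      · simp only [Program.regs, List.mem_append, not_or] at h
        rw [exec_seq, (h₂ _).reg r h.2, (h₁ _).reg r h.1]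
  | ite b c₁ c₂ h₁ h₂ =>
      classical
      refine ⟨fun arr h => ?_, fun r h => ?_⟩
      · simp only [Program.arrays, List.mem_append, not_or] at h
        rw [exec_ite]
        split_ifs
        exacts [(h₁ _).mem arr h.1, (h₂ _).mem arr h.2]
      · simp only [Program.regs, List.mem_append, not_or] at h
        rw [exec_ite]
        split_ifs
        exacts [(h₁ _).reg r h.1, (h₂ _).reg r h.2]
  | loop r e c h =>
      rw [Program.exec, run_loop]
      generalize e.eval s = N
      induction N with
      | zero => exact Agree.refl _ _
      | succ k ih =>
          refine ⟨fun arr ha => ?_, fun r' hr => ?_⟩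
          · exact ((h _).mem arr ha).trans (ih.mem arr ha)
          · have hr' : r' ≠ r ∧ r' ∉ c.regs := by simpa [Program.regs] using hr
            refine ((h _).reg r' hr'.2).trans ?_
            rw [Memory.setReg_reg, if_neg hr'.1]
            exact ih.reg r' hr

theorem rounds_agree (r : ℕ) (e : NExpr) (c : Program) (s : Memory) (T k : ℕ) :
    Agree (.loop r e c) s (rounds r c s T k).1 := by
  have h := exec_agree (.loop r (.const k) c) s
  rw [Program.exec, run_loop] at h
  -- The clock does not influence the memory, so `k` rounds of any loop are a complete run of a loop
  -- with constant bound `k`, to which the frame rule applies.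
  have key : ∀ k, ∀ T T', (rounds r c s T k).1 = (rounds r c s T' k).1 := by
    intro k
    induction k with
    | zero => intros; rfl
    | succ k ih => intro T T'; simp only [rounds, ih T T']
  rw [key k T ((NExpr.const k).cost + 1)]
  exact ⟨h.mem, h.reg⟩

/-- Induction over the rounds of a loop. -/
theorem exec_loop {r : ℕ} {e : NExpr} {c : Program} {s : Memory} (P : ℕ → Memory → Prop)
    {N : ℕ} (hN : e.eval s = N) (h0 : P 0 s)
    -- Each round may use that `s'` agrees with `s` outside the write set, so `P` has to record only
    -- what the loop changes.
    (hs : ∀ k < N, ∀ s', Agree (.loop r e c) s s' → P k s' →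
      P (k + 1) (c.exec (s'.setReg r k))) :
    P N ((Program.loop r e c).exec s) := by
  have key : ∀ k ≤ N, P k (rounds r c s (e.cost + 1) k).1 := by
    intro k
    induction k with
    | zero => intro _; exact h0
    | succ k ih =>
        intro hk
        exact hs k hk _ (rounds_agree r e c s _ k) (ih (Nat.le_of_succ_le hk))
  rw [Program.exec, run_loop, hN]
  exact key N le_rfl

/-- All loops run for at most `m + n + 1` rounds. -/
def Program.Tame : Program → Prop
  | .skip => True
  | .setReg _ _ => True
  | .setCell _ _ _ _ => True
  | .seq c₁ c₂ => c₁.Tame ∧ c₂.Tame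
  | .ite _ c₁ c₂ => c₁.Tame ∧ c₂.Tame
  | .loop _ e c => (∀ s, e.eval s ≤ s.reg regM + s.reg regClient + 1) ∧ c.Tame

/-- A bound for the running time of a tame program. -/
def Program.timeBound : Program → Polynomial ℕ
  | .skip => 1
  | .setReg _ e => Polynomial.C (e.cost + 1)
  | .setCell _ i j e => Polynomial.C (i.cost + j.cost + e.cost + 1)
  | .seq c₁ c₂ => c₁.timeBound + c₂.timeBound
  | .ite b c₁ c₂ => Polynomial.C b.cost + c₁.timeBound + c₂.timeBound
  | .loop _ e c => Polynomial.C (e.cost + 1) + Polynomial.X * (c.timeBound + 1)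

/-- The two input registers are never written, so the same number m + n + 1 bounds the rounds of
every loop at every nesting depth. -/
theorem steps_le (c : Program) (hc : c.Tame) (h0 : regM ∉ c.regs) (h1 : regClient ∉ c.regs)
    (s : Memory) :
    c.steps s ≤ c.timeBound.eval (s.reg regM + s.reg regClient + 1) := by
  induction c generalizing s with
  | skip => simp [Program.steps, Program.run, Program.timeBound]
  | setReg r e => simp [Program.steps, Program.run, Program.timeBound]
  | setCell arr i j e => simp [Program.steps, Program.run, Program.timeBound]
  | seq c₁ c₂ ih₁ ih₂ =>
      simp only [Program.regs, List.mem_append, not_or] at h0 h1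
      have e1 := ih₁ hc.1 h0.1 h1.1 s
      have e2 := ih₂ hc.2 h0.2 h1.2 (c₁.exec s)
      rw [(exec_agree c₁ s).reg _ h0.1, (exec_agree c₁ s).reg _ h1.1] at e2
      simp only [Program.timeBound, Polynomial.eval_add]
      exact add_le_add e1 e2
  | ite b c₁ c₂ ih₁ ih₂ =>
      simp only [Program.regs, List.mem_append, not_or] at h0 h1
      have e1 := ih₁ hc.1 h0.1 h1.1 s
      have e2 := ih₂ hc.2 h0.2 h1.2 s
      simp only [Program.timeBound, Polynomial.eval_add, Polynomial.eval_C]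
      simp only [Program.steps] at e1 e2 ⊢
      simp only [Program.run]
      split_ifs <;> dsimp only <;> omega
  | loop r e c ih =>
      have h0' : regM ∉ c.regs := fun h => h0 (by simp [Program.regs, h])
      have h1' : regClient ∉ c.regs := fun h => h1 (by simp [Program.regs, h])
      have hr0 : regM ≠ r := fun h => h0 (by simp [Program.regs, h])
      have hr1 : regClient ≠ r := fun h => h1 (by simp [Program.regs, h])
      set X := s.reg regM + s.reg regClient + 1 with hX
      have key : ∀ k, (rounds r c s (e.cost + 1) k).2 ≤
          e.cost + 1 + k * (c.timeBound.eval X + 1) := by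
        intro k
        induction k with
        | zero => simp [rounds]
        | succ k ihk =>
            have ha := rounds_agree r e c s (e.cost + 1) k
            have e2 := ih hc.2 h0' h1' ((rounds r c s (e.cost + 1) k).1.setReg r k)
            rw [Memory.setReg_reg, Memory.setReg_reg, if_neg hr0, if_neg hr1,
              ha.reg _ h0, ha.reg _ h1, ← hX] at e2
            simp only [Program.steps] at e2
            simp only [rounds]
            linarith [Nat.succ_mul k (c.timeBound.eval X + 1)]
      simp only [Program.steps, run_loop, Program.timeBound, Polynomial.eval_add,
        Polynomial.eval_C, Polynomial.eval_mul, Polynomial.eval_X, Polynomial.eval_one]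
      exact (key _).trans (Nat.add_le_add_left (Nat.mul_le_mul_right _ (hc.1 s)) _)

/-- Run `c` for `(m + n + 1) ^ k` times. -/
def Program.times (c : Program) : ℕ → Program
  | 0 => c
  | k + 1 => .loop 7 (.add (.add (.reg regM) (.reg regClient)) (.const 1)) (c.times k)

/-- If every run of `c` makes progress, then enough runs of `c` succeed. -/
theorem exec_times (c : Program) (h0 : regM ∉ c.regs) (h1 : regClient ∉ c.regs)
    (P D : Memory → Prop) (φ : Memory → ℝ)
    (hP : ∀ s, P s → P (c.exec s)) (hD : ∀ s, P s → D s → D (c.exec s))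
    (hφ : ∀ s, P s → ¬ D s → φ s + 1 ≤ φ (c.exec s))
    -- The nested loops all share register 7. A loop sets its counter from the round number, so
    -- overwriting by inner loops does no harm, and only insensitivity of `P`, `D`, `φ` to this
    -- register is needed.
    (hreg : ∀ s k, P s → P (s.setReg 7 k) ∧ (D s ↔ D (s.setReg 7 k)) ∧ φ (s.setReg 7 k) = φ s)
    (k : ℕ) (s : Memory) (hs : P s) :
    P ((c.times k).exec s) ∧ (D s → D ((c.times k).exec s)) ∧
      (¬ D ((c.times k).exec s) →
        φ s + ((s.reg regM + s.reg regClient + 1) ^ k : ℕ) ≤ φ ((c.times k).exec s)) := by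
  have hregs : ∀ k, regM ∉ (c.times k).regs ∧ regClient ∉ (c.times k).regs := by
    intro k
    induction k with
    | zero => exact ⟨h0, h1⟩
    | succ k ih => simpa [Program.times, Program.regs, regM, regClient] using ih
  induction k generalizing s with
  | zero =>
      refine ⟨hP s hs, hD s hs, fun h => ?_⟩
      have := hφ s hs (fun h' => h (hD s hs h'))
      simpa [Program.times] using this
  | succ k ih =>
      set X := s.reg regM + s.reg regClient + 1 with hX
      have := exec_loop (r := 7) (e := .add (.add (.reg regM) (.reg regClient)) (.const 1))
        (c := c.times k) (s := s)
        (fun l s' => P s' ∧ (D s → D s') ∧ (¬ D s' → φ s + (l * X ^ k : ℕ) ≤ φ s'))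
        (N := X) rfl ⟨hs, id, by simp⟩ (by
          rintro l hl s' ha ⟨hp, hd, hf⟩
          obtain ⟨g1, g2, g3⟩ := hreg s' l hp
          obtain ⟨i1, i2, i3⟩ := ih (s'.setReg 7 l) g1
          refine ⟨i1, fun h => i2 (g2.1 (hd h)), fun h => ?_⟩
          have hr : (s'.setReg 7 l).reg regM + (s'.setReg 7 l).reg regClient + 1 = X := by
            have e0 := ha.reg regM (hregs (k + 1)).1
            have e1 := ha.reg regClient (hregs (k + 1)).2
            rw [hX, ← e0, ← e1]
            rfl
          have a1 := i3 h
          rw [hr, g3] at a1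
          -- Success persists, so failure at the end means failure in every earlier round, and the
          -- gains of all rounds add up.
          have a2 := hf (fun h' => h (i2 (g2.1 h')))
          push_cast at a1 a2 ⊢
          linarith)
      refine ⟨this.1, this.2.1, fun h => ?_⟩
      have := this.2.2 h
      rwa [← pow_succ'] at this

/-! ## One multiplicative step -/

/-- Convexity: the power function lies above its tangent at `w`. This controls the effect of raising
the floor. -/
theorem pow_succ_sub_le {t : ℕ} {u w : ℝ} (hu : 0 ≤ u) (huw : u ≤ w) :
    w ^ (t + 1) ≤ u ^ (t + 1) + (t + 1) * (w - u) * w ^ t := by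
  induction t with
  | zero => simp
  | succ t ih =>
      have hw : 0 ≤ w := hu.trans huw
      have h1 : u ^ (t + 1) ≤ w ^ (t + 1) := pow_le_pow_left₀ hu huw _
      have h2 := mul_le_mul_of_nonneg_left ih hw
      have h3 := mul_le_mul_of_nonneg_left h1 (sub_nonneg.2 huw)
      have e1 : w ^ (t + 1 + 1) = w * w ^ (t + 1) := pow_succ' _ _
      have e2 : u ^ (t + 1 + 1) = u * u ^ (t + 1) := pow_succ' _ _
      have e3 : w ^ (t + 1) = w * w ^ t := pow_succ' _ _
      rw [e1, e2]
      push_cast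
      rw [mul_add w] at h2
      have e4 : w * ((t + 1) * (w - u) * w ^ t) = (t + 1) * (w - u) * w ^ (t + 1) := by
        rw [e3]; ring
      rw [e4] at h2
      linarith

/-- With z = (t+1) d/u ≤ 1 one has (1 + d/u)^(t+1) ≤ exp z ≤ 1 + 2z. For relative increments up to
1/(t+1) the first-order growth is thus correct up to a factor 2. -/
theorem add_pow_succ_le {t : ℕ} {u d : ℝ} (hu : 0 < u) (hd : 0 ≤ d) (hdu : d ≤ u / (t + 1)) :
    (u + d) ^ (t + 1) ≤ u ^ (t + 1) + 2 * (t + 1) * (u ^ t * d) := by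
  have hq : (0 : ℝ) < t + 1 := by positivity
  have hz0 : 0 ≤ (t + 1) * (d / u) := by positivity
  have hz1 : (t + 1) * (d / u) ≤ 1 := by
    rw [le_div_iff₀ hq] at hdu
    rw [← mul_div_assoc, div_le_one hu]
    linarith
  have h1 : (1 + d / u) ^ (t + 1) ≤ Real.exp ((t + 1) * (d / u)) := by
    have := Real.add_one_le_exp (d / u)
    calc (1 + d / u) ^ (t + 1) ≤ (Real.exp (d / u)) ^ (t + 1) :=
          pow_le_pow_left₀ (by positivity) (by linarith) _
      _ = Real.exp ((t + 1) * (d / u)) := by rw [← Real.exp_nat_mul]; push_cast; rfl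
  have h2 := Real.abs_exp_sub_one_le (x := (t + 1) * (d / u)) (by rwa [abs_of_nonneg hz0])
  rw [abs_of_nonneg hz0] at h2
  have h3 := (abs_le.1 h2).2
  have e : u + d = u * (1 + d / u) := by field_simp
  rw [e, mul_pow]
  calc u ^ (t + 1) * (1 + d / u) ^ (t + 1)
      ≤ u ^ (t + 1) * (1 + 2 * ((t + 1) * (d / u))) :=
        mul_le_mul_of_nonneg_left (by linarith) (by positivity)
    _ = u ^ (t + 1) + 2 * (t + 1) * (u ^ t * d) := by
        rw [pow_succ]; field_simp

section Step

variable {ρ ι : Type*} [Fintype ρ] [Fintype ι]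

/-- A step in which variable `i` of value `w i` grows by the factor `1 + 1 / (D * g i)`, where `g`
is the gradient of the power sum of the rows `u`: no variable more than doubles, the power sum
grows at most in proportion to the time `1 / D`, and some relative growth is substantial. -/
theorem multiplicative_step [Nonempty ι] (t m : ℕ) (hm : 0 < m) (A : ρ → ι → ℝ)
    (hA : ∀ r i, 0 ≤ A r i) (u : ρ → ℝ) (hu : ∀ r, 0 < u r) (w : ι → ℝ)
    (hw : ∀ i, 1 / (m : ℝ) ≤ w i) (hw2 : ∑ i, w i ≤ 2) (g : ι → ℝ)
    (hg : ∀ i, g i = ∑ r, A r i * u r ^ t) (hg0 : ∀ i, 0 < g i) (D : ℝ)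
    (hD : D = ∑ i, (1 + 2 * (t + 1) * ∑ r, A r i / u r) / g i) :
    0 < D ∧ (∀ i, 1 / (D * g i) ≤ 1) ∧
      ∑ r, (u r + ∑ i, A r i * (w i * (1 / (D * g i)))) ^ (t + 1)
        ≤ ∑ r, u r ^ (t + 1) + 4 * (t + 1) * (1 / D) ∧
      1 / (2 * (t + 1) * m) ≤ ∑ i, m * (w i * (1 / (D * g i)))
        + ∑ r, (∑ i, A r i * (w i * (1 / (D * g i)))) / u r := by
  have hmR : (0 : ℝ) < m := by exact_mod_cast hm
  have hw0 : ∀ i, 0 ≤ w i := fun i => le_trans (by positivity) (hw i)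
  have hrel : ∀ i, 0 ≤ ∑ r, A r i / u r :=
    fun i => Finset.sum_nonneg fun r _ => div_nonneg (hA r i) (hu r).le
  have hterm : ∀ i, 0 < (1 + 2 * (t + 1) * ∑ r, A r i / u r) / g i := fun i => by
    have := hrel i
    have := hg0 i
    positivity
  have hD0 : 0 < D := by
    rw [hD]
    exact Finset.sum_pos (fun i _ => hterm i) Finset.univ_nonempty
  set l : ι → ℝ := fun i => 1 / (D * g i) with hl
  have hl0 : ∀ i, 0 < l i := fun i => by have := hg0 i; positivity
  have hlg : ∀ i, g i * l i = 1 / D := fun i => by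
    have := (hg0 i).ne'
    simp only [hl]; field_simp
  -- `D` is a sum of positive terms and dominates each of them. Both caps on the step length follow:
  -- `l i ≤ 1`, and `A r i * l i ≤ u r / (2 * (t + 1))`.
  have hle : ∀ i, l i * (1 + 2 * (t + 1) * ∑ r, A r i / u r) ≤ 1 := fun i => by
    have h1 : (1 + 2 * (t + 1) * ∑ r, A r i / u r) / g i ≤ D := by
      conv_rhs => rw [hD]
      exact Finset.single_le_sum
        (f := fun i => (1 + 2 * (t + 1) * ∑ r, A r i / u r) / g i)
        (fun i _ => (hterm i).le) (Finset.mem_univ i)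
    rw [div_le_iff₀ (hg0 i)] at h1
    simp only [hl]
    rw [one_div, inv_mul_le_iff₀ (mul_pos hD0 (hg0 i)), mul_one]
    exact h1
  have hcap : ∀ r i, A r i * l i ≤ u r / (2 * (t + 1)) := fun r i => by
    have h1 : A r i / u r ≤ ∑ r, A r i / u r :=
      Finset.single_le_sum (f := fun r => A r i / u r)
        (fun r _ => div_nonneg (hA r i) (hu r).le) (Finset.mem_univ r)
    have h2 : l i * (2 * (t + 1) * (A r i / u r)) ≤ 1 := by
      refine le_trans (mul_le_mul_of_nonneg_left ?_ (hl0 i).le) (hle i)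
      have : 2 * ((t : ℝ) + 1) * (A r i / u r) ≤ 2 * (t + 1) * ∑ r, A r i / u r :=
        mul_le_mul_of_nonneg_left h1 (by positivity)
      linarith
    have e : l i * (2 * (t + 1) * (A r i / u r)) = A r i * l i * (2 * (t + 1)) / u r := by ring
    rw [e, div_le_one (hu r)] at h2
    rwa [le_div_iff₀ (by positivity)]
  have hd0 : ∀ r, 0 ≤ ∑ i, A r i * (w i * l i) := fun r =>
    Finset.sum_nonneg fun i _ => mul_nonneg (hA r i) (mul_nonneg (hw0 i) (hl0 i).le)
  refine ⟨hD0, fun i => ?_, ?_, ?_⟩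
  · refine le_trans ?_ (hle i)
    have := mul_nonneg (hl0 i).le (mul_nonneg (by positivity : (0 : ℝ) ≤ 2 * (t + 1)) (hrel i))
    change l i ≤ _
    linarith
  -- The total of `w` is at most 2, so each row grows by at most the fraction 1/(t+1) that
  -- `add_pow_succ_le` allows.
  · have hd : ∀ r, ∑ i, A r i * (w i * l i) ≤ u r / (t + 1) := fun r => by
      calc ∑ i, A r i * (w i * l i) ≤ ∑ i, w i * (u r / (2 * (t + 1))) :=
            Finset.sum_le_sum fun i _ => by
              have := mul_le_mul_of_nonneg_left (hcap r i) (hw0 i)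
              linarith
        _ = (∑ i, w i) * (u r / (2 * (t + 1))) := by rw [Finset.sum_mul]
        _ ≤ 2 * (u r / (2 * (t + 1))) := by
            have := (hu r).le
            exact mul_le_mul_of_nonneg_right hw2 (by positivity)
        _ = u r / (t + 1) := by field_simp
    calc ∑ r, (u r + ∑ i, A r i * (w i * l i)) ^ (t + 1)
        ≤ ∑ r, (u r ^ (t + 1) + 2 * (t + 1) * (u r ^ t * ∑ i, A r i * (w i * l i))) :=
          Finset.sum_le_sum fun r _ => add_pow_succ_le (hu r) (hd0 r) (hd r)
      _ = ∑ r, u r ^ (t + 1)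
            + 2 * (t + 1) * ∑ r, ∑ i, (A r i * u r ^ t) * (w i * l i) := by
          rw [Finset.sum_add_distrib, Finset.mul_sum]
          congr 1
          refine Finset.sum_congr rfl fun r _ => ?_
          rw [Finset.mul_sum]
          congr 1
          exact Finset.sum_congr rfl fun i _ => by ring
      -- Summing over rows first produces the gradient, and `g i * l i = 1 / D` is the same for all
      -- variables.
      _ = ∑ r, u r ^ (t + 1) + 2 * (t + 1) * ∑ i, w i * (1 / D) := by
          rw [Finset.sum_comm]
          congr 2
          refine Finset.sum_congr rfl fun i _ => ?_
          rw [← Finset.sum_mul, ← hg, ← hlg i]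
          ring
      _ ≤ ∑ r, u r ^ (t + 1) + 4 * (t + 1) * (1 / D) := by
          rw [← Finset.sum_mul]
          have h1 : (∑ i, w i) * (1 / D) ≤ 2 * (1 / D) :=
            mul_le_mul_of_nonneg_right hw2 (by positivity)
          have h2 := mul_le_mul_of_nonneg_left h1 (by positivity : (0 : ℝ) ≤ 2 * (t + 1))
          linarith
  -- `D` is chosen so that these quantities sum to exactly 1, hence the step is not too short. The
  -- bound `w i ≥ 1 / m` converts the two parts of the sum into growth of variables and relative
  -- growth of rows.
  · have hone : ∑ i, l i * (1 + 2 * (t + 1) * ∑ r, A r i / u r) = 1 := by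
      have : ∀ i, l i * (1 + 2 * (t + 1) * ∑ r, A r i / u r)
          = (1 + 2 * (t + 1) * ∑ r, A r i / u r) / g i * (1 / D) := fun i => by
        simp only [hl]
        have := (hg0 i).ne'
        field_simp
      rw [Finset.sum_congr rfl fun i _ => this i, ← Finset.sum_mul, ← hD]
      field_simp
    have h1 : ∀ i, l i ≤ m * (w i * l i) := fun i => by
      have := hw i
      rw [div_le_iff₀ hmR] at this
      have := mul_le_mul_of_nonneg_right this (hl0 i).le
      linarith
    have h2 : ∑ r, (∑ i, A r i * (w i * l i)) / u r
        ≥ ∑ i, (1 / m) * (l i * ∑ r, A r i / u r) := by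
      simp only [Finset.sum_div, Finset.mul_sum]
      rw [Finset.sum_comm]
      refine Finset.sum_le_sum fun i _ => Finset.sum_le_sum fun r _ => ?_
      have h3 : 0 ≤ l i * (A r i / u r) := mul_nonneg (hl0 i).le (div_nonneg (hA r i) (hu r).le)
      have h4 := mul_le_mul_of_nonneg_right (hw i) h3
      calc 1 / (m : ℝ) * (l i * (A r i / u r)) ≤ w i * (l i * (A r i / u r)) := h4
        _ = A r i * (w i * l i) / u r := by ring
    have h5 : ∀ i, 1 / (2 * (t + 1) * m) * (l i * (1 + 2 * (t + 1) * ∑ r, A r i / u r))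
        ≤ m * (w i * l i) + (1 / m) * (l i * ∑ r, A r i / u r) := fun i => by
      have e : 1 / (2 * (t + 1) * m) * (l i * (1 + 2 * (t + 1) * ∑ r, A r i / u r))
          = 1 / (2 * (t + 1) * m) * l i + (1 / m) * (l i * ∑ r, A r i / u r) := by
        field_simp
      have h6 : 1 / (2 * ((t : ℝ) + 1) * m) ≤ 1 := by
        rw [div_le_one (by positivity)]
        have : (1 : ℝ) ≤ m := by exact_mod_cast hm
        nlinarith [(Nat.cast_nonneg t : (0 : ℝ) ≤ t)]
      have h7 := mul_le_mul_of_nonneg_right h6 (hl0 i).le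
      rw [e]
      linarith [h1 i]
    calc 1 / (2 * ((t : ℝ) + 1) * m)
        = ∑ i, 1 / (2 * ((t : ℝ) + 1) * m) * (l i * (1 + 2 * (t + 1) * ∑ r, A r i / u r)) := by
          rw [← Finset.mul_sum, hone, mul_one]
      _ ≤ ∑ i, (m * (w i * l i) + (1 / m) * (l i * ∑ r, A r i / u r)) :=
          Finset.sum_le_sum fun i _ => h5 i
      _ ≤ _ := by
          rw [Finset.sum_add_distrib]
          exact add_le_add le_rfl h2

/-- Every term u^t (u - D) is at least -D^(t+1), whereas a row above 2D would contribute more than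
2^t D^(t+1), which the other rows, at most 2^t in number, cannot offset. This passes from power sums
to the largest row at the loss of a factor 2. -/
theorem le_of_sum_pow_succ_le {t : ℕ} {u : ρ → ℝ} (hu : ∀ r, 0 ≤ u r) {D : ℝ} (hD : 0 ≤ D)
    (hcard : Fintype.card ρ ≤ 2 ^ t) (h : ∑ r, u r ^ (t + 1) ≤ D * ∑ r, u r ^ t) (r : ρ) :
    u r ≤ 2 * D := by
  classical
  by_contra! hr
  have hterm : ∀ r', -(D ^ (t + 1)) ≤ u r' ^ (t + 1) - D * u r' ^ t := fun r' => by
    have e : u r' ^ (t + 1) - D * u r' ^ t = u r' ^ t * (u r' - D) := by ring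
    rw [e]
    rcases le_total D (u r') with h1 | h1
    · have := mul_nonneg (pow_nonneg (hu r') t) (sub_nonneg.2 h1)
      have := pow_nonneg hD (t + 1)
      linarith
    · have h2 : u r' ^ t ≤ D ^ t := pow_le_pow_left₀ (hu r') h1 t
      have h3 : u r' ^ t * (D - u r') ≤ D ^ t * D :=
        mul_le_mul h2 (by linarith [hu r']) (by linarith) (pow_nonneg hD t)
      rw [← pow_succ] at h3
      linarith
  have hur : 0 < u r := by linarith
  have hbig : 2 ^ t * D ^ (t + 1) < u r ^ (t + 1) - D * u r ^ t := by
    have h1 : (2 * D) ^ t ≤ u r ^ t := pow_le_pow_left₀ (by positivity) hr.le t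
    have h2 : (2 * D) ^ t * D ≤ u r ^ t * D := mul_le_mul_of_nonneg_right h1 hD
    have h3 : u r ^ t * (2 * D) < u r ^ t * u r := mul_lt_mul_of_pos_left hr (pow_pos hur t)
    rw [mul_pow] at h2
    rw [pow_succ, pow_succ]
    linarith
  have hsum : ∑ r', (u r' ^ (t + 1) - D * u r' ^ t) ≤ 0 := by
    rw [Finset.sum_sub_distrib, ← Finset.mul_sum]
    linarith
  rw [← Finset.add_sum_erase _ _ (Finset.mem_univ r)] at hsum
  have hrest : -(2 ^ t * D ^ (t + 1)) ≤
      ∑ r' ∈ Finset.univ.erase r, (u r' ^ (t + 1) - D * u r' ^ t) := by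
    have h1 := Finset.card_nsmul_le_sum (Finset.univ.erase r)
      (fun r' => u r' ^ (t + 1) - D * u r' ^ t) (-(D ^ (t + 1))) fun r' _ => hterm r'
    refine le_trans ?_ h1
    rw [nsmul_eq_mul]
    have h2 : ((Finset.univ.erase r).card : ℝ) ≤ 2 ^ t := by
      have : (Finset.univ.erase r).card ≤ 2 ^ t :=
        (Finset.card_le_univ _).trans hcard
      exact_mod_cast this
    have := mul_le_mul_of_nonneg_right h2 (pow_nonneg hD (t + 1))
    linarith
  linarith

end Step

/-! ## The potential -/

variable {m : ℕ}

/-- The rows of the objective: the opening cost, the assignment cost and the loads. -/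
def rows (I : Instance m) (n : ℕ) (x : Fin m → ℝ) (y : Fin m → ℕ → ℝ) :
    Option (Option (Fin m)) → ℝ
  | none => ∑ i, I.opening i * x i
  | some none => ∑ i, ∑ j ∈ Finset.range (n + 1), I.assign i j * y i j
  | some (some i) => ∑ j ∈ Finset.range (n + 1), I.load i j * y i j

/-- The gradient of the power sum at `y i j`. -/
def slope (I : Instance m) (t : ℕ) (u : Option (Option (Fin m)) → ℝ) (i : Fin m) (j : ℕ) : ℝ :=
  I.assign i j * u (some none) ^ t + I.load i j * u (some (some i)) ^ t

/-- The value of the dual variables that the algorithm has collected. -/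
def potential (I : Instance m) (n t : ℕ) (u : Option (Option (Fin m)) → ℝ)
    (x : Fin m → ℝ) (y : Fin m → ℕ → ℝ) (xs : Fin m → ℝ) (ys : Fin m → ℕ → ℝ) : ℝ :=
  ∑ i, xs i * (I.opening i * u none ^ t) * Real.log (m * x i + 1)
    + ∑ i, ∑ j ∈ Finset.range (n + 1), ys i j * slope I t u i j * Real.log (m * y i j + 1)

/-- The cost of serving client `j` by facility `i` alone. -/
def fullCost (I : Instance m) (i : Fin m) (j : ℕ) : ℝ :=
  I.opening i + I.assign i j + I.load i j

/-- The clients whose cheapest facility is accounted for by the floor `θ`. -/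
def Accounted (I : Instance m) (θ : ℝ) (j : ℕ) : Prop :=
  ∃ i, fullCost I i j ≤ 2 * m * θ

/-- The invariant of the algorithm. -/
structure Inv (I : Instance m) (n t : ℕ) (θ : ℝ) (x : Fin m → ℝ) (y : Fin m → ℕ → ℝ) : Prop where
  x_nonneg : ∀ i, 0 ≤ x i
  x_le : ∀ i, x i ≤ 4
  y_nonneg : ∀ i, ∀ j ≤ n, 0 ≤ y i j
  y_le : ∀ i, ∀ j ≤ n, y i j ≤ 4
  floor_nonneg : 0 ≤ θ
  -- The floor never exceeds the largest row of a feasible solution, so adding it to every row does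
  -- not spoil the competitive ratio.
  floor_le : ∀ xs ys, Feasible (n + 1) xs ys → ∀ b, (∀ r, rows I n xs ys r ≤ b) → θ ≤ b
  -- Only accounted clients have to be covered by the comparison solution. The competitive ratio
  -- uses this for feasible solutions, the running time for the solution of `exists_cheap_cover`,
  -- which ignores all other clients.
  power_le : ∀ xs ys, (∀ i, 0 ≤ xs i) → (∀ i, ∀ j ≤ n, 0 ≤ ys i j) →
    (∀ j ≤ n, Accounted I θ j → ∀ S, 1 ≤ coverage xs ys j S) →
    ∑ r, (rows I n x y r + θ) ^ (t + 1)
      ≤ (t + 1) * θ * ∑ r, (rows I n x y r + θ) ^ t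
        + 8 * (t + 1) * potential I n t (fun r => rows I n x y r + θ) x y xs ys

theorem rows_nonneg (I : Instance m) (n : ℕ) {x : Fin m → ℝ} {y : Fin m → ℕ → ℝ}
    (hx : ∀ i, 0 ≤ x i) (hy : ∀ i, ∀ j ≤ n, 0 ≤ y i j) (r) : 0 ≤ rows I n x y r := by
  have hy' : ∀ i, ∀ j ∈ Finset.range (n + 1), 0 ≤ y i j := fun i j hj =>
    hy i j (Nat.lt_succ_iff.1 (Finset.mem_range.1 hj))
  rcases r with _ | _ | i
  · exact Finset.sum_nonneg fun i _ => mul_nonneg (I.opening_nonneg i) (hx i)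
  · exact Finset.sum_nonneg fun i _ => Finset.sum_nonneg fun j hj =>
      mul_nonneg (I.assign_nonneg i j) (hy' i j hj)
  · exact Finset.sum_nonneg fun j hj => mul_nonneg (I.load_nonneg i j) (hy' i j hj)

theorem slope_nonneg (I : Instance m) (t : ℕ) {u : Option (Option (Fin m)) → ℝ}
    (hu : ∀ r, 0 ≤ u r) (i : Fin m) (j : ℕ) : 0 ≤ slope I t u i j :=
  add_nonneg (mul_nonneg (I.assign_nonneg i j) (pow_nonneg (hu _) _))
    (mul_nonneg (I.load_nonneg i j) (pow_nonneg (hu _) _))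

theorem slope_mono (I : Instance m) (t : ℕ) {u u' : Option (Option (Fin m)) → ℝ}
    (hu : ∀ r, 0 ≤ u r) (huu : ∀ r, u r ≤ u' r) (i : Fin m) (j : ℕ) :
    slope I t u i j ≤ slope I t u' i j :=
  add_le_add
    (mul_le_mul_of_nonneg_left (pow_le_pow_left₀ (hu _) (huu _) _) (I.assign_nonneg i j))
    (mul_le_mul_of_nonneg_left (pow_le_pow_left₀ (hu _) (huu _) _) (I.load_nonneg i j))

theorem log_mul_add_one_mono (m : ℕ) {a b : ℝ} (ha : 0 ≤ a) (hab : a ≤ b) :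
    Real.log (m * a + 1) ≤ Real.log (m * b + 1) :=
  Real.log_le_log (by positivity)
    (by linarith [mul_le_mul_of_nonneg_left hab (Nat.cast_nonneg m : (0 : ℝ) ≤ m)])

theorem log_mul_add_one_nonneg (m : ℕ) {a : ℝ} (ha : 0 ≤ a) : 0 ≤ Real.log (m * a + 1) :=
  Real.log_nonneg (by have : 0 ≤ (m : ℝ) * a := by positivity
                      linarith)

/-- Gradients and logarithms are monotone, so dual value collected at earlier, smaller gradients may
be evaluated at the current ones. -/
theorem potential_mono (I : Instance m) (n t : ℕ) {u u' : Option (Option (Fin m)) → ℝ}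
    (hu : ∀ r, 0 ≤ u r) (huu : ∀ r, u r ≤ u' r)
    {x x' : Fin m → ℝ} {y y' : Fin m → ℕ → ℝ} (hx : ∀ i, 0 ≤ x i) (hxx : ∀ i, x i ≤ x' i)
    (hy : ∀ i, ∀ j ≤ n, 0 ≤ y i j) (hyy : ∀ i, ∀ j ≤ n, y i j ≤ y' i j)
    {xs : Fin m → ℝ} {ys : Fin m → ℕ → ℝ} (hxs : ∀ i, 0 ≤ xs i)
    (hys : ∀ i, ∀ j ≤ n, 0 ≤ ys i j) :
    potential I n t u x y xs ys ≤ potential I n t u' x' y' xs ys := by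
  have hu' : ∀ r, 0 ≤ u' r := fun r => (hu r).trans (huu r)
  refine add_le_add (Finset.sum_le_sum fun i _ => ?_)
    (Finset.sum_le_sum fun i _ => Finset.sum_le_sum fun j hj => ?_)
  · refine mul_le_mul ?_ (log_mul_add_one_mono m (hx i) (hxx i))
      (log_mul_add_one_nonneg m (hx i))
      (mul_nonneg (hxs i) (mul_nonneg (I.opening_nonneg i) (pow_nonneg (hu' _) _)))
    exact mul_le_mul_of_nonneg_left (mul_le_mul_of_nonneg_left
      (pow_le_pow_left₀ (hu _) (huu _) _) (I.opening_nonneg i)) (hxs i)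
  · have hj' : j ≤ n := Nat.lt_succ_iff.1 (Finset.mem_range.1 hj)
    refine mul_le_mul ?_ (log_mul_add_one_mono m (hy i j hj') (hyy i j hj'))
      (log_mul_add_one_nonneg m (hy i j hj'))
      (mul_nonneg (hys i j hj') (slope_nonneg I t hu' i j))
    exact mul_le_mul_of_nonneg_left (slope_mono I t hu huu i j) (hys i j hj')

/-! ### Preservation of the invariant -/

theorem inv_zero (I : Instance m) (t : ℕ) {y : Fin m → ℕ → ℝ} (hy : ∀ i, y i 0 = 0) :
    Inv I 0 t 0 (fun _ => 0) y := by
  have hr : ∀ r, rows I 0 (fun _ => 0) y r = 0 := by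
    rintro (_ | _ | i) <;> simp [rows, hy]
  refine ⟨fun _ => le_rfl, fun _ => by norm_num, ?_, ?_, le_rfl, ?_, ?_⟩
  · intro i j hj
    obtain rfl : j = 0 := by omega
    rw [hy]
  · intro i j hj
    obtain rfl : j = 0 := by omega
    rw [hy]; norm_num
  · intro xs ys hf b hb
    exact (rows_nonneg I 0 hf.1 (fun i j hj => hf.2.1 i j (by omega)) none).trans (hb none)
  · intro xs ys _ _ _
    simp [hr, potential, hy]

theorem rows_succ (I : Instance m) (n : ℕ) (x : Fin m → ℝ) {y y' : Fin m → ℕ → ℝ}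
    (hy : ∀ i, ∀ j ≤ n, y' i j = y i j) (hy' : ∀ i, y' i (n + 1) = 0) (r) :
    rows I (n + 1) x y' r = rows I n x y r := by
  have h : ∀ i, ∀ f : ℕ → ℝ, ∑ j ∈ Finset.range (n + 1 + 1), f j * y' i j
      = ∑ j ∈ Finset.range (n + 1), f j * y i j := fun i f => by
    rw [Finset.sum_range_succ, hy', mul_zero, add_zero]
    exact Finset.sum_congr rfl fun j hj => by
      rw [hy i j (Nat.lt_succ_iff.1 (Finset.mem_range.1 hj))]
  rcases r with _ | _ | i
  · rfl
  · exact Finset.sum_congr rfl fun i _ => h i _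
  · exact h i _

theorem rows_le_succ (I : Instance m) (n : ℕ) (x : Fin m → ℝ) {y : Fin m → ℕ → ℝ}
    (hy : ∀ i, ∀ j ≤ n + 1, 0 ≤ y i j) (r) : rows I n x y r ≤ rows I (n + 1) x y r := by
  rcases r with _ | _ | i
  · exact le_rfl
  · refine Finset.sum_le_sum fun i _ => ?_
    rw [Finset.sum_range_succ _ (n + 1)]
    linarith [mul_nonneg (I.assign_nonneg i (n + 1)) (hy i _ le_rfl)]
  · change _ ≤ ∑ j ∈ Finset.range (n + 1 + 1), I.load i j * y i j
    rw [Finset.sum_range_succ _ (n + 1)]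
    exact le_add_of_nonneg_right (mul_nonneg (I.load_nonneg i (n + 1)) (hy i _ le_rfl))

/-- The new column of `y` is zero and adds nothing to the rows or the potential, while the demands
on comparison solutions only become stronger. -/
theorem Inv.arrive {I : Instance m} {n t : ℕ} {θ : ℝ} {x : Fin m → ℝ} {y y' : Fin m → ℕ → ℝ}
    (h : Inv I n t θ x y) (hy : ∀ i, ∀ j ≤ n, y' i j = y i j) (hy' : ∀ i, y' i (n + 1) = 0) :
    Inv I (n + 1) t θ x y' := by
  refine ⟨h.x_nonneg, h.x_le, ?_, ?_, h.floor_nonneg, ?_, ?_⟩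
  · intro i j hj
    rcases Nat.le_succ_iff.1 hj with hj | rfl
    · rw [hy i j hj]; exact h.y_nonneg i j hj
    · rw [hy']
  · intro i j hj
    rcases Nat.le_succ_iff.1 hj with hj | rfl
    · rw [hy i j hj]; exact h.y_le i j hj
    · rw [hy']; norm_num
  · intro xs ys hf b hb
    refine h.floor_le xs ys ⟨hf.1, fun i j hj => hf.2.1 i j (by omega),
      fun j hj => hf.2.2 j (by omega)⟩ b fun r => ?_
    exact (rows_le_succ I n xs (fun i j hj => hf.2.1 i j (by omega)) r).trans (hb r)
  · intro xs ys hxs hys hc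
    have hp := h.power_le xs ys hxs (fun i j hj => hys i j (by omega))
      (fun j hj => hc j (by omega))
    simp only [rows_succ I n x hy hy']
    refine hp.trans_eq ?_
    congr 2
    unfold potential
    congr 1
    refine Finset.sum_congr rfl fun i _ => ?_
    rw [Finset.sum_range_succ _ (n + 1), hy', mul_zero, zero_add, Real.log_one, mul_zero, add_zero]
    exact Finset.sum_congr rfl fun j hj => by
      rw [hy i j (Nat.lt_succ_iff.1 (Finset.mem_range.1 hj))]

/-- Variables without cost may be raised. -/
theorem Inv.raise {I : Instance m} {n t : ℕ} {θ : ℝ} {x x' : Fin m → ℝ} {y y' : Fin m → ℕ → ℝ}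
    (h : Inv I n t θ x y) (hx : ∀ i, x' i = x i ∨ I.opening i = 0 ∧ x' i = 4)
    (hy : ∀ i, ∀ j ≤ n, y' i j = y i j ∨ (I.assign i j = 0 ∧ I.load i j = 0) ∧ y' i j = 4) :
    Inv I n t θ x' y' := by
  have hxx : ∀ i, x i ≤ x' i := fun i => by
    rcases hx i with e | ⟨_, e⟩ <;> rw [e]
    exact h.x_le i
  have hyy : ∀ i, ∀ j ≤ n, y i j ≤ y' i j := fun i j hj => by
    rcases hy i j hj with e | ⟨_, e⟩ <;> rw [e]
    exact h.y_le i j hj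
  have hr : rows I n x' y' = rows I n x y := by
    have ha : ∀ i, ∀ j ∈ Finset.range (n + 1), I.assign i j * y' i j = I.assign i j * y i j :=
      fun i j hj => by
        rcases hy i j (Nat.lt_succ_iff.1 (Finset.mem_range.1 hj)) with e | ⟨e, _⟩
        · rw [e]
        · rw [e.1, zero_mul, zero_mul]
    have hl : ∀ i, ∀ j ∈ Finset.range (n + 1), I.load i j * y' i j = I.load i j * y i j :=
      fun i j hj => by
        rcases hy i j (Nat.lt_succ_iff.1 (Finset.mem_range.1 hj)) with e | ⟨e, _⟩
        · rw [e]
        · rw [e.2, zero_mul, zero_mul]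
    funext r
    rcases r with _ | _ | i
    · refine Finset.sum_congr rfl fun i _ => ?_
      rcases hx i with e | ⟨e, _⟩
      · rw [e]
      · rw [e, zero_mul, zero_mul]
    · exact Finset.sum_congr rfl fun i _ => Finset.sum_congr rfl (ha i)
    · exact Finset.sum_congr rfl (hl i)
  refine ⟨fun i => (h.x_nonneg i).trans (hxx i), fun i => ?_,
    fun i j hj => (h.y_nonneg i j hj).trans (hyy i j hj), fun i j hj => ?_,
    h.floor_nonneg, h.floor_le, fun xs ys hxs hys hc => ?_⟩
  · rcases hx i with e | ⟨_, e⟩ <;> rw [e]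
    exact h.x_le i
  · rcases hy i j hj with e | ⟨_, e⟩ <;> rw [e]
    exact h.y_le i j hj
  · rw [hr]
    refine (h.power_le xs ys hxs hys hc).trans (add_le_add le_rfl
      (mul_le_mul_of_nonneg_left ?_ (by positivity)))
    exact potential_mono I n t
      (fun r => add_nonneg (rows_nonneg I n h.x_nonneg h.y_nonneg r) h.floor_nonneg)
      (fun _ => le_rfl) h.x_nonneg hxx h.y_nonneg hyy hxs hys

/-- By convexity the power sum grows by at most (t+1)(θ' - θ) Σ u'^t, which is absorbed by the
change of the floor term. A larger floor accounts for more clients, so fewer comparison solutions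
have to be considered. -/
theorem Inv.raise_floor {I : Instance m} {n t : ℕ} {θ θ' : ℝ} {x : Fin m → ℝ}
    {y : Fin m → ℕ → ℝ} (h : Inv I n t θ x y) (hθ : θ ≤ θ')
    (hle : ∀ xs ys, Feasible (n + 1) xs ys → ∀ b, (∀ r, rows I n xs ys r ≤ b) → θ' ≤ b) :
    Inv I n t θ' x y := by
  have h0 := h.floor_nonneg
  have hr := rows_nonneg I n h.x_nonneg h.y_nonneg
  refine ⟨h.x_nonneg, h.x_le, h.y_nonneg, h.y_le, h0.trans hθ, hle, ?_⟩
  intro xs ys hxs hys hc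
  have hp := h.power_le xs ys hxs hys fun j hj ⟨i, hi⟩ => hc j hj
    ⟨i, hi.trans (mul_le_mul_of_nonneg_left hθ (by positivity))⟩
  have hm := potential_mono I n t (u := fun r => rows I n x y r + θ)
    (u' := fun r => rows I n x y r + θ') (fun r => add_nonneg (hr r) h0)
    (fun r => by linarith) h.x_nonneg (fun _ => le_rfl) h.y_nonneg (fun _ _ _ => le_rfl) hxs hys
  have h1 : ∑ r, (rows I n x y r + θ') ^ (t + 1) ≤ ∑ r, (rows I n x y r + θ) ^ (t + 1)
      + (t + 1) * (θ' - θ) * ∑ r, (rows I n x y r + θ') ^ t := by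
    rw [Finset.mul_sum, ← Finset.sum_add_distrib]
    refine Finset.sum_le_sum fun r _ => ?_
    have := pow_succ_sub_le (t := t) (u := rows I n x y r + θ) (w := rows I n x y r + θ')
      (add_nonneg (hr r) h0) (by linarith)
    rwa [add_sub_add_left_eq_sub] at this
  have h2 : ∑ r, (rows I n x y r + θ) ^ t ≤ ∑ r, (rows I n x y r + θ') ^ t :=
    Finset.sum_le_sum fun r _ => pow_le_pow_left₀ (add_nonneg (hr r) h0) (by linarith) _
  have h3 := mul_le_mul_of_nonneg_left h2 (by positivity : 0 ≤ ((t : ℝ) + 1) * θ)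
  have h4 := mul_le_mul_of_nonneg_left hm (by positivity : (0 : ℝ) ≤ 8 * (t + 1))
  linarith

/-! ### Comparison solutions and the bound on the rows -/

/-- A feasible solution pays for the cheapest facility of every client. -/
theorem cheapest_le {I : Instance m} {n : ℕ} (hm : 2 ≤ m) {xs : Fin m → ℝ} {ys : Fin m → ℕ → ℝ}
    (hf : Feasible (n + 1) xs ys) {b : ℝ} (hb : ∀ r, rows I n xs ys r ≤ b) {μ : ℝ} (hμ0 : 0 ≤ μ)
    (hμ : ∀ i, μ ≤ fullCost I i n) : μ / (2 * m) ≤ b := by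
  classical
  have hys : ∀ i, ∀ j ≤ n, 0 ≤ ys i j := fun i j hj => hf.2.1 i j (by omega)
  have hb0 : 0 ≤ b := (rows_nonneg I n hf.1 hys none).trans (hb none)
  -- The exponentially many constraints of a client are equivalent to this one, which is the
  -- constraint of the set where `xs` is below `ys`.
  have hmin : 1 ≤ ∑ i, min (xs i) (ys i n) := by
    have := hf.2.2 n (by omega) (Finset.univ.filter fun i => xs i < ys i n)
    rw [coverage, Finset.compl_filter, Finset.sum_filter, Finset.sum_filter,
      ← Finset.sum_add_distrib] at this
    refine this.trans_eq (Finset.sum_congr rfl fun i _ => ?_)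
    by_cases h : xs i < ys i n
    · simp [h, h.le]
    · simp [h, not_lt.1 h]
  have h1 : μ ≤ ∑ i, fullCost I i n * min (xs i) (ys i n) := by
    have : μ * 1 ≤ μ * ∑ i, min (xs i) (ys i n) := mul_le_mul_of_nonneg_left hmin hμ0
    rw [mul_one, Finset.mul_sum] at this
    refine this.trans (Finset.sum_le_sum fun i _ =>
      mul_le_mul_of_nonneg_right (hμ i) (le_min (hf.1 i) (hys i n le_rfl)))
  have h2 : ∑ i, fullCost I i n * min (xs i) (ys i n) ≤ ∑ r, rows I n xs ys r := by
    rw [Fintype.sum_option, Fintype.sum_option]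
    simp only [rows]
    rw [← add_assoc, ← Finset.sum_add_distrib, ← Finset.sum_add_distrib]
    refine Finset.sum_le_sum fun i _ => ?_
    have ha : I.assign i n * ys i n ≤ ∑ j ∈ Finset.range (n + 1), I.assign i j * ys i j :=
      Finset.single_le_sum (f := fun j => I.assign i j * ys i j) (fun j hj =>
        mul_nonneg (I.assign_nonneg i j) (hys i j (Nat.lt_succ_iff.1 (Finset.mem_range.1 hj))))
        (Finset.self_mem_range_succ n)
    have hl : I.load i n * ys i n ≤ ∑ j ∈ Finset.range (n + 1), I.load i j * ys i j :=
      Finset.single_le_sum (f := fun j => I.load i j * ys i j) (fun j hj =>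
        mul_nonneg (I.load_nonneg i j) (hys i j (Nat.lt_succ_iff.1 (Finset.mem_range.1 hj))))
        (Finset.self_mem_range_succ n)
    have h3 := mul_le_mul_of_nonneg_left (min_le_left (xs i) (ys i n)) (I.opening_nonneg i)
    have h4 := mul_le_mul_of_nonneg_left (min_le_right (xs i) (ys i n)) (I.assign_nonneg i n)
    have h5 := mul_le_mul_of_nonneg_left (min_le_right (xs i) (ys i n)) (I.load_nonneg i n)
    rw [fullCost, add_mul, add_mul]
    linarith
  have h3 : ∑ r, rows I n xs ys r ≤ (m + 2) * b := by
    refine (Finset.sum_le_card_nsmul _ _ b fun r _ => hb r).trans_eq ?_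
    simp only [Finset.card_univ, Fintype.card_option, Fintype.card_fin, nsmul_eq_mul]
    push_cast
    ring
  have hm' : (2 : ℝ) ≤ m := by exact_mod_cast hm
  rw [div_le_iff₀ (by positivity)]
  -- There are m + 2 rows, at most 2m of them since m ≥ 2; this is the origin of the denominator.
  have : (m + 2) * b ≤ b * (2 * m) := by nlinarith
  linarith

/-- A cheap solution for the clients that are accounted for. -/
theorem exists_cheap_cover (I : Instance m) (n : ℕ) {θ : ℝ} (hθ : 0 ≤ θ) :
    ∃ (xs : Fin m → ℝ) (ys : Fin m → ℕ → ℝ), (∀ i, 0 ≤ xs i) ∧ (∀ i, ∀ j ≤ n, 0 ≤ ys i j) ∧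
      (∀ j ≤ n, Accounted I θ j → ∀ S, 1 ≤ coverage xs ys j S) ∧
      ∀ r, rows I n xs ys r ≤ (n + 1) * (2 * m * θ) := by
  classical
  -- Each accounted client is served entirely by one affordable facility. Taking the sum over
  -- clients for `x`, possibly above 1, pays the opening cost once per client and makes the total
  -- cost a sum of full costs.
  set z : Fin m → ℕ → ℝ := fun i j =>
    if h : Accounted I θ j then (if i = h.choose then 1 else 0) else 0 with hz
  have hz0 : ∀ i j, 0 ≤ z i j := fun i j => by
    simp only [hz]; split_ifs <;> norm_num
  have hz1 : ∀ j (h : Accounted I θ j), z h.choose j = 1 := fun j h => by simp [hz, h]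
  have hcost : ∑ i, ∑ j ∈ Finset.range (n + 1), fullCost I i j * z i j
      ≤ (n + 1) * (2 * m * θ) := by
    rw [Finset.sum_comm]
    refine (Finset.sum_le_card_nsmul _ _ (2 * m * θ) fun j _ => ?_).trans_eq
      (by simp [nsmul_eq_mul])
    by_cases h : Accounted I θ j
    · simpa [hz, h] using h.choose_spec
    · simp only [hz, h, dite_false, mul_zero, Finset.sum_const_zero]
      positivity
  refine ⟨fun i => ∑ j ∈ Finset.range (n + 1), z i j, z,
    fun i => Finset.sum_nonneg fun j _ => hz0 i j, fun i j _ => hz0 i j, ?_, ?_⟩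
  · intro j hj h S
    have hx : ∀ i, z i j ≤ ∑ j ∈ Finset.range (n + 1), z i j := fun i =>
      Finset.single_le_sum (f := fun j => z i j) (fun j _ => hz0 i j)
        (Finset.mem_range.2 (Nat.lt_succ_iff.2 hj))
    have h1 : ∑ i, z i j ≤ coverage (fun i => ∑ j ∈ Finset.range (n + 1), z i j) z j S := by
      rw [← Finset.sum_add_sum_compl S, coverage]
      exact add_le_add (Finset.sum_le_sum fun i _ => hx i) le_rfl
    refine le_trans ?_ h1
    rw [← hz1 j h]
    exact Finset.single_le_sum (f := fun i => z i j) (fun i _ => hz0 i j) (Finset.mem_univ _)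
  · have hc := I.opening_nonneg
    have ha := I.assign_nonneg
    have hl := I.load_nonneg
    rintro (_ | _ | i)
    · refine le_trans ?_ hcost
      refine Finset.sum_le_sum fun i _ => ?_
      rw [Finset.mul_sum]
      refine Finset.sum_le_sum fun j _ => mul_le_mul_of_nonneg_right ?_ (hz0 i j)
      rw [fullCost]; linarith [ha i j, hl i j]
    · refine le_trans ?_ hcost
      refine Finset.sum_le_sum fun i _ => Finset.sum_le_sum fun j _ =>
        mul_le_mul_of_nonneg_right ?_ (hz0 i j)
      rw [fullCost]; linarith [hc i, hl i j]
    · refine le_trans ?_ (le_trans (Finset.single_le_sum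
        (f := fun i => ∑ j ∈ Finset.range (n + 1), fullCost I i j * z i j)
        (fun i _ => Finset.sum_nonneg fun j _ => mul_nonneg
          (add_nonneg (add_nonneg (hc i) (ha i j)) (hl i j)) (hz0 i j))
        (Finset.mem_univ i)) hcost)
      refine Finset.sum_le_sum fun j _ => mul_le_mul_of_nonneg_right ?_ (hz0 i j)
      rw [fullCost]; linarith [hc i, ha i j]

/-- All logarithms are at most their value at 4. What remains is linear in the comparison solution,
and grouping it by rows instead of variables gives the sum of its rows weighted by u_r^t. -/
theorem potential_le {I : Instance m} {n t : ℕ} {u : Option (Option (Fin m)) → ℝ}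
    (hu : ∀ r, 0 ≤ u r) {x : Fin m → ℝ} {y : Fin m → ℕ → ℝ}
    (hx : ∀ i, 0 ≤ x i) (hx4 : ∀ i, x i ≤ 4) (hy : ∀ i, ∀ j ≤ n, 0 ≤ y i j)
    (hy4 : ∀ i, ∀ j ≤ n, y i j ≤ 4) {xs : Fin m → ℝ} {ys : Fin m → ℕ → ℝ} (hxs : ∀ i, 0 ≤ xs i)
    (hys : ∀ i, ∀ j ≤ n, 0 ≤ ys i j) {b : ℝ} (hb : ∀ r, rows I n xs ys r ≤ b) :
    potential I n t u x y xs ys ≤ Real.log (m * 4 + 1) * (b * ∑ r, u r ^ t) := by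
  have h1 : potential I n t u x y xs ys
      ≤ Real.log (m * 4 + 1) * ∑ r, rows I n xs ys r * u r ^ t := by
    have hL := log_mul_add_one_nonneg m (show (0 : ℝ) ≤ 4 by norm_num)
    calc potential I n t u x y xs ys
        ≤ ∑ i, xs i * (I.opening i * u none ^ t) * Real.log (m * 4 + 1)
          + ∑ i, ∑ j ∈ Finset.range (n + 1), ys i j * slope I t u i j * Real.log (m * 4 + 1) := by
          refine add_le_add (Finset.sum_le_sum fun i _ => ?_)
            (Finset.sum_le_sum fun i _ => Finset.sum_le_sum fun j hj => ?_)
          · exact mul_le_mul_of_nonneg_left (log_mul_add_one_mono m (hx i) (hx4 i))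
              (mul_nonneg (hxs i) (mul_nonneg (I.opening_nonneg i) (pow_nonneg (hu _) _)))
          · have hj' : j ≤ n := Nat.lt_succ_iff.1 (Finset.mem_range.1 hj)
            exact mul_le_mul_of_nonneg_left (log_mul_add_one_mono m (hy i j hj') (hy4 i j hj'))
              (mul_nonneg (hys i j hj') (slope_nonneg I t hu i j))
      _ = Real.log (m * 4 + 1) * ∑ r, rows I n xs ys r * u r ^ t := by
          rw [Fintype.sum_option, Fintype.sum_option]
          simp only [rows, slope, ← Finset.sum_mul]
          rw [mul_add, mul_add, mul_comm (Real.log _), mul_comm (Real.log _),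
            mul_comm (Real.log _)]
          simp only [mul_add, Finset.sum_add_distrib, add_mul, Finset.sum_mul]
          congr 1
          · exact Finset.sum_congr rfl fun i _ => by ring
          · congr 1
            · exact Finset.sum_congr rfl fun i _ => Finset.sum_congr rfl fun j _ => by ring
            · exact Finset.sum_congr rfl fun i _ => Finset.sum_congr rfl fun j _ => by ring
  refine h1.trans (mul_le_mul_of_nonneg_left ?_
    (log_mul_add_one_nonneg m (show (0 : ℝ) ≤ 4 by norm_num)))
  rw [Finset.mul_sum]
  exact Finset.sum_le_sum fun r _ => mul_le_mul_of_nonneg_right (hb r) (pow_nonneg (hu r) _)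

/-- All rows are bounded in terms of any solution for the clients that are accounted for. -/
theorem Inv.rows_le {I : Instance m} {n t : ℕ} {θ : ℝ} {x : Fin m → ℝ} {y : Fin m → ℕ → ℝ}
    (h : Inv I n t θ x y) (ht : m + 2 ≤ 2 ^ t) {xs : Fin m → ℝ} {ys : Fin m → ℕ → ℝ}
    (hxs : ∀ i, 0 ≤ xs i) (hys : ∀ i, ∀ j ≤ n, 0 ≤ ys i j)
    (hc : ∀ j ≤ n, Accounted I θ j → ∀ S, 1 ≤ coverage xs ys j S)
    {b : ℝ} (hb : ∀ r, rows I n xs ys r ≤ b) (r) :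
    rows I n x y r + θ ≤ 2 * ((t + 1) * (θ + 8 * Real.log (m * 4 + 1) * b)) := by
  have hb0 : 0 ≤ b := (rows_nonneg I n hxs hys none).trans (hb none)
  have hL := log_mul_add_one_nonneg m (show (0 : ℝ) ≤ 4 by norm_num)
  have h0 := h.floor_nonneg
  have hu : ∀ r, 0 ≤ rows I n x y r + θ := fun r =>
    add_nonneg (rows_nonneg I n h.x_nonneg h.y_nonneg r) h0
  refine le_of_sum_pow_succ_le (t := t) hu (by positivity)
    (by rw [Fintype.card_option, Fintype.card_option, Fintype.card_fin]; exact ht) ?_ r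
  have h1 := h.power_le xs ys hxs hys hc
  have h2 := mul_le_mul_of_nonneg_left (potential_le (t := t) hu h.x_nonneg h.x_le h.y_nonneg
    h.y_le hxs hys hb) (by positivity : (0 : ℝ) ≤ 8 * (t + 1))
  refine (h1.trans (add_le_add le_rfl h2)).trans_eq ?_
  ring

/-! ## The step of the algorithm -/

/-- The gradient of the power sum at the smaller one of `x i` and `y i n`. -/
def grad (I : Instance m) (n t : ℕ) (u : Option (Option (Fin m)) → ℝ) (x : Fin m → ℝ)
    (y : Fin m → ℕ → ℝ) (i : Fin m) : ℝ :=
  if x i < y i n then I.opening i * u none ^ t else slope I t u i n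

/-- The relative growth of the rows if the smaller one of `x i` and `y i n` grows. -/
def relCost (I : Instance m) (n : ℕ) (u : Option (Option (Fin m)) → ℝ) (x : Fin m → ℝ)
    (y : Fin m → ℕ → ℝ) (i : Fin m) : ℝ :=
  if x i < y i n then I.opening i / u none
  else I.assign i n / u (some none) + I.load i n / u (some (some i))

/-- The inverse of the step size. -/
def invStep (I : Instance m) (n t : ℕ) (u : Option (Option (Fin m)) → ℝ) (x : Fin m → ℝ)
    (y : Fin m → ℕ → ℝ) : ℝ :=
  ∑ i, (1 + 2 * (t + 1) * relCost I n u x y i) / grad I n t u x y i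

/-- The factor by which the smaller one of `x i` and `y i n` grows, minus one. -/
def growth (I : Instance m) (n t : ℕ) (u : Option (Option (Fin m)) → ℝ) (x : Fin m → ℝ)
    (y : Fin m → ℕ → ℝ) (i : Fin m) : ℝ :=
  1 / (invStep I n t u x y * grad I n t u x y i)

/-- The new `x`. -/
def stepX (I : Instance m) (n t : ℕ) (u : Option (Option (Fin m)) → ℝ) (x : Fin m → ℝ)
    (y : Fin m → ℕ → ℝ) (i : Fin m) : ℝ :=
  if x i < y i n then x i + (x i + 1 / m) * growth I n t u x y i else x i

/-- The new `y`. -/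
def stepY (I : Instance m) (n t : ℕ) (u : Option (Option (Fin m)) → ℝ) (x : Fin m → ℝ)
    (y : Fin m → ℕ → ℝ) (i : Fin m) (j : ℕ) : ℝ :=
  if j = n ∧ ¬ x i < y i n then y i j + (y i j + 1 / m) * growth I n t u x y i else y i j

/-- The coefficient in row `r` of the smaller one of `x i` and `y i n`. -/
def coef (I : Instance m) (n : ℕ) (x : Fin m → ℝ) (y : Fin m → ℕ → ℝ) :
    Option (Option (Fin m)) → Fin m → ℝ
  | none, i => if x i < y i n then I.opening i else 0
  | some none, i => if x i < y i n then 0 else I.assign i n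
  | some (some k), i => if k = i then (if x i < y i n then 0 else I.load i n) else 0

/-- A measure of progress while client `n` is served. -/
def progress (I : Instance m) (n : ℕ) (θ : ℝ) (x : Fin m → ℝ) (y : Fin m → ℕ → ℝ) : ℝ :=
  ∑ i, m * x i + ∑ i, m * y i n + ∑ r, rows I n x y r / θ

theorem coef_nonneg (I : Instance m) (n : ℕ) (x : Fin m → ℝ) (y : Fin m → ℕ → ℝ) (r i) :
    0 ≤ coef I n x y r i := by
  have := I.opening_nonneg i
  have := I.assign_nonneg i n
  have := I.load_nonneg i n
  rcases r with _ | _ | k <;> simp only [coef] <;> split_ifs <;> first | assumption | exact le_rfl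

theorem grad_eq (I : Instance m) (n t : ℕ) (u : Option (Option (Fin m)) → ℝ) (x : Fin m → ℝ)
    (y : Fin m → ℕ → ℝ) (i : Fin m) :
    grad I n t u x y i = ∑ r, coef I n x y r i * u r ^ t := by
  rw [Fintype.sum_option, Fintype.sum_option]
  by_cases h : x i < y i n <;> simp [grad, coef, slope, h]

theorem relCost_eq (I : Instance m) (n : ℕ) (u : Option (Option (Fin m)) → ℝ) (x : Fin m → ℝ)
    (y : Fin m → ℕ → ℝ) (i : Fin m) :
    relCost I n u x y i = ∑ r, coef I n x y r i / u r := by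
  rw [Fintype.sum_option, Fintype.sum_option]
  by_cases h : x i < y i n <;> simp [relCost, coef, h, ite_div]

/-- In terms of the matrix `coef` the rows change linearly, which puts the step into the form
required by `multiplicative_step`. -/
theorem rows_step (I : Instance m) (n t : ℕ) (u : Option (Option (Fin m)) → ℝ) (x : Fin m → ℝ)
    (y : Fin m → ℕ → ℝ) (r) :
    rows I n (stepX I n t u x y) (stepY I n t u x y) r = rows I n x y r
      + ∑ i, coef I n x y r i * ((min (x i) (y i n) + 1 / m) * growth I n t u x y i) := by
  have hsum : ∀ i (f : ℕ → ℝ), ∑ j ∈ Finset.range (n + 1), f j * stepY I n t u x y i j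
      = ∑ j ∈ Finset.range (n + 1), f j * y i j + (if x i < y i n then 0 else f n)
        * ((min (x i) (y i n) + 1 / m) * growth I n t u x y i) := fun i f => by
    rw [Finset.sum_range_succ, Finset.sum_range_succ, add_assoc]
    congr 1
    · refine Finset.sum_congr rfl fun j hj => ?_
      rw [stepY, if_neg (fun h => (Finset.mem_range.1 hj).ne h.1)]
    · by_cases h : x i < y i n
      · simp [stepY, h]
      · simp [stepY, h, not_lt.1 h, mul_add]
  rcases r with _ | _ | k
  · simp only [rows, coef]
    rw [← Finset.sum_add_distrib]
    refine Finset.sum_congr rfl fun i _ => ?_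
    by_cases h : x i < y i n
    · simp [stepX, h, h.le, mul_add]
    · simp [stepX, h]
  · simp only [rows, coef]
    rw [← Finset.sum_add_distrib]
    exact Finset.sum_congr rfl fun i _ => hsum i _
  · simp only [rows, coef, ite_mul, zero_mul, Finset.sum_ite_eq, Finset.mem_univ, if_true]
    have := hsum k (I.load k)
    simpa only [ite_mul, zero_mul] using this

/-- The situation in which a step is made. -/
structure Ready (I : Instance m) (n t : ℕ) (θ : ℝ) (x : Fin m → ℝ) (y : Fin m → ℕ → ℝ) :
    Prop where
  inv : Inv I n t θ x y
  accounted : Accounted I θ n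
  opening : ∀ i, I.opening i = 0 → x i = 4
  client : ∀ i, I.assign i n = 0 → I.load i n = 0 → y i n = 4

theorem half_le_log {a : ℝ} (h0 : 0 ≤ a) (h1 : a ≤ 1) : a / 2 ≤ Real.log (1 + a) := by
  refine le_trans ?_ (Real.le_log_one_add_of_nonneg h0)
  rw [div_le_div_iff₀ (by norm_num) (by linarith)]
  nlinarith

/-- The offset 1/m makes the step multiply m v + 1 by exactly 1 + a. It also lets variables leave 0.
-/
theorem log_step (hm : 2 ≤ m) {v a : ℝ} (hv : 0 ≤ v) (h0 : 0 ≤ a) (h1 : a ≤ 1) :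
    Real.log (m * v + 1) + a / 2 ≤ Real.log (m * (v + (v + 1 / m) * a) + 1) := by
  have hm' : (2 : ℝ) ≤ m := by exact_mod_cast hm
  have e : m * (v + (v + 1 / m) * a) + 1 = (m * v + 1) * (1 + a) := by field_simp; ring
  rw [e, Real.log_mul (by positivity) (by positivity)]
  linarith [half_le_log h0 h1]

/-- The product of gradient and growth has the same value s for all moving variables, so each adds
at least s/2 times its comparison value to the potential. The covering constraint sums these to at
least s/2. The power sum grows by at most 4(t+1)s = 8(t+1) · s/2, whence the constant 8 in the
invariant. -/
theorem Ready.step {I : Instance m} {n t : ℕ} {θ : ℝ} {x : Fin m → ℝ} {y : Fin m → ℕ → ℝ}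
    (h : Ready I n t θ x y) (hm : 2 ≤ m) (hlt : ∑ i, min (x i) (y i n) < 1) {u}
    (hu : u = fun r => rows I n x y r + θ) :
    0 < θ ∧ (∀ i, x i ≤ stepX I n t u x y i) ∧ (∀ i j, y i j ≤ stepY I n t u x y i j) ∧
      Ready I n t θ (stepX I n t u x y) (stepY I n t u x y) ∧
      progress I n θ x y + 1 / (2 * (t + 1) * m)
        ≤ progress I n θ (stepX I n t u x y) (stepY I n t u x y) := by
  classical
  have hmR : (2 : ℝ) ≤ m := by exact_mod_cast hm
  have hx0 := h.inv.x_nonneg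
  have hy0 : ∀ i, 0 ≤ y i n := fun i => h.inv.y_nonneg i n le_rfl
  have hmin0 : ∀ i, 0 ≤ min (x i) (y i n) := fun i => le_min (hx0 i) (hy0 i)
  have hmin1 : ∀ i, min (x i) (y i n) < 1 := fun i =>
    (Finset.single_le_sum (f := fun i => min (x i) (y i n)) (fun i _ => hmin0 i)
      (Finset.mem_univ i)).trans_lt hlt
  -- Variables without cost sit at 4, the upper bound of all variables, so a smaller `x i` is not
  -- among them. A moving `y i n` is not either, because every minimum is below 1. Hence all
  -- gradients will be positive.
  have hact : ∀ i, x i < y i n → 0 < I.opening i := fun i hi => by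
    refine lt_of_le_of_ne (I.opening_nonneg i) fun h0 => ?_
    have := h.opening i h0.symm
    linarith [h.inv.y_le i n le_rfl]
  have hpas : ∀ i, ¬ x i < y i n → 0 < I.assign i n ∨ 0 < I.load i n := fun i hi => by
    by_contra! hc
    have h1 := h.client i (le_antisymm hc.1 (I.assign_nonneg i n))
      (le_antisymm hc.2 (I.load_nonneg i n))
    have := hmin1 i
    rw [min_eq_right (not_lt.1 hi)] at this
    linarith
  -- For every facility the variable that moves has positive cost, in particular for the facility
  -- that accounts for client `n`.
  have hθ : 0 < θ := by
    obtain ⟨i, hi⟩ := h.accounted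
    have : 0 < fullCost I i n := by
      have := I.opening_nonneg i
      have := I.assign_nonneg i n
      have := I.load_nonneg i n
      rw [fullCost]
      by_cases hi : x i < y i n
      · linarith [hact i hi]
      · rcases hpas i hi with h | h <;> linarith
    by_contra! hneg
    have : 2 * (m : ℝ) * θ ≤ 0 := mul_nonpos_of_nonneg_of_nonpos (by positivity) hneg
    linarith
  have hrows := rows_nonneg I n hx0 h.inv.y_nonneg
  have hu0 : ∀ r, 0 < u r := fun r => by rw [hu]; exact add_pos_of_nonneg_of_pos (hrows r) hθ
  have huθ : ∀ r, θ ≤ u r := fun r => by rw [hu]; exact le_add_of_nonneg_left (hrows r)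
  have hg0 : ∀ i, 0 < grad I n t u x y i := fun i => by
    rw [grad]
    split_ifs with hi
    · exact mul_pos (hact i hi) (pow_pos (hu0 _) _)
    · have h1 : 0 < u (some none) ^ t := pow_pos (hu0 _) _
      have h2 : 0 < u (some (some i)) ^ t := pow_pos (hu0 _) _
      have := mul_nonneg (I.assign_nonneg i n) h1.le
      have := mul_nonneg (I.load_nonneg i n) h2.le
      rw [slope]
      rcases hpas i hi with h | h
      · linarith [mul_pos h h1]
      · linarith [mul_pos h h2]
  have : Nonempty (Fin m) := ⟨⟨0, by omega⟩⟩
  -- The minima sum to less than 1 and the m offsets 1/m to exactly 1.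
  have hw2 : ∑ i, (min (x i) (y i n) + 1 / (m : ℝ)) ≤ 2 := by
    rw [Finset.sum_add_distrib, Finset.sum_const, Finset.card_univ, Fintype.card_fin,
      nsmul_eq_mul, mul_one_div_cancel (by positivity)]
    linarith
  obtain ⟨hD0, hl1, hpow, hprog⟩ := multiplicative_step t m (by omega) (coef I n x y)
    (coef_nonneg I n x y) u hu0 (fun i => min (x i) (y i n) + 1 / (m : ℝ))
    (fun i => le_add_of_nonneg_left (hmin0 i)) hw2 (grad I n t u x y)
    (grad_eq I n t u x y) hg0 (invStep I n t u x y) (by simp only [invStep, relCost_eq])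
  set l := growth I n t u x y with hl
  change ∀ i, l i ≤ 1 at hl1
  set s := 1 / invStep I n t u x y with hs
  have hs0 : 0 < s := by positivity
  have hl0 : ∀ i, 0 < l i := fun i => by
    have := hg0 i
    rw [hl, growth]; positivity
  have hgl : ∀ i, grad I n t u x y i * l i = s := fun i => by
    have := (hg0 i).ne'
    rw [hl, growth, hs]; field_simp
  set x' := stepX I n t u x y with hx'
  set y' := stepY I n t u x y with hy'
  have hxact : ∀ i, x i < y i n → x' i = x i + (x i + 1 / m) * l i := fun i hi => by
    rw [hx', stepX, if_pos hi]
  have hxpas : ∀ i, ¬ x i < y i n → x' i = x i := fun i hi => by rw [hx', stepX, if_neg hi]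
  have hyact : ∀ i, x i < y i n → ∀ j, y' i j = y i j := fun i hi j => by
    rw [hy', stepY, if_neg fun h => h.2 hi]
  have hypas : ∀ i, ¬ x i < y i n → y' i n = y i n + (y i n + 1 / m) * l i := fun i hi => by
    rw [hy', stepY, if_pos ⟨rfl, hi⟩]
  have hyold : ∀ i j, j ≠ n → y' i j = y i j := fun i j hj => by
    rw [hy', stepY, if_neg fun h => hj h.1]
  have hinc : ∀ i, 0 ≤ (min (x i) (y i n) + 1 / m) * l i := fun i =>
    mul_nonneg (add_nonneg (hmin0 i) (by positivity)) (hl0 i).le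
  -- A moving value is below 1 and grows by at most 1 + 1/m ≤ 2 more, so the cap 4 is safe.
  have hnew : ∀ i, min (x i) (y i n) + (min (x i) (y i n) + 1 / m) * l i ≤ 4 := fun i => by
    have h1 : (1 : ℝ) / m ≤ 1 := by rw [div_le_one (by positivity)]; linarith
    have h2 : (min (x i) (y i n) + 1 / m) * l i ≤ 2 * 1 :=
      mul_le_mul (by linarith [hmin1 i]) (hl1 i) (hl0 i).le (by norm_num)
    linarith [hmin1 i]
  have hxx : ∀ i, x i ≤ x' i := fun i => by
    by_cases hi : x i < y i n
    · have := hinc i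
      rw [min_eq_left hi.le] at this
      rw [hxact i hi]; linarith
    · rw [hxpas i hi]
  have hyn : ∀ i, y i n ≤ y' i n := fun i => by
    by_cases hi : x i < y i n
    · rw [hyact i hi]
    · have := hinc i
      rw [min_eq_right (not_lt.1 hi)] at this
      rw [hypas i hi]; linarith
  have hyy : ∀ i j, y i j ≤ y' i j := fun i j => by
    by_cases hj : j = n
    · rw [hj]; exact hyn i
    · rw [hyold i j hj]
  have hx4 : ∀ i, x' i ≤ 4 := fun i => by
    by_cases hi : x i < y i n
    · have := hnew i
      rw [min_eq_left hi.le] at this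
      rw [hxact i hi]; exact this
    · rw [hxpas i hi]; exact h.inv.x_le i
  have hy4 : ∀ i, ∀ j ≤ n, y' i j ≤ 4 := fun i j hj => by
    by_cases hjn : j = n
    · rw [hjn]
      by_cases hi : x i < y i n
      · rw [hyact i hi]; exact h.inv.y_le i n le_rfl
      · have := hnew i
        rw [min_eq_right (not_lt.1 hi)] at this
        rw [hypas i hi]; exact this
    · rw [hyold i j hjn]; exact h.inv.y_le i j hj
  have hrows' : ∀ r, rows I n x' y' r = rows I n x y r
      + ∑ i, coef I n x y r i * ((min (x i) (y i n) + 1 / m) * l i) := rows_step I n t u x y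
  have hrinc : ∀ r, 0 ≤ ∑ i, coef I n x y r i * ((min (x i) (y i n) + 1 / m) * l i) := fun r =>
    Finset.sum_nonneg fun i _ => mul_nonneg (coef_nonneg I n x y r i) (hinc i)
  refine ⟨hθ, hxx, hyy, ⟨?_, h.accounted, ?_, ?_⟩, ?_⟩
  · refine ⟨fun i => (hx0 i).trans (hxx i), hx4,
      fun i j hj => (h.inv.y_nonneg i j hj).trans (hyy i j), hy4, hθ.le, h.inv.floor_le, ?_⟩
    intro xs ys hxs hys hc
    have hold := h.inv.power_le xs ys hxs hys hc
    rw [← hu] at hold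
    have hur : ∀ r, rows I n x y r + θ = u r := fun r => by rw [hu]
    simp only [hur] at hold
    set u' : Option (Option (Fin m)) → ℝ := fun r => rows I n x' y' r + θ with hu'
    have hu'r : ∀ r, u' r = u r + ∑ i, coef I n x y r i * ((min (x i) (y i n) + 1 / m) * l i) :=
      fun r => by rw [hu', hu]; simp only [hrows']; ring
    have huu : ∀ r, u r ≤ u' r := fun r => by rw [hu'r]; linarith [hrinc r]
    have hF : ∑ r, u' r ^ (t + 1) ≤ ∑ r, u r ^ (t + 1) + 4 * (t + 1) * s := by
      simp only [hu'r]; exact hpow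
    have hW : ∑ r, u r ^ t ≤ ∑ r, u' r ^ t :=
      Finset.sum_le_sum fun r _ => pow_le_pow_left₀ (hu0 r).le (huu r) _
    -- The gain is measured with the old gradients first; afterwards the gradients are replaced by
    -- the new, larger ones.
    have hmono := potential_mono I n t (fun r => (hu0 r).le) huu (x := x') (x' := x')
      (y := y') (y' := y') (fun i => (hx0 i).trans (hxx i)) (fun _ => le_rfl)
      (fun i j hj => (h.inv.y_nonneg i j hj).trans (hyy i j)) (fun _ _ _ => le_rfl) hxs hys
    have hpot : potential I n t u x y xs ys + s / 2 ≤ potential I n t u x' y' xs ys := by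
      have hcov := hc n le_rfl h.accounted (Finset.univ.filter fun i => x i < y i n)
      rw [coverage, Finset.compl_filter, Finset.sum_filter, Finset.sum_filter] at hcov
      have h1 : ∑ i, xs i * (I.opening i * u none ^ t) * Real.log (m * x i + 1)
          + (∑ i, if x i < y i n then xs i else 0) * (s / 2)
          ≤ ∑ i, xs i * (I.opening i * u none ^ t) * Real.log (m * x' i + 1) := by
        rw [Finset.sum_mul, ← Finset.sum_add_distrib]
        refine Finset.sum_le_sum fun i _ => ?_
        by_cases hi : x i < y i n
        · rw [if_pos hi, hxact i hi]
          have hlog := log_step hm (hx0 i) (hl0 i).le (hl1 i)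
          have hg := hgl i
          rw [grad, if_pos hi] at hg
          have := mul_le_mul_of_nonneg_left hlog (mul_nonneg (hxs i)
            (mul_nonneg (I.opening_nonneg i) (pow_nonneg (hu0 none).le t)))
          calc _ = xs i * (I.opening i * u none ^ t) * (Real.log (m * x i + 1) + l i / 2) := by
                rw [← hg]; ring
            _ ≤ _ := this
        · rw [if_neg hi, hxpas i hi]; linarith
      have h2 : ∑ i, ∑ j ∈ Finset.range (n + 1), ys i j * slope I t u i j
            * Real.log (m * y i j + 1)
          + (∑ i, if ¬ x i < y i n then ys i n else 0) * (s / 2)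
          ≤ ∑ i, ∑ j ∈ Finset.range (n + 1), ys i j * slope I t u i j
            * Real.log (m * y' i j + 1) := by
        rw [Finset.sum_mul, ← Finset.sum_add_distrib]
        refine Finset.sum_le_sum fun i _ => ?_
        rw [Finset.sum_range_succ, Finset.sum_range_succ, add_assoc]
        refine add_le_add (Finset.sum_le_sum fun j hj => ?_) ?_
        · rw [hyold i j (Finset.mem_range.1 hj).ne]
        · by_cases hi : x i < y i n
          · rw [if_neg (not_not.2 hi), hyact i hi]; linarith
          · rw [if_pos hi, hypas i hi]
            have hlog := log_step hm (hy0 i) (hl0 i).le (hl1 i)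
            have hg := hgl i
            rw [grad, if_neg hi] at hg
            have := mul_le_mul_of_nonneg_left hlog (mul_nonneg (hys i n le_rfl)
              (slope_nonneg I t (fun r => (hu0 r).le) i n))
            calc _ = ys i n * slope I t u i n * (Real.log (m * y i n + 1) + l i / 2) := by
                  rw [← hg]; ring
              _ ≤ _ := this
      have h3 := mul_le_mul_of_nonneg_right hcov (by positivity : 0 ≤ s / 2)
      rw [potential, potential]
      linarith
    have h4 := mul_le_mul_of_nonneg_left hW (by positivity : 0 ≤ ((t : ℝ) + 1) * θ)
    have h5 := mul_le_mul_of_nonneg_left (hpot.trans hmono)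
      (by positivity : (0 : ℝ) ≤ 8 * (t + 1))
    change ∑ r, u' r ^ (t + 1) ≤ (t + 1) * θ * ∑ r, u' r ^ t + _
    linarith
  · intro i hi
    have h1 := h.opening i hi
    linarith [hxx i, hx4 i]
  · intro i ha hl
    have h1 := h.client i ha hl
    linarith [hyn i, hy4 i n le_rfl]
  · have h1 : ∑ i, (m * ((min (x i) (y i n) + 1 / m) * l i))
        ≤ (∑ i, m * x' i + ∑ i, m * y' i n) - (∑ i, m * x i + ∑ i, m * y i n) := by
      rw [← Finset.sum_add_distrib, ← Finset.sum_add_distrib, ← Finset.sum_sub_distrib]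
      refine Finset.sum_le_sum fun i _ => ?_
      by_cases hi : x i < y i n
      · rw [hxact i hi, hyact i hi, min_eq_left hi.le]; linarith
      · rw [hxpas i hi, hypas i hi, min_eq_right (not_lt.1 hi)]; linarith
    -- Dividing by the fixed `θ ≤ u r` instead of the changing `u r` only increases the gain and
    -- makes it telescope over the steps.
    have h2 : ∑ r, (∑ i, coef I n x y r i * ((min (x i) (y i n) + 1 / m) * l i)) / u r
        ≤ ∑ r, rows I n x' y' r / θ - ∑ r, rows I n x y r / θ := by
      rw [← Finset.sum_sub_distrib]
      refine Finset.sum_le_sum fun r _ => ?_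
      rw [← sub_div, hrows', add_sub_cancel_left]
      exact div_le_div_of_nonneg_left (hrinc r) hθ (huθ r)
    have h3 := hprog.trans (add_le_add h1 h2)
    rw [progress, progress]
    linarith

/-- The progress is polynomially bounded. -/
theorem Ready.progress_le {I : Instance m} {n t : ℕ} {θ : ℝ} {x : Fin m → ℝ}
    {y : Fin m → ℕ → ℝ} (h : Ready I n t θ x y) (hm : 2 ≤ m) (ht : m + 2 ≤ 2 ^ t) (htm : t ≤ m)
    (hθ : 0 < θ) :
    2 * (t + 1) * m * progress I n θ x y ≤ ((m + n + 1 : ℕ) : ℝ) ^ 16 := by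
  have hmR : (2 : ℝ) ≤ m := by exact_mod_cast hm
  have htR : (t : ℝ) ≤ m := by exact_mod_cast htm
  -- This comparison solution costs a polynomial multiple of `θ`, so the bound on the rows becomes
  -- polynomial after division by `θ`.
  obtain ⟨xs, ys, hxs, hys, hc, hb⟩ := exists_cheap_cover I n hθ.le
  have hrow := h.inv.rows_le ht hxs hys (fun j hj => hc j hj) hb
  have hlog : Real.log (m * 4 + 1) ≤ 4 * m := by
    have := Real.log_le_sub_one_of_pos (by positivity : (0 : ℝ) < m * 4 + 1)
    linarith
  set X : ℝ := ((m + n + 1 : ℕ) : ℝ) with hX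
  have hXe : X = m + n + 1 := by rw [hX]; push_cast; ring
  have hn0 : (0 : ℝ) ≤ n := Nat.cast_nonneg n
  have hX3 : 3 ≤ X := by rw [hXe]; linarith
  have hmX : (m : ℝ) + 1 ≤ X := by rw [hXe]; linarith
  have hnX : (n : ℝ) + 1 ≤ X := by rw [hXe]; linarith
  have htX : (t : ℝ) + 1 ≤ X := by linarith
  have hrow' : ∀ r, rows I n x y r / θ ≤ 2 * X * (1 + 64 * X ^ 3) := fun r => by
    rw [div_le_iff₀ hθ]
    have h1 : Real.log (m * 4 + 1) * ((n + 1) * (2 * m * θ)) ≤ 4 * X * (X * (2 * X * θ)) := by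
      have e1 : (m : ℝ) ≤ X := by linarith
      gcongr
      exact hlog.trans (by linarith)
    have h2 := hrow r
    have h3 : 2 * (((t : ℝ) + 1) * (θ + 8 * Real.log (m * 4 + 1) * ((n + 1) * (2 * m * θ))))
        ≤ 2 * (X * (θ + 8 * (4 * X * (X * (2 * X * θ))))) := by
      have h4 : 0 ≤ Real.log (m * 4 + 1) * ((n + 1) * (2 * m * θ)) :=
        mul_nonneg (log_mul_add_one_nonneg m (by norm_num)) (by positivity)
      rw [mul_assoc 8]
      gcongr
    have h5 : 2 * (X * (θ + 8 * (4 * X * (X * (2 * X * θ))))) = 2 * X * (1 + 64 * X ^ 3) * θ := by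
      ring
    linarith
  have hprog : progress I n θ x y ≤ 8 * X ^ 2 + 2 * X * (2 * X * (1 + 64 * X ^ 3)) := by
    have hmm : ∀ a : ℝ, a ≤ 4 → m * a ≤ 4 * X := fun a ha => by nlinarith
    have h1 : ∑ i, m * x i ≤ 4 * X ^ 2 := by
      refine (Finset.sum_le_card_nsmul _ _ (4 * X) fun i _ => hmm _ (h.inv.x_le i)).trans ?_
      rw [Finset.card_univ, Fintype.card_fin, nsmul_eq_mul]
      nlinarith
    have h2 : ∑ i, m * y i n ≤ 4 * X ^ 2 := by
      refine (Finset.sum_le_card_nsmul _ _ (4 * X)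
        fun i _ => hmm _ (h.inv.y_le i n le_rfl)).trans ?_
      rw [Finset.card_univ, Fintype.card_fin, nsmul_eq_mul]
      nlinarith
    have h3 : ∑ r, rows I n x y r / θ ≤ 2 * X * (2 * X * (1 + 64 * X ^ 3)) := by
      refine (Finset.sum_le_card_nsmul _ _ _ fun r _ => hrow' r).trans ?_
      rw [Finset.card_univ, Fintype.card_option, Fintype.card_option, Fintype.card_fin,
        nsmul_eq_mul]
      refine mul_le_mul_of_nonneg_right ?_ (by positivity)
      push_cast
      linarith
    rw [progress]
    linarith
  have hsmall : 8 * X ^ 2 + 2 * X * (2 * X * (1 + 64 * X ^ 3)) ≤ X ^ 12 := by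
    have e : 8 * X ^ 2 + 2 * X * (2 * X * (1 + 64 * X ^ 3)) = X ^ 2 * (12 + 256 * X ^ 3) := by ring
    have h3 : (27 : ℝ) ≤ X ^ 3 := by
      calc (27 : ℝ) = 3 ^ 3 := by norm_num
        _ ≤ X ^ 3 := pow_le_pow_left₀ (by norm_num) hX3 3
    have h7 : (2187 : ℝ) ≤ X ^ 7 := by
      calc (2187 : ℝ) = 3 ^ 7 := by norm_num
        _ ≤ X ^ 7 := pow_le_pow_left₀ (by norm_num) hX3 7
    rw [e, show X ^ 12 = X ^ 2 * (X ^ 7 * X ^ 3) by ring]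
    refine mul_le_mul_of_nonneg_left ?_ (by positivity)
    nlinarith
  calc 2 * ((t : ℝ) + 1) * m * progress I n θ x y
      ≤ 2 * (t + 1) * m * X ^ 12 :=
        mul_le_mul_of_nonneg_left (hprog.trans hsmall) (by positivity)
    _ ≤ X * X * X * X ^ 12 := by
        refine mul_le_mul_of_nonneg_right ?_ (by positivity)
        have e1 : (m : ℝ) ≤ X := by linarith
        have e2 : (2 : ℝ) ≤ X := by linarith
        gcongr
    _ = X ^ 15 * 1 := by ring
    _ ≤ X ^ 15 * X := mul_le_mul_of_nonneg_left (by linarith) (by positivity)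
    _ = X ^ 16 := by ring

/-! ## The programs

Register 3 holds the exponent `t` of the weights; the registers 4 to 8 are auxiliary.  Array 7 holds
the floor `θ`, array 8 a scalar, the arrays 9 to 11 the rows, the arrays 12 to 14 their powers,
array 15 the inverse step size and array 16 the gradient. -/

/-- The number in cell `(0, 0)`. -/
def scalar (arr : ℕ) : RExpr := .cell arr (.const 0) (.const 0)
/-- The number of the current facility. -/
def entry (arr : ℕ) : RExpr := .cell arr (.reg 5) (.const 0)
/-- The number of the current facility and the client that has arrived. -/
def current (arr : ℕ) : RExpr := .cell arr (.reg 5) (.reg 1)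
/-- The number of the current facility and the client in register 6. -/
def pair (arr : ℕ) : RExpr := .cell arr (.reg 5) (.reg 6)
/-- Set cell `(0, 0)`. -/
def setScalar (arr : ℕ) (e : RExpr) : Program := .setCell arr (.const 0) (.const 0) e
/-- Set the number of the current facility. -/
def setEntry (arr : ℕ) (e : RExpr) : Program := .setCell arr (.reg 5) (.const 0) e
/-- Add to cell `(0, 0)`. -/
def addScalar (arr : ℕ) (e : RExpr) : Program := setScalar arr (.add (scalar arr) e)
/-- Run through the facilities. -/
def forFacilities (c : Program) : Program := .loop 5 (.reg 0) c
/-- Run through the clients that have arrived. -/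
def forClients (c : Program) : Program := .loop 6 (.add (.reg 1) (.const 1)) c
/-- Is `x` smaller than `y` for the current facility and the client that has arrived? -/
def isActive : Test := .realLt (entry 4) (current 5)

/-- Write the minimizing set to array 6 and the coverage to array 8. -/
def scanBody : Program :=
  .ite isActive
    (.seq (setEntry 6 (.const 1)) (addScalar 8 (entry 4)))
    (.seq (setEntry 6 (.const 0)) (addScalar 8 (current 5)))

/-- Find the minimizing set and the coverage. -/
def scan : Program := .seq (setScalar 8 (.const 0)) (forFacilities scanBody)

/-- The separation oracle. -/
def separation : Program :=
  .seq scan (.ite (.realLt (scalar 8) (.const (1 / 2)))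
    (.setReg 2 (.const 1)) (.setReg 2 (.const 0)))

/-- Add the terms of one client to the rows. -/
def rowsInner : Program :=
  .seq (setEntry 9 (.add (entry 9) (.mul (pair 3) (pair 5)))) (addScalar 11 (.mul (pair 2) (pair 5)))

/-- Add the terms of one facility to the rows. -/
def rowsBody : Program :=
  .seq (setEntry 9 (scalar 7)) (.seq (addScalar 10 (.mul (entry 1) (entry 4))) (forClients rowsInner))

/-- Compute the rows. -/
def computeRows : Program :=
  .seq (setScalar 10 (scalar 7)) (.seq (setScalar 11 (scalar 7)) (forFacilities rowsBody))

/-- Multiply the weights by the rows. -/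
def powersBody : Program :=
  .ite (.natLt (.reg 8) (.reg 3))
    (.seq (setScalar 13 (.mul (scalar 13) (scalar 10)))
      (.seq (setScalar 14 (.mul (scalar 14) (scalar 11)))
        (forFacilities (setEntry 12 (.mul (entry 12) (entry 9))))))
    .skip

/-- Compute the powers of the rows. -/
def computePowers : Program :=
  .seq (setScalar 13 (.const 1)) (.seq (setScalar 14 (.const 1))
    (.seq (forFacilities (setEntry 12 (.const 1))) (.loop 8 (.reg 0) powersBody)))

/-- The contribution of a facility to the inverse step size. -/
def rateTerm (e : RExpr) : RExpr :=
  .div (.add (.const 1) (.mul (.mul (.const 2) (.add (.ofNat (.reg 3)) (.const 1))) e)) (entry 16)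

/-- Compute the gradient of one facility. -/
def rateBody : Program :=
  .ite isActive
    (.seq (setEntry 16 (.mul (entry 1) (scalar 13)))
      (addScalar 15 (rateTerm (.div (entry 1) (scalar 10)))))
    (.seq (setEntry 16 (.add (.mul (current 2) (scalar 14)) (.mul (current 3) (entry 12))))
      (addScalar 15 (rateTerm (.add (.div (current 2) (scalar 11)) (.div (current 3) (entry 9))))))

/-- Compute the gradient and the inverse step size. -/
def computeRate : Program := .seq (setScalar 15 (.const 0)) (forFacilities rateBody)

/-- The new value of a variable. -/
def moved (e : RExpr) : RExpr :=
  .add e (.mul (.add e (.div (.const 1) (.ofNat (.reg 0))))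
    (.div (.const 1) (.mul (scalar 15) (entry 16))))

/-- Increase one variable of a facility. -/
def moveBody : Program :=
  .ite isActive (setEntry 4 (moved (entry 4)))
    (.setCell 5 (.reg 5) (.reg 1) (moved (current 5)))

/-- Increase the variables. -/
def move : Program := forFacilities moveBody

/-- Make a step if the client is not yet covered. -/
def stepProgram : Program :=
  .seq scan (.ite (.realLt (scalar 8) (.const 1))
    (.seq computeRows (.seq computePowers (.seq computeRate move))) .skip)

/-- Raise the variables of one facility that have no cost. -/
def freeBody : Program :=
  .seq (.ite (.realLt (.const 0) (entry 1)) .skip (setEntry 4 (.const 4)))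
    (.ite (.realLt (.const 0) (.add (current 2) (current 3))) .skip
      (.setCell 5 (.reg 5) (.reg 1) (.const 4)))

/-- Raise the variables that have no cost. -/
def raiseFree : Program := forFacilities freeBody

/-- The cost of serving the client by the current facility alone. -/
def fullCostExpr : RExpr := .add (.add (entry 1) (current 2)) (current 3)

/-- Compute the cost of the cheapest facility. -/
def computeCheapest : Program :=
  .seq (.setReg 5 (.const 0)) (.seq (setScalar 8 fullCostExpr)
    (forFacilities (.ite (.realLt fullCostExpr (scalar 8)) (setScalar 8 fullCostExpr) .skip)))

/-- The floor that the cheapest facility requires. -/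
def floorExpr : RExpr := .div (scalar 8) (.mul (.const 2) (.ofNat (.reg 0)))

/-- Raise the floor. -/
def raiseFloor : Program :=
  .seq computeCheapest (.ite (.realLt (scalar 7) floorExpr) (setScalar 7 floorExpr) .skip)

/-- One doubling in the computation of the exponent. -/
def exponentBody : Program :=
  .ite (.natLt (.reg 4) (.add (.reg 0) (.reg 0)))
    (.seq (.setReg 4 (.add (.reg 4) (.reg 4))) (.setReg 3 (.add (.reg 3) (.const 1)))) .skip

/-- Compute the exponent of the weights. -/
def computeExponent : Program :=
  .seq (.setReg 3 (.const 0)) (.seq (.setReg 4 (.const 1)) (.loop 8 (.reg 0) exponentBody))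

/-- The update. -/
def updating : Program :=
  .seq raiseFree (.seq raiseFloor (.seq computeExponent (stepProgram.times 17)))

/-- The algorithm. -/
def algorithm : Algorithm where
  separate := separation
  update := updating

/-! ## What the programs compute -/

/-- The memory holds the data of the first `n + 1` clients. -/
structure Holds {m : ℕ} (I : Instance m) (n : ℕ) (s : Memory) : Prop where
  reg_m : s.reg 0 = m
  reg_client : s.reg 1 = n
  opening : ∀ i : Fin m, s.mem 1 i 0 = I.opening i
  assign : ∀ i : Fin m, ∀ j ≤ n, s.mem 2 i j = I.assign i j
  load : ∀ i : Fin m, ∀ j ≤ n, s.mem 3 i j = I.load i j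

theorem Holds.of_agree {m : ℕ} {I : Instance m} {n : ℕ} {s s' : Memory} (h : Holds I n s)
    {c : Program} (ha : Agree c s s')
    (hc : (0 ∉ c.regs ∧ 1 ∉ c.regs) ∧ 1 ∉ c.arrays ∧ 2 ∉ c.arrays ∧ 3 ∉ c.arrays) :
    Holds I n s' := by
  refine ⟨?_, ?_, ?_, ?_, ?_⟩
  · rw [ha.reg 0 hc.1.1, h.reg_m]
  · rw [ha.reg 1 hc.1.2, h.reg_client]
  · rw [ha.mem 1 hc.2.1]; exact h.opening
  · rw [ha.mem 2 hc.2.2.1]; exact h.assign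
  · rw [ha.mem 3 hc.2.2.2]; exact h.load

/-- Each facility contributes `x` or `y` independently of the others, so choosing the smaller one
minimizes over all sets in linear time. -/
theorem scan_spec (s : Memory) {m n : ℕ} (h0 : s.reg 0 = m) (h1 : s.reg 1 = n) :
    (scan.exec s).mem 8 0 0 = ∑ i ∈ Finset.range m, min (s.mem 4 i 0) (s.mem 5 i n) ∧
      ∀ i < m, (scan.exec s).mem 6 i 0 = if s.mem 4 i 0 < s.mem 5 i n then 1 else 0 := by
  rw [scan, exec_seq]
  set s₁ := (setScalar 8 (.const 0)).exec s with hs₁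
  have ha₁ : Agree _ s s₁ := exec_agree _ s
  refine exec_loop (fun k s' => s'.mem 8 0 0
      = ∑ i ∈ Finset.range k, min (s.mem 4 i 0) (s.mem 5 i n) ∧
        ∀ i < k, s'.mem 6 i 0 = if s.mem 4 i 0 < s.mem 5 i n then 1 else 0)
    (by simp [NExpr.eval, ha₁.reg 0 (by decide), h0]) ?_ ?_
  · simp [hs₁, setScalar, exec_setCell, Memory.setCell_mem, NExpr.eval, RExpr.eval]
  · rintro k hk s' ha ⟨e1, e2⟩
    have r1 : s'.reg 1 = n := by rw [ha.reg 1 (by decide), ha₁.reg 1 (by decide), h1]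
    have m4 : s'.mem 4 = s.mem 4 := by rw [ha.mem 4 (by decide), ha₁.mem 4 (by decide)]
    have m5 : s'.mem 5 = s.mem 5 := by rw [ha.mem 5 (by decide), ha₁.mem 5 (by decide)]
    rw [scanBody, exec_ite, Finset.sum_range_succ, ← e1]
    have hact : isActive.holds (s'.setReg 5 k) ↔ s.mem 4 k 0 < s.mem 5 k n := by
      simp [isActive, Test.holds, entry, current, RExpr.eval, NExpr.eval, Memory.setReg_reg, r1,
        m4, m5]
    by_cases hlt : s.mem 4 k 0 < s.mem 5 k n
    · rw [if_pos (hact.2 hlt), min_eq_left hlt.le]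
      refine ⟨?_, fun i hi => ?_⟩
      · simp [exec_seq, setEntry, addScalar, setScalar, scalar, entry, exec_setCell,
          Memory.setCell_mem, RExpr.eval, NExpr.eval, Memory.setReg_reg, m4]
      · rcases Nat.lt_succ_iff_lt_or_eq.1 hi with h | rfl
        · simp [exec_seq, setEntry, addScalar, setScalar, scalar, entry, exec_setCell,
            Memory.setCell_mem, RExpr.eval, NExpr.eval, Memory.setReg_reg, h.ne, e2 i h]
        · simp [exec_seq, setEntry, addScalar, setScalar, scalar, entry, exec_setCell,
            Memory.setCell_mem, RExpr.eval, NExpr.eval, Memory.setReg_reg, hlt]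
    · rw [if_neg (fun h => hlt (hact.1 h)), min_eq_right (not_lt.1 hlt)]
      refine ⟨?_, fun i hi => ?_⟩
      · simp [exec_seq, setEntry, addScalar, setScalar, scalar, current, exec_setCell,
          Memory.setCell_mem, RExpr.eval, NExpr.eval, Memory.setReg_reg, m5, r1]
      · rcases Nat.lt_succ_iff_lt_or_eq.1 hi with h | rfl
        · simp [exec_seq, setEntry, addScalar, setScalar, scalar, exec_setCell,
            Memory.setCell_mem, RExpr.eval, NExpr.eval, Memory.setReg_reg, h.ne, e2 i h]
        · simp [exec_seq, setEntry, addScalar, setScalar, scalar, exec_setCell,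
            Memory.setCell_mem, RExpr.eval, NExpr.eval, Memory.setReg_reg, hlt]

theorem rowsInner_spec (s : Memory) {n k : ℕ} (h1 : s.reg 1 = n) (h5 : s.reg 5 = k) :
    ((forClients rowsInner).exec s).mem 9 k 0
        = s.mem 9 k 0 + ∑ j ∈ Finset.range (n + 1), s.mem 3 k j * s.mem 5 k j ∧
      ((forClients rowsInner).exec s).mem 11 0 0
        = s.mem 11 0 0 + ∑ j ∈ Finset.range (n + 1), s.mem 2 k j * s.mem 5 k j ∧
      ∀ i, i ≠ k → ((forClients rowsInner).exec s).mem 9 i 0 = s.mem 9 i 0 := by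
  refine exec_loop (fun l s' => s'.mem 9 k 0
      = s.mem 9 k 0 + ∑ j ∈ Finset.range l, s.mem 3 k j * s.mem 5 k j ∧
      s'.mem 11 0 0 = s.mem 11 0 0 + ∑ j ∈ Finset.range l, s.mem 2 k j * s.mem 5 k j ∧
      ∀ i, i ≠ k → s'.mem 9 i 0 = s.mem 9 i 0)
    (by simp [NExpr.eval, h1]) (by simp) ?_
  rintro l hl s' ha ⟨e1, e2, e3⟩
  have r5 : s'.reg 5 = k := by rw [ha.reg 5 (by decide), h5]
  have m2 : s'.mem 2 = s.mem 2 := ha.mem 2 (by decide)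
  have m3 : s'.mem 3 = s.mem 3 := ha.mem 3 (by decide)
  have m5 : s'.mem 5 = s.mem 5 := ha.mem 5 (by decide)
  refine ⟨?_, ?_, fun i hi => ?_⟩
  · simp [rowsInner, exec_seq, setEntry, addScalar, setScalar, scalar, entry, pair, exec_setCell,
      Memory.setCell_mem, RExpr.eval, NExpr.eval, Memory.setReg_reg, r5, m3, m5, e1,
      Finset.sum_range_succ, add_assoc]
  · simp [rowsInner, exec_seq, setEntry, addScalar, setScalar, scalar, entry, pair, exec_setCell,
      Memory.setCell_mem, RExpr.eval, NExpr.eval, Memory.setReg_reg, r5, m2, m5, e2,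
      Finset.sum_range_succ, add_assoc]
  · simp [rowsInner, exec_seq, setEntry, addScalar, setScalar, scalar, entry, pair, exec_setCell,
      Memory.setCell_mem, RExpr.eval, NExpr.eval, Memory.setReg_reg, r5, hi, e3]

theorem computeRows_spec (s : Memory) {m n : ℕ} (h0 : s.reg 0 = m) (h1 : s.reg 1 = n) :
    (computeRows.exec s).mem 10 0 0
        = ∑ i ∈ Finset.range m, s.mem 1 i 0 * s.mem 4 i 0 + s.mem 7 0 0 ∧
      (computeRows.exec s).mem 11 0 0
        = ∑ i ∈ Finset.range m, ∑ j ∈ Finset.range (n + 1), s.mem 2 i j * s.mem 5 i j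
          + s.mem 7 0 0 ∧
      ∀ i < m, (computeRows.exec s).mem 9 i 0
        = ∑ j ∈ Finset.range (n + 1), s.mem 3 i j * s.mem 5 i j + s.mem 7 0 0 := by
  rw [computeRows, exec_seq, exec_seq]
  set s₁ := (setScalar 11 (scalar 7)).exec ((setScalar 10 (scalar 7)).exec s) with hs₁
  have ha₁ : Agree (.seq (setScalar 10 (scalar 7)) (setScalar 11 (scalar 7))) s s₁ :=
    exec_agree (.seq _ _) s
  refine exec_loop (fun k s' => s'.mem 10 0 0
      = ∑ i ∈ Finset.range k, s.mem 1 i 0 * s.mem 4 i 0 + s.mem 7 0 0 ∧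
      s'.mem 11 0 0 = ∑ i ∈ Finset.range k, ∑ j ∈ Finset.range (n + 1),
        s.mem 2 i j * s.mem 5 i j + s.mem 7 0 0 ∧
      ∀ i < k, s'.mem 9 i 0
        = ∑ j ∈ Finset.range (n + 1), s.mem 3 i j * s.mem 5 i j + s.mem 7 0 0)
    (by simp [NExpr.eval, ha₁.reg 0 (by decide), h0]) ?_ ?_
  · simp [hs₁, setScalar, scalar, exec_setCell, Memory.setCell_mem, NExpr.eval, RExpr.eval]
  · rintro k hk s' ha ⟨e1, e2, e3⟩
    have r1 : s'.reg 1 = n := by rw [ha.reg 1 (by decide), ha₁.reg 1 (by decide), h1]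
    have m1 : s'.mem 1 = s.mem 1 := by rw [ha.mem 1 (by decide), ha₁.mem 1 (by decide)]
    have m2 : s'.mem 2 = s.mem 2 := by rw [ha.mem 2 (by decide), ha₁.mem 2 (by decide)]
    have m3 : s'.mem 3 = s.mem 3 := by rw [ha.mem 3 (by decide), ha₁.mem 3 (by decide)]
    have m4 : s'.mem 4 = s.mem 4 := by rw [ha.mem 4 (by decide), ha₁.mem 4 (by decide)]
    have m5 : s'.mem 5 = s.mem 5 := by rw [ha.mem 5 (by decide), ha₁.mem 5 (by decide)]
    have m7 : s'.mem 7 = s.mem 7 := by rw [ha.mem 7 (by decide), ha₁.mem 7 (by decide)]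
    rw [rowsBody, exec_seq, exec_seq]
    set s₂ := (addScalar 10 (.mul (entry 1) (entry 4))).exec
      ((setEntry 9 (scalar 7)).exec (s'.setReg 5 k)) with hs₂
    have ha₂ : Agree (.seq (setEntry 9 (scalar 7)) (addScalar 10 (.mul (entry 1) (entry 4))))
        (s'.setReg 5 k) s₂ := exec_agree (.seq _ _) _
    have q1 : s₂.reg 1 = n := by rw [ha₂.reg 1 (by decide), Memory.setReg_reg]; simpa using r1
    have q5 : s₂.reg 5 = k := by rw [ha₂.reg 5 (by decide), Memory.setReg_reg]; simp
    have n2 : s₂.mem 2 = s.mem 2 := by rw [ha₂.mem 2 (by decide), Memory.setReg_mem, m2]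
    have n3 : s₂.mem 3 = s.mem 3 := by rw [ha₂.mem 3 (by decide), Memory.setReg_mem, m3]
    have n5 : s₂.mem 5 = s.mem 5 := by rw [ha₂.mem 5 (by decide), Memory.setReg_mem, m5]
    have n11 : s₂.mem 11 = s'.mem 11 := by rw [ha₂.mem 11 (by decide), Memory.setReg_mem]
    have n10 : s₂.mem 10 0 0 = s'.mem 10 0 0 + s.mem 1 k 0 * s.mem 4 k 0 := by
      simp [hs₂, setEntry, addScalar, setScalar, scalar, entry, exec_setCell,
        Memory.setCell_mem, RExpr.eval, NExpr.eval, Memory.setReg_reg, m1, m4]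
    have n9 : ∀ i, s₂.mem 9 i 0 = if i = k then s.mem 7 0 0 else s'.mem 9 i 0 := fun i => by
      simp [hs₂, setEntry, addScalar, setScalar, scalar, entry, exec_setCell,
        Memory.setCell_mem, RExpr.eval, NExpr.eval, Memory.setReg_reg, m7]
    obtain ⟨f1, f2, f3⟩ := rowsInner_spec s₂ q1 q5
    refine ⟨?_, ?_, fun i hi => ?_⟩
    · rw [(exec_agree (forClients rowsInner) s₂).mem 10 (by decide), n10, e1,
        Finset.sum_range_succ]
      ring
    · rw [f2, n11, e2, Finset.sum_range_succ _ k, n2, n5]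
      ring
    · rcases Nat.lt_succ_iff_lt_or_eq.1 hi with h | rfl
      · rw [f3 i h.ne, n9, if_neg h.ne, e3 i h]
      · rw [f1, n9, if_pos rfl, n3, n5]
        ring

/-- The expression may read the cell that it overwrites, since round `k` still finds its old value
there. This is needed to multiply array 12 in place. -/
theorem fill_spec (s : Memory) (arr : ℕ) (e : RExpr) {m : ℕ} (h0 : s.reg 0 = m) (v : ℕ → ℝ)
    (hv : ∀ k < m, ∀ s', Agree (forFacilities (setEntry arr e)) s s' →
      s'.mem arr k 0 = s.mem arr k 0 → e.eval (s'.setReg 5 k) = v k) :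
    ∀ i < m, ((forFacilities (setEntry arr e)).exec s).mem arr i 0 = v i := by
  have := exec_loop (r := 5) (e := .reg 0) (c := setEntry arr e) (s := s)
    (fun k s' => (∀ i < k, s'.mem arr i 0 = v i) ∧ ∀ i, k ≤ i → s'.mem arr i 0 = s.mem arr i 0)
    (N := m) (by simpa [NExpr.eval] using h0) (by simp) (by
      rintro k hk s' ha ⟨e1, e2⟩
      refine ⟨fun i hi => ?_, fun i hi => ?_⟩
      · rcases Nat.lt_succ_iff_lt_or_eq.1 hi with h | rfl
        · simp [setEntry, exec_setCell, Memory.setCell_mem, NExpr.eval, Memory.setReg_reg, h.ne,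
            e1 i h]
        · simp [setEntry, exec_setCell, Memory.setCell_mem, NExpr.eval, Memory.setReg_reg,
            hv i hk s' ha (e2 i le_rfl)]
      · have : i ≠ k := by omega
        simp [setEntry, exec_setCell, Memory.setCell_mem, NExpr.eval, Memory.setReg_reg, this,
          e2 i (by omega)])
  exact this.1

theorem computePowers_spec (s : Memory) {m t : ℕ} (h0 : s.reg 0 = m) (h3 : s.reg 3 = t)
    (ht : t ≤ m) :
    (computePowers.exec s).mem 13 0 0 = s.mem 10 0 0 ^ t ∧
      (computePowers.exec s).mem 14 0 0 = s.mem 11 0 0 ^ t ∧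
      ∀ i < m, (computePowers.exec s).mem 12 i 0 = s.mem 9 i 0 ^ t := by
  rw [computePowers, exec_seq, exec_seq, exec_seq]
  set s₁ := (setScalar 14 (.const 1)).exec ((setScalar 13 (.const 1)).exec s) with hs₁
  have ha₁ : Agree (.seq (setScalar 13 (.const 1)) (setScalar 14 (.const 1))) s s₁ :=
    exec_agree (.seq _ _) s
  set s₂ := (forFacilities (setEntry 12 (.const 1))).exec s₁ with hs₂
  have ha₂ : Agree _ s₁ s₂ := exec_agree _ _
  have f := fill_spec s₁ 12 (.const 1) (m := m) (by rw [ha₁.reg 0 (by decide), h0])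
    (fun _ => 1) (fun k _ s' _ _ => by simp [RExpr.eval])
  -- The loop has `m` rounds but multiplies only in the first `t`, so the exponent reached after `k`
  -- rounds is `min k t`.
  have key := exec_loop (r := 8) (e := .reg 0) (c := powersBody) (s := s₂)
    (fun k s' => s'.mem 13 0 0 = s.mem 10 0 0 ^ (min k t) ∧
      s'.mem 14 0 0 = s.mem 11 0 0 ^ (min k t) ∧
      ∀ i < m, s'.mem 12 i 0 = s.mem 9 i 0 ^ (min k t)) (N := m)
    (by simp [NExpr.eval, ha₂.reg 0 (by decide), ha₁.reg 0 (by decide), h0]) ?_ ?_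
  · rwa [min_eq_right ht] at key
  · refine ⟨?_, ?_, ?_⟩
    · rw [ha₂.mem 13 (by decide)]
      simp [hs₁, setScalar, exec_setCell, Memory.setCell_mem, NExpr.eval, RExpr.eval]
    · rw [ha₂.mem 14 (by decide)]
      simp [hs₁, setScalar, exec_setCell, Memory.setCell_mem, NExpr.eval, RExpr.eval]
    · simpa using f
  · rintro k hk s' ha ⟨e1, e2, e3⟩
    have hr : ∀ r, r ∉ [5, 8] → s'.reg r = s.reg r := fun r hr => by
      rw [ha.reg r (by simpa [Program.regs, powersBody, setScalar, forFacilities, setEntry,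
        and_comm] using hr), ha₂.reg r (by
          simp only [forFacilities, Program.regs, setEntry]; simp at hr ⊢; exact hr.1),
        ha₁.reg r (by simp [Program.regs, setScalar])]
    have m9 : s'.mem 9 = s.mem 9 := by
      rw [ha.mem 9 (by decide), ha₂.mem 9 (by decide), ha₁.mem 9 (by decide)]
    have m10 : s'.mem 10 = s.mem 10 := by
      rw [ha.mem 10 (by decide), ha₂.mem 10 (by decide), ha₁.mem 10 (by decide)]
    have m11 : s'.mem 11 = s.mem 11 := by
      rw [ha.mem 11 (by decide), ha₂.mem 11 (by decide), ha₁.mem 11 (by decide)]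
    have r3 : s'.reg 3 = t := by rw [hr 3 (by decide), h3]
    have r0 : s'.reg 0 = m := by rw [hr 0 (by decide), h0]
    have htest : (Test.natLt (.reg 8) (.reg 3)).holds (s'.setReg 8 k) ↔ k < t := by
      simp [Test.holds, NExpr.eval, Memory.setReg_reg, r3]
    rw [powersBody, exec_ite]
    by_cases hkt : k < t
    · rw [if_pos (htest.2 hkt), exec_seq, exec_seq]
      rw [min_eq_left hkt.le] at e1 e2 e3
      rw [min_eq_left hkt]
      set s₃ := (setScalar 14 (.mul (scalar 14) (scalar 11))).exec
        ((setScalar 13 (.mul (scalar 13) (scalar 10))).exec (s'.setReg 8 k)) with hs₃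
      have ha₃ : Agree (.seq (setScalar 13 (.mul (scalar 13) (scalar 10)))
        (setScalar 14 (.mul (scalar 14) (scalar 11)))) (s'.setReg 8 k) s₃ :=
        exec_agree (.seq _ _) _
      have ha₄ := exec_agree (forFacilities (setEntry 12 (.mul (entry 12) (entry 9)))) s₃
      refine ⟨?_, ?_, ?_⟩
      · rw [ha₄.mem 13 (by decide), pow_succ, ← e1, ← m10]
        simp [hs₃, setScalar, scalar, exec_setCell, Memory.setCell_mem, NExpr.eval, RExpr.eval]
      · rw [ha₄.mem 14 (by decide), pow_succ, ← e2, ← m11]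
        simp [hs₃, setScalar, scalar, exec_setCell, Memory.setCell_mem, NExpr.eval, RExpr.eval]
      · refine fill_spec s₃ 12 _ (m := m) ?_ (fun i => s.mem 9 i 0 ^ (k + 1)) ?_
        · rw [ha₃.reg 0 (by decide), Memory.setReg_reg]; simpa using r0
        · intro i hi s₄ hb h12
          have n9 : s₄.mem 9 = s.mem 9 := by
            rw [hb.mem 9 (by decide), ha₃.mem 9 (by decide), Memory.setReg_mem, m9]
          have n12 : s₄.mem 12 i 0 = s.mem 9 i 0 ^ k := by
            rw [h12, ha₃.mem 12 (by decide), Memory.setReg_mem, e3 i hi]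
          simp [entry, RExpr.eval, NExpr.eval, Memory.setReg_reg, n9, n12, pow_succ]
    · rw [if_neg (fun h => hkt (htest.1 h)), exec_skip]
      rw [min_eq_right (not_lt.1 hkt)] at e1 e2 e3
      rw [min_eq_right ((not_lt.1 hkt).trans (Nat.le_succ k))]
      exact ⟨e1, e2, e3⟩

theorem computeRate_spec {m : ℕ} {I : Instance m} {n t : ℕ} {s : Memory} (h : Holds I n s)
    (h3 : s.reg 3 = t) {u : Option (Option (Fin m)) → ℝ} (hu0 : s.mem 10 0 0 = u none)
    (hu1 : s.mem 11 0 0 = u (some none)) (hu : ∀ i : Fin m, s.mem 9 i 0 = u (some (some i)))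
    (hw0 : s.mem 13 0 0 = u none ^ t) (hw1 : s.mem 14 0 0 = u (some none) ^ t)
    (hw : ∀ i : Fin m, s.mem 12 i 0 = u (some (some i)) ^ t) :
    (computeRate.exec s).mem 15 0 0 = invStep I n t u (s.x m) (s.y m) ∧
      ∀ i : Fin m, (computeRate.exec s).mem 16 i 0 = grad I n t u (s.x m) (s.y m) i := by
  -- Loop counters are natural numbers, so the quantities of the facilities are extended by 0.
  set G : ℕ → ℝ := fun k => if hk : k < m then grad I n t u (s.x m) (s.y m) ⟨k, hk⟩ else 0 with hG
  set R : ℕ → ℝ := fun k => if hk : k < m then relCost I n u (s.x m) (s.y m) ⟨k, hk⟩ else 0 with hR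
  have key : (computeRate.exec s).mem 15 0 0
      = ∑ k ∈ Finset.range m, (1 + 2 * (t + 1) * R k) / G k ∧
      ∀ k < m, (computeRate.exec s).mem 16 k 0 = G k := by
    rw [computeRate, exec_seq]
    set s₁ := (setScalar 15 (.const 0)).exec s with hs₁
    have ha₁ : Agree _ s s₁ := exec_agree _ s
    refine exec_loop (fun k s' => s'.mem 15 0 0
      = ∑ k ∈ Finset.range k, (1 + 2 * (t + 1) * R k) / G k ∧ ∀ i < k, s'.mem 16 i 0 = G i)
      (by simp [NExpr.eval, ha₁.reg 0 (by decide), h.reg_m]) ?_ ?_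
    · simp [hs₁, setScalar, exec_setCell, Memory.setCell_mem, NExpr.eval, RExpr.eval]
    · rintro k hk s' ha ⟨e1, e2⟩
      have hmem : ∀ a, a ∉ [15, 16] → s'.mem a = s.mem a := fun a h => by
        have h' : a ≠ 15 ∧ a ≠ 16 := by simpa using h
        rw [ha.mem a (by simp [Program.arrays, rateBody, setEntry, addScalar, setScalar, h']),
          ha₁.mem a (by simp [Program.arrays, setScalar, h'])]
      have r1 : s'.reg 1 = n := by rw [ha.reg 1 (by decide), ha₁.reg 1 (by decide), h.reg_client]
      have r3 : s'.reg 3 = t := by rw [ha.reg 3 (by decide), ha₁.reg 3 (by decide), h3]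
      have c1 := h.opening ⟨k, hk⟩
      have c2 := h.assign ⟨k, hk⟩ n le_rfl
      have c3 := h.load ⟨k, hk⟩ n le_rfl
      have c9 := hu ⟨k, hk⟩
      have c12 := hw ⟨k, hk⟩
      simp only at c1 c2 c3 c9 c12
      have hact : isActive.holds (s'.setReg 5 k) ↔ s.x m ⟨k, hk⟩ < s.y m ⟨k, hk⟩ n := by
        simp [isActive, Test.holds, entry, current, RExpr.eval, NExpr.eval, Memory.setReg_reg, r1,
          hmem 4 (by decide), hmem 5 (by decide), Memory.x, Memory.y, arrX, arrY]
      rw [Finset.sum_range_succ, ← e1, rateBody, exec_ite]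
      by_cases hlt : s.x m ⟨k, hk⟩ < s.y m ⟨k, hk⟩ n
      · have hGk : G k = I.opening ⟨k, hk⟩ * u none ^ t := by simp [hG, hk, grad, hlt]
        have hRk : R k = I.opening ⟨k, hk⟩ / u none := by simp [hR, hk, relCost, hlt]
        rw [if_pos (hact.2 hlt)]
        refine ⟨?_, fun i hi => ?_⟩
        · rw [hGk, hRk]
          simp [exec_seq, setEntry, addScalar, setScalar, scalar, entry, rateTerm, exec_setCell,
            Memory.setCell_mem, RExpr.eval, NExpr.eval, Memory.setReg_reg, r3,
            hmem 1 (by decide), hmem 10 (by decide), hmem 13 (by decide), c1, hu0, hw0]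
        · rcases Nat.lt_succ_iff_lt_or_eq.1 hi with h | rfl
          · simp [exec_seq, setEntry, addScalar, setScalar, exec_setCell,
              Memory.setCell_mem, NExpr.eval, Memory.setReg_reg, h.ne, e2 i h]
          · rw [hGk]
            simp [exec_seq, setEntry, addScalar, setScalar, scalar, entry, exec_setCell,
              Memory.setCell_mem, RExpr.eval, NExpr.eval, Memory.setReg_reg,
              hmem 1 (by decide), hmem 13 (by decide), c1, hw0]
      · have hGk : G k = I.assign ⟨k, hk⟩ n * u (some none) ^ t
            + I.load ⟨k, hk⟩ n * u (some (some ⟨k, hk⟩)) ^ t := by simp [hG, hk, grad, slope, hlt]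
        have hRk : R k = I.assign ⟨k, hk⟩ n / u (some none)
            + I.load ⟨k, hk⟩ n / u (some (some ⟨k, hk⟩)) := by simp [hR, hk, relCost, hlt]
        rw [if_neg (fun h => hlt (hact.1 h))]
        refine ⟨?_, fun i hi => ?_⟩
        · rw [hGk, hRk]
          simp [exec_seq, setEntry, addScalar, setScalar, scalar, entry, current, rateTerm,
            exec_setCell, Memory.setCell_mem, RExpr.eval, NExpr.eval, Memory.setReg_reg, r1, r3,
            hmem 2 (by decide), hmem 3 (by decide), hmem 9 (by decide), hmem 11 (by decide),
            hmem 12 (by decide), hmem 14 (by decide), c2, c3, c9, c12, hu1, hw1]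
        · rcases Nat.lt_succ_iff_lt_or_eq.1 hi with h | rfl
          · simp [exec_seq, setEntry, addScalar, setScalar, exec_setCell,
              Memory.setCell_mem, NExpr.eval, Memory.setReg_reg, h.ne, e2 i h]
          · rw [hGk]
            simp [exec_seq, setEntry, addScalar, setScalar, scalar, entry, current, exec_setCell,
              Memory.setCell_mem, RExpr.eval, NExpr.eval, Memory.setReg_reg, r1,
              hmem 2 (by decide), hmem 3 (by decide), hmem 12 (by decide), hmem 14 (by decide),
              c2, c3, c12, hw1]
  refine ⟨?_, fun i => ?_⟩
  · rw [key.1, Finset.sum_range]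
    simp [invStep, hG, hR]
  · rw [key.2 i i.2]
    simp [hG]

/-- Round `k` writes only to facility `k`, so every facility is still judged by its values before
the loop, and the sequential updates amount to a simultaneous one. -/
theorem move_spec {m n : ℕ} {s : Memory} (h0 : s.reg 0 = m) (h1 : s.reg 1 = n) :
    (∀ i : Fin m, (move.exec s).x m i = if s.x m i < s.y m i n then
        s.x m i + (s.x m i + 1 / m) * (1 / (s.mem 15 0 0 * s.mem 16 i 0)) else s.x m i) ∧
      ∀ (i : Fin m) j, (move.exec s).y m i j = if j = n ∧ ¬ s.x m i < s.y m i n then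
        s.y m i j + (s.y m i j + 1 / m) * (1 / (s.mem 15 0 0 * s.mem 16 i 0)) else s.y m i j := by
  have key := exec_loop (r := 5) (e := .reg 0) (c := moveBody) (s := s)
    (fun k s' =>
      (∀ i, s'.mem 4 i 0 = if i < k ∧ s.mem 4 i 0 < s.mem 5 i n then
        s.mem 4 i 0 + (s.mem 4 i 0 + 1 / m) * (1 / (s.mem 15 0 0 * s.mem 16 i 0))
        else s.mem 4 i 0) ∧
      ∀ i j, s'.mem 5 i j = if i < k ∧ j = n ∧ ¬ s.mem 4 i 0 < s.mem 5 i n then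
        s.mem 5 i j + (s.mem 5 i j + 1 / m) * (1 / (s.mem 15 0 0 * s.mem 16 i 0))
        else s.mem 5 i j) (N := m) (by simpa [NExpr.eval] using h0) (by simp) (by
      rintro k hk s' ha ⟨e1, e2⟩
      have r0 : s'.reg 0 = m := by rw [ha.reg 0 (by decide), h0]
      have r1 : s'.reg 1 = n := by rw [ha.reg 1 (by decide), h1]
      have m15 : s'.mem 15 = s.mem 15 := ha.mem 15 (by decide)
      have m16 : s'.mem 16 = s.mem 16 := ha.mem 16 (by decide)
      have x1 : s'.mem 4 k 0 = s.mem 4 k 0 := by simp [e1 k]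
      have y1 : ∀ j, s'.mem 5 k j = s.mem 5 k j := fun j => by simp [e2 k]
      have hact : isActive.holds (s'.setReg 5 k) ↔ s.mem 4 k 0 < s.mem 5 k n := by
        simp [isActive, Test.holds, entry, current, RExpr.eval, NExpr.eval, Memory.setReg_reg, r1,
          x1, y1]
      rw [moveBody, exec_ite]
      by_cases hlt : s.mem 4 k 0 < s.mem 5 k n
      · rw [if_pos (hact.2 hlt)]
        refine ⟨fun i => ?_, fun i j => ?_⟩
        · by_cases hik : i = k
          · subst hik
            simp [setEntry, moved, scalar, entry, exec_setCell, Memory.setCell_mem, RExpr.eval,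
              NExpr.eval, Memory.setReg_reg, r0, m15, m16, x1, hlt]
          · have : i < k + 1 ↔ i < k := by omega
            simp [setEntry, exec_setCell, Memory.setCell_mem, NExpr.eval, Memory.setReg_reg, hik,
              this, e1 i]
        · by_cases hik : i = k
          · subst hik
            simp [setEntry, exec_setCell, Memory.setCell_mem, NExpr.eval, y1, hlt]
          · have : i < k + 1 ↔ i < k := by omega
            simp [setEntry, exec_setCell, Memory.setCell_mem, this, e2 i]
      · rw [if_neg (fun h => hlt (hact.1 h))]
        refine ⟨fun i => ?_, fun i j => ?_⟩
        · by_cases hik : i = k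
          · subst hik
            simp [exec_setCell, Memory.setCell_mem, x1, hlt]
          · have : i < k + 1 ↔ i < k := by omega
            simp [exec_setCell, Memory.setCell_mem, this, e1 i]
        · by_cases hik : i = k
          · subst hik
            by_cases hj : j = n
            · subst hj
              simp [moved, scalar, entry, current, exec_setCell, Memory.setCell_mem, RExpr.eval,
                NExpr.eval, Memory.setReg_reg, r0, r1, m15, m16, y1, not_lt.1 hlt]
            · simp [exec_setCell, Memory.setCell_mem, NExpr.eval, Memory.setReg_reg, r1, hj, y1]
          · have : i < k + 1 ↔ i < k := by omega
            simp [exec_setCell, Memory.setCell_mem, NExpr.eval, Memory.setReg_reg, hik, this,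
              e2 i])
  refine ⟨fun i => ?_, fun i j => ?_⟩
  · have := key.1 i
    simpa [move, forFacilities, Memory.x, Memory.y, arrX, arrY] using this
  · have := key.2 i j
    simpa [move, forFacilities, Memory.x, Memory.y, arrX, arrY] using this

theorem x_of_agree {c : Program} {s s' : Memory} (ha : Agree c s s') (hc : 4 ∉ c.arrays) :
    s'.x m = s.x m := by
  funext i
  exact congrFun (congrFun (ha.mem 4 hc) _) _

theorem y_of_agree {c : Program} {s s' : Memory} (ha : Agree c s s') (hc : 5 ∉ c.arrays) :
    s'.y m = s.y m := by
  funext i j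
  exact congrFun (congrFun (ha.mem 5 hc) _) _

/-- The least left-hand side of the constraints of client `n`. -/
def minCoverage (n : ℕ) (x : Fin m → ℝ) (y : Fin m → ℕ → ℝ) : ℝ := ∑ i, min (x i) (y i n)

theorem scan_coverage {s : Memory} {n : ℕ} (h0 : s.reg 0 = m) (h1 : s.reg 1 = n) :
    (scan.exec s).mem 8 0 0 = minCoverage n (s.x m) (s.y m) := by
  rw [(scan_spec s h0 h1).1, Finset.sum_range]
  rfl

theorem scan_set {s : Memory} {n : ℕ} (h0 : s.reg 0 = m) (h1 : s.reg 1 = n) (i : Fin m) :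
    (scan.exec s).mem 6 i 0 ≠ 0 ↔ s.x m i < s.y m i n := by
  rw [(scan_spec s h0 h1).2 i i.2]
  simp [Memory.x, Memory.y, arrX, arrY]

theorem computeRows_rows {I : Instance m} {n : ℕ} {s : Memory} (h : Holds I n s) :
    (computeRows.exec s).mem 10 0 0 = rows I n (s.x m) (s.y m) none + s.mem 7 0 0 ∧
      (computeRows.exec s).mem 11 0 0 = rows I n (s.x m) (s.y m) (some none) + s.mem 7 0 0 ∧
      ∀ i : Fin m, (computeRows.exec s).mem 9 i 0
        = rows I n (s.x m) (s.y m) (some (some i)) + s.mem 7 0 0 := by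
  obtain ⟨e1, e2, e3⟩ := computeRows_spec s h.reg_m h.reg_client
  have hj : ∀ j ∈ Finset.range (n + 1), j ≤ n := fun j hj =>
    Nat.lt_succ_iff.1 (Finset.mem_range.1 hj)
  refine ⟨?_, ?_, fun i => ?_⟩
  · rw [e1, Finset.sum_range]
    congr 1
    exact Finset.sum_congr rfl fun i _ => by rw [h.opening]; rfl
  · rw [e2, Finset.sum_range]
    congr 1
    exact Finset.sum_congr rfl fun i _ => Finset.sum_congr rfl fun j hj' => by
      rw [h.assign i j (hj j hj')]; rfl
  · rw [e3 i i.2]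
    congr 1
    exact Finset.sum_congr rfl fun j hj' => by rw [h.load i j (hj j hj')]; rfl

/-- The program makes one step if the client is not covered, and nothing otherwise. -/
theorem stepProgram_spec {I : Instance m} {n t : ℕ} {s : Memory} (h : Holds I n s)
    (h3 : s.reg 3 = t) (ht : t ≤ m) {u}
    (hu : u = fun r => rows I n (s.x m) (s.y m) r + s.mem 7 0 0) :
    (minCoverage n (s.x m) (s.y m) < 1 →
      (stepProgram.exec s).x m = stepX I n t u (s.x m) (s.y m) ∧
      (stepProgram.exec s).y m = stepY I n t u (s.x m) (s.y m)) ∧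
    (1 ≤ minCoverage n (s.x m) (s.y m) →
      (stepProgram.exec s).x m = s.x m ∧ (stepProgram.exec s).y m = s.y m) := by
  have hcov := scan_coverage h.reg_m h.reg_client
  set s₁ := scan.exec s with hs₁
  have a₁ : Agree scan s s₁ := exec_agree _ _
  have k₁ : Holds I n s₁ := h.of_agree a₁ (by decide)
  have x₁ : s₁.x m = s.x m := x_of_agree a₁ (by decide)
  have y₁ : s₁.y m = s.y m := y_of_agree a₁ (by decide)
  have htest : (Test.realLt (scalar 8) (.const 1)).holds s₁
      ↔ minCoverage n (s.x m) (s.y m) < 1 := by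
    simp [Test.holds, scalar, RExpr.eval, NExpr.eval, hcov]
  rw [stepProgram, exec_seq, exec_ite, ← hs₁]
  refine ⟨fun hlt => ?_, fun hge => ?_⟩
  · rw [if_pos (htest.2 hlt), exec_seq, exec_seq, exec_seq]
    obtain ⟨u1, u2, u3⟩ := computeRows_rows k₁
    set s₂ := computeRows.exec s₁ with hs₂
    have a₂ : Agree computeRows s₁ s₂ := exec_agree _ _
    have k₂ : Holds I n s₂ := k₁.of_agree a₂ (by decide)
    have r₂ : s₂.reg 3 = t := by rw [a₂.reg 3 (by decide), a₁.reg 3 (by decide), h3]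
    obtain ⟨w1, w2, w3⟩ := computePowers_spec s₂ k₂.reg_m r₂ ht
    set s₃ := computePowers.exec s₂ with hs₃
    have a₃ : Agree computePowers s₂ s₃ := exec_agree _ _
    have k₃ : Holds I n s₃ := k₂.of_agree a₃ (by decide)
    have r₃ : s₃.reg 3 = t := by rw [a₃.reg 3 (by decide), r₂]
    rw [a₁.mem 7 (by decide), x₁, y₁] at u1 u2 u3
    have x₃ : s₃.x m = s.x m := by rw [x_of_agree a₃ (by decide), x_of_agree a₂ (by decide), x₁]
    have y₃ : s₃.y m = s.y m := by rw [y_of_agree a₃ (by decide), y_of_agree a₂ (by decide), y₁]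
    obtain ⟨d1, d2⟩ := computeRate_spec (u := u) k₃ r₃
      (by rw [a₃.mem 10 (by decide), u1, hu]) (by rw [a₃.mem 11 (by decide), u2, hu])
      (fun i => by rw [a₃.mem 9 (by decide), u3, hu]) (by rw [w1, u1, hu]) (by rw [w2, u2, hu])
      (fun i => by rw [w3 i i.2, u3, hu])
    set s₄ := computeRate.exec s₃ with hs₄
    have a₄ : Agree computeRate s₃ s₄ := exec_agree _ _
    have k₄ : Holds I n s₄ := k₃.of_agree a₄ (by decide)
    have x₄ : s₄.x m = s.x m := by rw [x_of_agree a₄ (by decide), x₃]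
    have y₄ : s₄.y m = s.y m := by rw [y_of_agree a₄ (by decide), y₃]
    obtain ⟨f1, f2⟩ := move_spec k₄.reg_m k₄.reg_client
    rw [x₃, y₃] at d1 d2
    rw [x₄, y₄] at f1 f2
    refine ⟨funext fun i => ?_, funext fun i => funext fun j => ?_⟩
    · rw [f1 i, d1, d2 i, stepX, growth]
    · rw [f2 i j, d1, d2 i, stepY, growth]
  · rw [if_neg (fun hc => (htest.1 hc).not_ge hge), exec_skip]
    exact ⟨x₁, y₁⟩

theorem raiseFree_spec {I : Instance m} {n : ℕ} {s : Memory} (h : Holds I n s) :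
    (∀ i, (raiseFree.exec s).x m i = if 0 < I.opening i then s.x m i else 4) ∧
      ∀ i j, (raiseFree.exec s).y m i j
        = if j = n ∧ ¬ 0 < I.assign i n + I.load i n then 4 else s.y m i j := by
  have key := exec_loop (r := 5) (e := .reg 0) (c := freeBody) (s := s)
    (fun k s' =>
      (∀ i, s'.mem 4 i 0 = if i < k ∧ ¬ 0 < s.mem 1 i 0 then 4 else s.mem 4 i 0) ∧
      ∀ i j, s'.mem 5 i j = if i < k ∧ j = n ∧ ¬ 0 < s.mem 2 i n + s.mem 3 i n then 4
        else s.mem 5 i j) (N := m) (by simpa [NExpr.eval] using h.reg_m) (by simp) (by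
      rintro k hk s' ha ⟨e1, e2⟩
      have r1 : s'.reg 1 = n := by rw [ha.reg 1 (by decide), h.reg_client]
      have m1 : s'.mem 1 = s.mem 1 := ha.mem 1 (by decide)
      have m2 : s'.mem 2 = s.mem 2 := ha.mem 2 (by decide)
      have m3 : s'.mem 3 = s.mem 3 := ha.mem 3 (by decide)
      rw [freeBody, exec_seq]
      set s₂ := (Program.ite (.realLt (.const 0) (entry 1)) .skip (setEntry 4 (.const 4))).exec
        (s'.setReg 5 k) with hs₂
      have a₂ : Agree (.ite (.realLt (.const 0) (entry 1)) .skip (setEntry 4 (.const 4)))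
        (s'.setReg 5 k) s₂ := exec_agree _ _
      have q1 : s₂.reg 1 = n := by rw [a₂.reg 1 (by decide), Memory.setReg_reg]; simpa using r1
      have q5 : s₂.reg 5 = k := by rw [a₂.reg 5 (by decide), Memory.setReg_reg]; simp
      have n2 : s₂.mem 2 = s.mem 2 := by rw [a₂.mem 2 (by decide), Memory.setReg_mem, m2]
      have n3 : s₂.mem 3 = s.mem 3 := by rw [a₂.mem 3 (by decide), Memory.setReg_mem, m3]
      have n5 : s₂.mem 5 = s'.mem 5 := by rw [a₂.mem 5 (by decide), Memory.setReg_mem]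
      have t1 : (Test.realLt (.const 0) (entry 1)).holds (s'.setReg 5 k) ↔ 0 < s.mem 1 k 0 := by
        simp [Test.holds, entry, RExpr.eval, NExpr.eval, Memory.setReg_reg, m1]
      have t2 : (Test.realLt (.const 0) (.add (current 2) (current 3))).holds s₂
          ↔ 0 < s.mem 2 k n + s.mem 3 k n := by
        simp [Test.holds, current, RExpr.eval, NExpr.eval, q1, q5, n2, n3]
      have a₃ := exec_agree (.ite (.realLt (.const 0) (.add (current 2) (current 3))) .skip
        (.setCell 5 (.reg 5) (.reg 1) (.const 4))) s₂
      refine ⟨fun i => ?_, fun i j => ?_⟩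
      · rw [a₃.mem 4 (by decide), hs₂, exec_ite]
        by_cases hik : i = k
        · subst hik
          by_cases hc : 0 < s.mem 1 i 0
          · rw [if_pos (t1.2 hc), exec_skip, Memory.setReg_mem, e1]
            simp [hc]
          · rw [if_neg (fun h => hc (t1.1 h))]
            simp [setEntry, exec_setCell, Memory.setCell_mem, RExpr.eval, NExpr.eval,
              Memory.setReg_reg, not_lt.1 hc]
        · have : i < k + 1 ↔ i < k := by omega
          simp only [this]
          rw [← e1]
          split_ifs
          · rfl
          · simp [setEntry, exec_setCell, Memory.setCell_mem, RExpr.eval, NExpr.eval,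
              Memory.setReg_reg, hik]
      · rw [exec_ite]
        by_cases hik : i = k
        · subst hik
          by_cases hc : 0 < s.mem 2 i n + s.mem 3 i n
          · rw [if_pos (t2.2 hc), exec_skip, n5, e2]
            simp [hc]
          · rw [if_neg (fun h => hc (t2.1 h))]
            by_cases hj : j = n
            · simp [exec_setCell, Memory.setCell_mem, RExpr.eval, NExpr.eval, q1, q5,
                not_lt.1 hc, hj]
            · simp [exec_setCell, Memory.setCell_mem, RExpr.eval, NExpr.eval, q1, q5, hj, n5, e2]
        · have : i < k + 1 ↔ i < k := by omega
          simp only [this]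
          rw [← e2]
          split_ifs
          · rw [exec_skip, n5]
          · simp [exec_setCell, Memory.setCell_mem, RExpr.eval, NExpr.eval, q1, q5, hik, n5])
  refine ⟨fun i => ?_, fun i j => ?_⟩
  · have h1 := key.1 i
    rw [h.opening] at h1
    change ((Program.loop 5 (.reg 0) freeBody).exec s).mem 4 i 0 = _
    rw [h1]
    simp only [i.2, true_and, ite_not]
    rfl
  · have h1 := key.2 i j
    rw [h.assign i n le_rfl, h.load i n le_rfl] at h1
    change ((Program.loop 5 (.reg 0) freeBody).exec s).mem 5 i j = _
    rw [h1]
    simp only [i.2, true_and]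
    rfl

theorem fullCost_eval {I : Instance m} {n : ℕ} {s : Memory} (h : Holds I n s) (i : Fin m)
    (hi : s.reg 5 = i) : fullCostExpr.eval s = fullCost I i n := by
  simp [fullCostExpr, fullCost, entry, current, RExpr.eval, NExpr.eval, hi, h.reg_client,
    h.opening, h.assign, h.load]

theorem Holds.setReg {I : Instance m} {n : ℕ} {s : Memory} (h : Holds I n s) {r : ℕ} (v : ℕ)
    (hr : 2 ≤ r) : Holds I n (s.setReg r v) := by
  refine ⟨?_, ?_, h.opening, h.assign, h.load⟩
  · rw [Memory.setReg_reg, if_neg (by omega), h.reg_m]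
  · rw [Memory.setReg_reg, if_neg (by omega), h.reg_client]

theorem computeCheapest_spec {I : Instance m} {n : ℕ} {s : Memory} (h : Holds I n s)
    (hm : 2 ≤ m) :
    (∀ i, (computeCheapest.exec s).mem 8 0 0 ≤ fullCost I i n) ∧
      ∃ i, (computeCheapest.exec s).mem 8 0 0 = fullCost I i n := by
  rw [computeCheapest, exec_seq, exec_seq, exec_setReg]
  have k₁ : Holds I n (s.setReg 5 0) := h.setReg 0 (by norm_num)
  have v₁ := fullCost_eval k₁ (⟨0, by omega⟩ : Fin m) (by simp [Memory.setReg_reg])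
  set s₂ := (setScalar 8 fullCostExpr).exec (s.setReg 5 ((NExpr.const 0).eval s)) with hs₂
  have a₂ : Agree (setScalar 8 fullCostExpr) (s.setReg 5 0) s₂ := exec_agree _ _
  have k₂ : Holds I n s₂ := k₁.of_agree a₂ (by decide)
  have w₂ : s₂.mem 8 0 0 = fullCost I (⟨0, by omega⟩ : Fin m) n := by
    rw [← v₁]
    simp [hs₂, setScalar, exec_setCell, Memory.setCell_mem, NExpr.eval]
  have key := exec_loop (r := 5) (e := .reg 0) (s := s₂)
    (c := .ite (.realLt fullCostExpr (scalar 8)) (setScalar 8 fullCostExpr) .skip)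
    (fun k s' => (∀ i : Fin m, (i : ℕ) < k → s'.mem 8 0 0 ≤ fullCost I i n) ∧
      ∃ i, s'.mem 8 0 0 = fullCost I i n) (N := m) (by simpa [NExpr.eval] using k₂.reg_m)
    ⟨fun i hi => absurd hi (Nat.not_lt_zero _), _, w₂⟩ (by
      rintro k hk s' ha ⟨e1, e2⟩
      have k' : Holds I n s' := k₂.of_agree ha (by decide)
      have v := fullCost_eval (k'.setReg (r := 5) k (by norm_num)) ⟨k, hk⟩
        (by simp [Memory.setReg_reg])
      have htest : (Test.realLt fullCostExpr (scalar 8)).holds (s'.setReg 5 k)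
          ↔ fullCost I ⟨k, hk⟩ n < s'.mem 8 0 0 := by
        simp [Test.holds, v, scalar, RExpr.eval, NExpr.eval]
      rw [exec_ite]
      by_cases hlt : fullCost I ⟨k, hk⟩ n < s'.mem 8 0 0
      · rw [if_pos (htest.2 hlt)]
        have e : ((setScalar 8 fullCostExpr).exec (s'.setReg 5 k)).mem 8 0 0
            = fullCost I ⟨k, hk⟩ n := by
          simp [setScalar, exec_setCell, Memory.setCell_mem, NExpr.eval, v]
        rw [e]
        refine ⟨fun i hi => ?_, _, rfl⟩
        rcases Nat.lt_succ_iff_lt_or_eq.1 hi with h | h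
        · exact hlt.le.trans (e1 i h)
        · have : i = ⟨k, hk⟩ := Fin.ext h
          rw [this]
      · rw [if_neg (fun h => hlt (htest.1 h)), exec_skip]
        refine ⟨fun i hi => ?_, e2⟩
        rcases Nat.lt_succ_iff_lt_or_eq.1 hi with h | h
        · exact e1 i h
        · have : i = ⟨k, hk⟩ := Fin.ext h
          rw [this]
          exact not_lt.1 hlt)
  exact ⟨fun i => key.1 i i.2, key.2⟩

theorem raiseFloor_spec {I : Instance m} {n : ℕ} {s : Memory} (h : Holds I n s) (hm : 2 ≤ m) :
    ∃ μ : ℝ, (∀ i, μ ≤ fullCost I i n) ∧ (∃ i, μ = fullCost I i n) ∧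
      (raiseFloor.exec s).mem 7 0 0 = max (s.mem 7 0 0) (μ / (2 * m)) := by
  obtain ⟨h1, h2⟩ := computeCheapest_spec h hm
  refine ⟨_, h1, h2, ?_⟩
  rw [raiseFloor, exec_seq, exec_ite]
  set s₁ := computeCheapest.exec s with hs₁
  have a₁ : Agree computeCheapest s s₁ := exec_agree _ _
  have v : floorExpr.eval s₁ = s₁.mem 8 0 0 / (2 * m) := by
    simp [floorExpr, scalar, RExpr.eval, NExpr.eval, a₁.reg 0 (by decide), h.reg_m]
  have htest : (Test.realLt (scalar 7) floorExpr).holds s₁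
      ↔ s.mem 7 0 0 < s₁.mem 8 0 0 / (2 * m) := by
    simp [Test.holds, v, scalar, RExpr.eval, NExpr.eval, a₁.mem 7 (by decide)]
  by_cases hlt : s.mem 7 0 0 < s₁.mem 8 0 0 / (2 * m)
  · rw [if_pos (htest.2 hlt), max_eq_right hlt.le]
    simp [setScalar, exec_setCell, Memory.setCell_mem, NExpr.eval, v]
  · rw [if_neg (fun h => hlt (htest.1 h)), max_eq_left (not_lt.1 hlt), exec_skip,
      a₁.mem 7 (by decide)]

/-! ### The exponent of the weights -/

theorem two_mul_le_two_pow {m : ℕ} (hm : 2 ≤ m) : 2 * m ≤ 2 ^ m := by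
  induction m, hm using Nat.le_induction with
  | base => norm_num
  | succ k hk ih => rw [pow_succ]; omega

theorem clog_le_self {m : ℕ} (hm : 2 ≤ m) : Nat.clog 2 (2 * m) ≤ m :=
  Nat.clog_le_of_le_pow (two_mul_le_two_pow hm)

/-- Register 4 holds the power of 2 with exponent in register 3 and is doubled while below 2m. The
`m` rounds suffice because the logarithm is at most `m`. -/
theorem computeExponent_spec {s : Memory} (h0 : s.reg 0 = m) (hm : 2 ≤ m) :
    (computeExponent.exec s).reg 3 = Nat.clog 2 (2 * m) := by
  rw [computeExponent, exec_seq, exec_seq, exec_setReg, exec_setReg]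
  have key := exec_loop (r := 8) (e := .reg 0) (c := exponentBody) (N := m)
    (s := (s.setReg 3 ((NExpr.const 0).eval s)).setReg 4
      ((NExpr.const 1).eval (s.setReg 3 ((NExpr.const 0).eval s))))
    (fun k s' => s'.reg 4 = 2 ^ s'.reg 3 ∧ (s'.reg 3 = k ∨ 2 * m ≤ s'.reg 4) ∧
      s'.reg 3 ≤ Nat.clog 2 (2 * m)) (by simp [NExpr.eval, Memory.setReg_reg, h0])
    (by simp [NExpr.eval, Memory.setReg_reg]) (by
      rintro k hk s' ha ⟨e1, e2, e3⟩
      have r0 : s'.reg 0 = m := by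
        rw [ha.reg 0 (by decide), Memory.setReg_reg, Memory.setReg_reg]; simpa using h0
      have htest : (Test.natLt (.reg 4) (.add (.reg 0) (.reg 0))).holds (s'.setReg 8 k)
          ↔ s'.reg 4 < 2 * m := by
        simp [Test.holds, NExpr.eval, Memory.setReg_reg, r0, two_mul]
      rw [exponentBody, exec_ite]
      by_cases hlt : s'.reg 4 < 2 * m
      · rw [if_pos (htest.2 hlt)]
        have hk' : s'.reg 3 = k := e2.resolve_right (not_le.2 hlt)
        have hc : s'.reg 3 < Nat.clog 2 (2 * m) :=
          (Nat.lt_clog_iff_pow_lt (by norm_num)).2 (e1 ▸ hlt)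
        simp only [exec_seq, exec_setReg, NExpr.eval, Memory.setReg_reg]
        norm_num
        refine ⟨?_, Or.inl hk', hc⟩
        rw [e1, pow_succ]; ring
      · rw [if_neg (fun h => hlt (htest.1 h)), exec_skip]
        simp only [Memory.setReg_reg]
        norm_num
        exact ⟨e1, Or.inr (not_lt.1 hlt), e3⟩)
  refine le_antisymm key.2.2 ?_
  rcases key.2.1 with h | h
  · rw [h]; exact clog_le_self hm
  · rw [key.1] at h
    exact Nat.clog_le_of_le_pow h

/-- The update covers the client and preserves the invariant. -/
theorem updating_spec {I : Instance m} {n : ℕ} {s : Memory} (hm : 2 ≤ m) (h : Holds I n s)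
    (hinv : Inv I n (Nat.clog 2 (2 * m)) (s.mem 7 0 0) (s.x m) (s.y m)) :
    Inv I n (Nat.clog 2 (2 * m)) ((updating.exec s).mem 7 0 0) ((updating.exec s).x m)
        ((updating.exec s).y m) ∧
      (∀ i, s.x m i ≤ (updating.exec s).x m i) ∧
      (∀ i, ∀ j ≤ n, s.y m i j ≤ (updating.exec s).y m i j) ∧
      1 ≤ minCoverage n ((updating.exec s).x m) ((updating.exec s).y m) := by
  have hmR : (2 : ℝ) ≤ m := by exact_mod_cast hm
  set t := Nat.clog 2 (2 * m) with ht
  have htm : t ≤ m := clog_le_self hm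
  have ht2 : m + 2 ≤ 2 ^ t := le_trans (by omega) (Nat.le_pow_clog (by norm_num) (2 * m))
  rw [updating, exec_seq, exec_seq, exec_seq]
  obtain ⟨fx, fy⟩ := raiseFree_spec h
  set s₁ := raiseFree.exec s with hs₁
  have a₁ : Agree raiseFree s s₁ := exec_agree _ _
  have k₁ : Holds I n s₁ := h.of_agree a₁ (by decide)
  have o₁ : ∀ i, I.opening i = 0 → s₁.x m i = 4 := fun i hi => by rw [fx, hi]; simp
  have c₁ : ∀ i, I.assign i n = 0 → I.load i n = 0 → s₁.y m i n = 4 := fun i ha hl => by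
    rw [fy, ha, hl]; simp
  have i₁ : Inv I n t (s₁.mem 7 0 0) (s₁.x m) (s₁.y m) := by
    rw [a₁.mem 7 (by decide)]
    refine hinv.raise (fun i => ?_) fun i j _ => ?_
    · by_cases hi : 0 < I.opening i
      · left; rw [fx, if_pos hi]
      · right; exact ⟨le_antisymm (not_lt.1 hi) (I.opening_nonneg i), by rw [fx, if_neg hi]⟩
    · by_cases hi : j = n ∧ ¬ 0 < I.assign i n + I.load i n
      · right
        rw [fy, if_pos hi, hi.1]
        have := I.assign_nonneg i n
        have := I.load_nonneg i n
        have := not_lt.1 hi.2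
        exact ⟨⟨by linarith, by linarith⟩, rfl⟩
      · left; rw [fy, if_neg hi]
  have x₁ : ∀ i, s.x m i ≤ s₁.x m i := fun i => by
    rw [fx]; split_ifs
    exacts [le_rfl, hinv.x_le i]
  have y₁ : ∀ i, ∀ j ≤ n, s.y m i j ≤ s₁.y m i j := fun i j hj => by
    rw [fy]; split_ifs
    exacts [hinv.y_le i j hj, le_rfl]
  obtain ⟨μ, hμ, ⟨iμ, hiμ⟩, hθ⟩ := raiseFloor_spec k₁ hm
  set s₂ := raiseFloor.exec s₁ with hs₂
  have a₂ : Agree raiseFloor s₁ s₂ := exec_agree _ _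
  have k₂ : Holds I n s₂ := k₁.of_agree a₂ (by decide)
  have hμ0 : 0 ≤ μ := by
    rw [hiμ]
    exact add_nonneg (add_nonneg (I.opening_nonneg _) (I.assign_nonneg _ _)) (I.load_nonneg _ _)
  have i₂ : Inv I n t (s₂.mem 7 0 0) (s₁.x m) (s₁.y m) := by
    rw [hθ]
    exact i₁.raise_floor (le_max_left _ _) fun xs ys hf b hb =>
      max_le (i₁.floor_le xs ys hf b hb) (cheapest_le hm hf hb hμ0 hμ)
  -- The floor is now at least μ/(2m), so the cheapest facility accounts for client `n`.
  have acc : Accounted I (s₂.mem 7 0 0) n := by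
    refine ⟨iμ, ?_⟩
    rw [← hiμ, hθ]
    have := le_max_right (s₁.mem 7 0 0) (μ / (2 * m))
    rw [div_le_iff₀ (by positivity)] at this
    linarith
  have t₃ := computeExponent_spec k₂.reg_m hm
  set s₃ := computeExponent.exec s₂ with hs₃
  have a₃ : Agree computeExponent s₂ s₃ := exec_agree _ _
  have k₃ : Holds I n s₃ := k₂.of_agree a₃ (by decide)
  have x₃ : s₃.x m = s₁.x m := by rw [x_of_agree a₃ (by decide), x_of_agree a₂ (by decide)]
  have y₃ : s₃.y m = s₁.y m := by rw [y_of_agree a₃ (by decide), y_of_agree a₂ (by decide)]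
  have θ₃ : s₃.mem 7 = s₂.mem 7 := a₃.mem 7 (by decide)
  have hsafe : (0 ∉ stepProgram.regs ∧ 1 ∉ stepProgram.regs) ∧ 1 ∉ stepProgram.arrays ∧
      2 ∉ stepProgram.arrays ∧ 3 ∉ stepProgram.arrays := by decide
  -- These are the hypotheses of `exec_times`: a step preserves the situation, keeps a covered
  -- client covered, and otherwise raises the progress, scaled by 2(t+1)m, by at least 1.
  have key : ∀ s' : Memory, (Holds I n s' ∧ s'.reg 3 = t ∧
      Ready I n t (s'.mem 7 0 0) (s'.x m) (s'.y m) ∧ (∀ i, s₁.x m i ≤ s'.x m i) ∧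
      ∀ i, ∀ j ≤ n, s₁.y m i j ≤ s'.y m i j) →
      (Holds I n (stepProgram.exec s') ∧ (stepProgram.exec s').reg 3 = t ∧
      Ready I n t ((stepProgram.exec s').mem 7 0 0) ((stepProgram.exec s').x m)
        ((stepProgram.exec s').y m) ∧ (∀ i, s₁.x m i ≤ (stepProgram.exec s').x m i) ∧
      ∀ i, ∀ j ≤ n, s₁.y m i j ≤ (stepProgram.exec s').y m i j) ∧
      (1 ≤ minCoverage n (s'.x m) (s'.y m) →
        1 ≤ minCoverage n ((stepProgram.exec s').x m) ((stepProgram.exec s').y m)) ∧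
      (¬ 1 ≤ minCoverage n (s'.x m) (s'.y m) → 0 < s'.mem 7 0 0 ∧
        2 * (t + 1) * m * progress I n (s'.mem 7 0 0) (s'.x m) (s'.y m) + 1
        ≤ 2 * (t + 1) * m * progress I n ((stepProgram.exec s').mem 7 0 0)
          ((stepProgram.exec s').x m) ((stepProgram.exec s').y m)) := by
    rintro s' ⟨g1, g2, g3, g4, g5⟩
    have a' := exec_agree stepProgram s'
    have kk : Holds I n (stepProgram.exec s') := g1.of_agree a' hsafe
    have rr : (stepProgram.exec s').reg 3 = t := by rw [a'.reg 3 (by decide), g2]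
    have θθ : (stepProgram.exec s').mem 7 = s'.mem 7 := a'.mem 7 (by decide)
    obtain ⟨p1, p2⟩ := stepProgram_spec g1 g2 htm rfl
    rw [θθ]
    rcases lt_or_ge (minCoverage n (s'.x m) (s'.y m)) 1 with hlt | hge
    · obtain ⟨e1, e2⟩ := p1 hlt
      obtain ⟨q0, q1, q2, q3, q4⟩ := g3.step hm hlt rfl
      rw [e1, e2]
      refine ⟨⟨kk, rr, q3, fun i => (g4 i).trans (q1 i), fun i j hj => (g5 i j hj).trans (q2 i j)⟩,
        fun h => absurd hlt (not_lt.2 h), fun _ => ⟨q0, ?_⟩⟩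
      have hpos : (0 : ℝ) < 2 * (t + 1) * m := by positivity
      have := mul_le_mul_of_nonneg_left q4 hpos.le
      rw [mul_add, mul_one_div_cancel hpos.ne'] at this
      exact this
    · obtain ⟨e1, e2⟩ := p2 hge
      rw [e1, e2]
      exact ⟨⟨kk, rr, g3, g4, g5⟩, id, fun h => absurd hge h⟩
  obtain ⟨⟨_, _, f3, f4, f5⟩, _, f6⟩ := exec_times stepProgram hsafe.1.1 hsafe.1.2
    (fun s' => Holds I n s' ∧ s'.reg 3 = t ∧
      Ready I n t (s'.mem 7 0 0) (s'.x m) (s'.y m) ∧ (∀ i, s₁.x m i ≤ s'.x m i) ∧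
      ∀ i, ∀ j ≤ n, s₁.y m i j ≤ s'.y m i j)
    (fun s' => 1 ≤ minCoverage n (s'.x m) (s'.y m))
    (fun s' => 2 * (t + 1) * m * progress I n (s'.mem 7 0 0) (s'.x m) (s'.y m))
    (fun s' hs' => (key s' hs').1) (fun s' hs' => (key s' hs').2.1)
    (fun s' hs' hd => ((key s' hs').2.2 hd).2)
    (fun s' k hs' => ⟨⟨hs'.1.setReg k (by norm_num), by
      rw [Memory.setReg_reg, if_neg (by norm_num)]; exact hs'.2.1, hs'.2.2⟩, Iff.rfl, rfl⟩)
    17 s₃ ⟨k₃, t₃, by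
      rw [x₃, y₃, θ₃]; exact ⟨i₂, acc, o₁, c₁⟩, fun i => by rw [x₃], fun i j _ => by rw [y₃]⟩
  set s₄ := (stepProgram.times 17).exec s₃ with hs₄
  refine ⟨f3.inv, fun i => (x₁ i).trans (f4 i), fun i j hj => (y₁ i j hj).trans (f5 i j hj), ?_⟩
  -- Without success the scaled progress would have grown by (m+n+1)^17, beyond its bound
  -- (m+n+1)^16. The bound needs a positive floor, which an uncovered client guarantees.
  by_contra hneg
  have h1 := f6 hneg
  have hθ0 : 0 < s₄.mem 7 0 0 := (f3.step hm (not_le.1 hneg) rfl).1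
  have h2 := f3.progress_le hm ht2 htm hθ0
  have h3 : 0 ≤ progress I n (s₃.mem 7 0 0) (s₃.x m) (s₃.y m) := by
    rw [x₃, y₃, θ₃, progress]
    have e1 : 0 ≤ ∑ i, (m : ℝ) * s₁.x m i :=
      Finset.sum_nonneg fun i _ => mul_nonneg (by positivity) (i₁.x_nonneg i)
    have e2 : 0 ≤ ∑ i, (m : ℝ) * s₁.y m i n :=
      Finset.sum_nonneg fun i _ => mul_nonneg (by positivity) (i₁.y_nonneg i n le_rfl)
    have e3 : 0 ≤ ∑ r, rows I n (s₁.x m) (s₁.y m) r / s₂.mem 7 0 0 :=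
      Finset.sum_nonneg fun r _ =>
        div_nonneg (rows_nonneg I n i₁.x_nonneg i₁.y_nonneg r) i₂.floor_nonneg
    linarith
  have h4 : s₃.reg regM + s₃.reg regClient + 1 = m + n + 1 := by
    have e0 : s₃.reg regM = m := k₃.reg_m
    have e1 : s₃.reg regClient = n := k₃.reg_client
    rw [e0, e1]
  rw [h4] at h1
  have h5 : (0 : ℝ) ≤ 2 * (t + 1) * m * progress I n (s₃.mem 7 0 0) (s₃.x m) (s₃.y m) :=
    mul_nonneg (by positivity) h3
  have h6 : ((m + n + 1 : ℕ) : ℝ) ^ 16 < (((m + n + 1) ^ 17 : ℕ) : ℝ) := by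
    have : 1 < m + n + 1 := by omega
    exact_mod_cast Nat.pow_lt_pow_right this (by norm_num)
  linarith

/-! ## The execution -/

theorem minCoverage_le (n : ℕ) (x : Fin m → ℝ) (y : Fin m → ℕ → ℝ) (S : Finset (Fin m)) :
    minCoverage n x y ≤ coverage x y n S := by
  rw [minCoverage, ← Finset.sum_add_sum_compl S, coverage]
  exact add_le_add (Finset.sum_le_sum fun i _ => min_le_left _ _)
    (Finset.sum_le_sum fun i _ => min_le_right _ _)

open Classical in
theorem coverage_filter (n : ℕ) (x : Fin m → ℝ) (y : Fin m → ℕ → ℝ) :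
    coverage x y n (Finset.univ.filter fun i => x i < y i n) = minCoverage n x y := by
  rw [coverage, Finset.compl_filter, Finset.sum_filter, Finset.sum_filter,
    ← Finset.sum_add_distrib, minCoverage]
  refine Finset.sum_congr rfl fun i _ => ?_
  by_cases h : x i < y i n
  · simp [h, h.le]
  · simp [h, not_lt.1 h]

theorem coverage_mono {x x' : Fin m → ℝ} {y y' : Fin m → ℕ → ℝ} {j : ℕ}
    (hx : ∀ i, x i ≤ x' i) (hy : ∀ i, y i j ≤ y' i j) (S : Finset (Fin m)) :
    coverage x y j S ≤ coverage x' y' j S :=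
  add_le_add (Finset.sum_le_sum fun i _ => hx i) (Finset.sum_le_sum fun i _ => hy i)

theorem separation_safe : (0 ∉ separation.regs ∧ 1 ∉ separation.regs) ∧
    1 ∉ separation.arrays ∧ 2 ∉ separation.arrays ∧ 3 ∉ separation.arrays := by decide

theorem updating_safe : (0 ∉ updating.regs ∧ 1 ∉ updating.regs) ∧
    1 ∉ updating.arrays ∧ 2 ∉ updating.arrays ∧ 3 ∉ updating.arrays := by decide

theorem separation_x (s : Memory) : (separation.exec s).x m = s.x m :=
  x_of_agree (exec_agree _ _) (by decide)

theorem separation_y (s : Memory) : (separation.exec s).y m = s.y m :=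
  y_of_agree (exec_agree _ _) (by decide)

theorem separation_verdict {s : Memory} {n : ℕ} (h0 : s.reg 0 = m) (h1 : s.reg 1 = n) :
    (separation.exec s).reg regVerdict ≠ 0 ↔ minCoverage n (s.x m) (s.y m) < 1 / 2 := by
  have hcov := scan_coverage h0 h1
  have htest : (Test.realLt (scalar 8) (.const (1 / 2))).holds (scan.exec s)
      ↔ minCoverage n (s.x m) (s.y m) < 1 / 2 := by
    simp [Test.holds, scalar, RExpr.eval, NExpr.eval, hcov]
  rw [separation, exec_seq, exec_ite, ← htest]
  split_ifs with h
  · exact iff_of_true (by simp [exec_setReg, Memory.setReg_reg, regVerdict, NExpr.eval]) h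
  · exact iff_of_false (by simp [exec_setReg, Memory.setReg_reg, regVerdict, NExpr.eval]) h

theorem separation_set {s : Memory} {n : ℕ} (h0 : s.reg 0 = m) (h1 : s.reg 1 = n) (i : Fin m) :
    (separation.exec s).mem 6 i 0 ≠ 0 ↔ s.x m i < s.y m i n := by
  have h := scan_set h0 h1 i
  rw [separation, exec_seq, (exec_agree (.ite (.realLt (scalar 8) (.const (1 / 2)))
    (.setReg 2 (.const 1)) (.setReg 2 (.const 0))) (scan.exec s)).mem 6 (by decide)]
  exact h

theorem separatesAt {I : Instance m} {n : ℕ} {s : Memory} (h : Holds I n s) :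
    SeparatesAt m algorithm n s := by
  classical
  have hset : (separation.exec s).set m = Finset.univ.filter fun i => s.x m i < s.y m i n := by
    ext i
    simp only [Memory.set, Finset.mem_filter, Finset.mem_univ, true_and]
    exact separation_set h.reg_m h.reg_client i
  refine ⟨separation_x s, fun i l _ => by
    change (separation.exec s).y m i l = _; rw [separation_y], ?_, ?_, ?_⟩
  · change (separation.exec s).set m = _
    rw [hset]
  · intro S
    change coverage _ _ _ ((separation.exec s).set m) ≤ _
    rw [hset, coverage_filter]
    exact minCoverage_le n _ _ S
  · change (separation.exec s).reg regVerdict ≠ 0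
      ↔ coverage _ _ _ ((separation.exec s).set m) < 1 / 2
    rw [hset, coverage_filter, separation_verdict h.reg_m h.reg_client]

/-- What is known when client `n` has arrived. -/
structure Arrived (I : Instance m) (n : ℕ) (s : Memory) : Prop where
  holds : Holds I n s
  inv : Inv I n (Nat.clog 2 (2 * m)) (s.mem 7 0 0) (s.x m) (s.y m)
  covered : ∀ j < n, ∀ S, 1 / 2 ≤ coverage (s.x m) (s.y m) j S

theorem Arrived.separation {I : Instance m} {n : ℕ} {s : Memory} (h : Arrived I n s) :
    Arrived I n (separation.exec s) := by
  refine ⟨h.holds.of_agree (exec_agree _ _) separation_safe, ?_, ?_⟩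
  · rw [separation_x, separation_y, (exec_agree CCFL.separation s).mem 7 (by decide)]
    exact h.inv
  · rw [separation_x, separation_y]
    exact h.covered

theorem Arrived.updating {I : Instance m} {n : ℕ} {s : Memory} (hm : 2 ≤ m)
    (h : Arrived I n s) :
    Arrived I n (updating.exec s) ∧
      (∀ i, s.x m i ≤ (updating.exec s).x m i) ∧
      (∀ i, ∀ j ≤ n, s.y m i j ≤ (updating.exec s).y m i j) ∧
      1 ≤ minCoverage n ((updating.exec s).x m) ((updating.exec s).y m) := by
  obtain ⟨h1, h2, h3, h4⟩ := updating_spec hm h.holds h.inv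
  exact ⟨⟨h.holds.of_agree (exec_agree _ _) updating_safe, h1, fun j hj S =>
    (h.covered j hj S).trans (coverage_mono h2 (fun i => h3 i j hj.le) S)⟩, h2, h3, h4⟩

theorem arrived_zero (I : Instance m) (p : ℝ) : Arrived I 0 (arrive I 0 (initial I p)) := by
  have hx : (arrive I 0 (initial I p)).x m = fun _ => 0 := by
    funext i
    simp [arrive, initial, Memory.x, arrX, arrAssign, arrLoad, arrY, arrExponent, arrOpening]
  have hy : ∀ i, (arrive I 0 (initial I p)).y m i 0 = 0 := by
    intro i
    simp [arrive, Memory.y, arrAssign, arrLoad, arrY]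
  have h7 : (arrive I 0 (initial I p)).mem 7 0 0 = 0 := by
    simp [arrive, initial, arrAssign, arrLoad, arrY, arrExponent, arrOpening]
  refine ⟨⟨?_, ?_, ?_, ?_, ?_⟩, ?_, fun j hj => absurd hj (Nat.not_lt_zero _)⟩
  · simp [arrive, initial, regClient, regM]
  · simp [arrive, regClient]
  · intro i
    simp [arrive, initial, arrAssign, arrLoad, arrY, arrExponent, arrOpening]
  · intro i j hj
    obtain rfl : j = 0 := by omega
    simp [arrive, arrAssign]
  · intro i j hj
    obtain rfl : j = 0 := by omega
    simp [arrive, arrAssign, arrLoad]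
  · rw [h7, hx]
    exact inv_zero I _ hy

theorem Arrived.arrive {I : Instance m} {n : ℕ} {s : Memory} (h : Arrived I n s)
    (hc : 1 / 2 ≤ minCoverage n (s.x m) (s.y m)) :
    Arrived I (n + 1) (arrive I (n + 1) s) := by
  have hx : (CCFL.arrive I (n + 1) s).x m = s.x m := by
    funext i
    simp [CCFL.arrive, Memory.x, arrX, arrAssign, arrLoad, arrY]
  have hy : ∀ i, ∀ j ≤ n, (CCFL.arrive I (n + 1) s).y m i j = s.y m i j := by
    intro i j hj
    have : j ≠ n + 1 := by omega
    simp [CCFL.arrive, Memory.y, arrAssign, arrLoad, arrY, this]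
  have hy' : ∀ i, (CCFL.arrive I (n + 1) s).y m i (n + 1) = 0 := by
    intro i
    simp [CCFL.arrive, Memory.y, arrAssign, arrLoad, arrY]
  have h7 : (CCFL.arrive I (n + 1) s).mem 7 0 0 = s.mem 7 0 0 := by
    simp [CCFL.arrive, arrAssign, arrLoad, arrY]
  refine ⟨⟨?_, ?_, ?_, ?_, ?_⟩, ?_, fun j hj S => ?_⟩
  · simpa [CCFL.arrive, regClient] using h.holds.reg_m
  · simp [CCFL.arrive, regClient]
  · intro i
    simpa [CCFL.arrive, arrAssign, arrLoad, arrY] using h.holds.opening i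
  · intro i j hj
    by_cases hjn : j = n + 1
    · simp [CCFL.arrive, arrAssign, hjn]
    · simpa [CCFL.arrive, arrAssign, arrLoad, arrY, hjn] using h.holds.assign i j (by omega)
  · intro i j hj
    by_cases hjn : j = n + 1
    · simp [CCFL.arrive, arrAssign, arrLoad, hjn]
    · simpa [CCFL.arrive, arrAssign, arrLoad, arrY, hjn] using h.holds.load i j (by omega)
  · rw [h7, hx]
    exact h.inv.arrive hy hy'
  · have hjn : j ≤ n := Nat.lt_succ_iff.1 hj
    have h1 : 1 / 2 ≤ coverage (s.x m) (s.y m) j S := by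
      rcases hjn.lt_or_eq with h' | rfl
      · exact h.covered j h' S
      · exact hc.trans (minCoverage_le _ _ _ S)
    exact h1.trans (coverage_mono (fun i => by rw [hx]) (fun i => by rw [hy i j hjn]) S)

/-- The number of iterations for the client that arrives in memory `s`. -/
def iterations (s : Memory) : ℕ := if (separation.exec s).reg regVerdict = 0 then 0 else 1

/-- The memory after `k` iterations. -/
def iterate (s : Memory) : ℕ → Memory
  | 0 => s
  | k + 1 => updating.exec (separation.exec (iterate s k))

/-- The memory when client `n` has arrived. -/
def startOf (I : Instance m) (p : ℝ) : ℕ → Memory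
  | 0 => arrive I 0 (initial I p)
  | n + 1 => arrive I (n + 1)
      (separation.exec (iterate (startOf I p n) (iterations (startOf I p n))))

theorem iterations_le (s : Memory) : iterations s ≤ 1 := by
  rw [iterations]; split_ifs <;> norm_num

theorem Arrived.iterate {I : Instance m} {n : ℕ} {s : Memory} (hm : 2 ≤ m) (h : Arrived I n s)
    (k : ℕ) : Arrived I n (iterate s k) := by
  induction k with
  | zero => exact h
  | succ k ih => exact (ih.separation.updating hm).1

/-- Either the oracle finds nothing, or a single update lifts the constraints of all sets to 1 at
once. -/
theorem Arrived.finished {I : Instance m} {n : ℕ} {s : Memory} (hm : 2 ≤ m)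
    (h : Arrived I n s) :
    1 / 2 ≤ minCoverage n ((CCFL.iterate s (iterations s)).x m)
      ((CCFL.iterate s (iterations s)).y m) := by
  have hv := separation_verdict h.holds.reg_m h.holds.reg_client
  by_cases h0 : (CCFL.separation.exec s).reg regVerdict = 0
  · rw [iterations, if_pos h0]
    exact not_lt.1 fun hlt => hv.2 hlt h0
  · rw [iterations, if_neg h0]
    exact le_trans (by norm_num) (h.separation.updating hm).2.2.2

theorem arrived_startOf (hm : 2 ≤ m) (I : Instance m) (p : ℝ) (n : ℕ) :
    Arrived I n (startOf I p n) := by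
  induction n with
  | zero => exact arrived_zero I p
  | succ n ih =>
      refine (ih.iterate hm _).separation.arrive ?_
      rw [separation_x, separation_y]
      exact ih.finished hm

/-- The execution of the algorithm. -/
def execution (hm : 2 ≤ m) (I : Instance m) (p : ℝ) : Execution algorithm I p where
  iters n := iterations (startOf I p n)
  state n k := iterate (startOf I p n) k
  first := rfl
  iterate n k hk := by
    have h1 := iterations_le (startOf I p n)
    obtain rfl : k = 0 := by omega
    refine ⟨fun h => ?_, rfl⟩
    change (separation.exec (startOf I p n)).reg regVerdict = 0 at h
    rw [iterations, if_pos h] at hk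
    exact absurd hk (lt_irrefl _)
  finish n := by
    have h := arrived_startOf hm I p n
    have h' := h.iterate hm (iterations (startOf I p n))
    by_contra hv
    exact absurd ((separation_verdict h'.holds.reg_m h'.holds.reg_client).1 hv)
      (not_lt.2 (h.finished hm))
  next n := rfl

theorem updatesAt {I : Instance m} {n : ℕ} {s : Memory} (hm : 2 ≤ m) (h : Arrived I n s) :
    UpdatesAt m algorithm n s := by
  obtain ⟨_, h2, h3, h4⟩ := h.separation.updating hm
  rw [separation_x] at h2
  rw [separation_y] at h3
  exact ⟨h2, h3, h4.trans (minCoverage_le _ _ _ _)⟩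

/-! ### Running time of the programs -/

theorem tame_facilities {c : Program} (hc : c.Tame) : (forFacilities c).Tame :=
  ⟨fun s => by simp only [NExpr.eval, regM]; omega, hc⟩

theorem tame_clients {c : Program} (hc : c.Tame) : (forClients c).Tame :=
  ⟨fun s => by simp only [NExpr.eval, regClient]; omega, hc⟩

theorem tame_count {c : Program} (hc : c.Tame) : (Program.loop 8 (.reg 0) c).Tame :=
  ⟨fun s => by simp only [NExpr.eval, regM]; omega, hc⟩

theorem tame_times {c : Program} (hc : c.Tame) (k : ℕ) : (c.times k).Tame := by
  induction k with
  | zero => exact hc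
  | succ k ih => exact ⟨fun s => le_rfl, ih⟩

theorem tame_scan : scan.Tame := ⟨trivial, tame_facilities ⟨⟨trivial, trivial⟩, trivial, trivial⟩⟩

theorem tame_separation : separation.Tame := ⟨tame_scan, trivial, trivial⟩

theorem tame_stepProgram : stepProgram.Tame :=
  ⟨tame_scan,
    ⟨⟨trivial, trivial, tame_facilities ⟨trivial, trivial, tame_clients ⟨trivial, trivial⟩⟩⟩,
      ⟨trivial, trivial, tame_facilities trivial,
        tame_count ⟨⟨trivial, trivial, tame_facilities trivial⟩, trivial⟩⟩,
      ⟨trivial, tame_facilities ⟨⟨trivial, trivial⟩, trivial, trivial⟩⟩,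
      tame_facilities ⟨trivial, trivial⟩⟩, trivial⟩

theorem tame_updating : updating.Tame :=
  ⟨tame_facilities ⟨⟨trivial, trivial⟩, trivial, trivial⟩,
    ⟨⟨trivial, trivial, tame_facilities ⟨trivial, trivial⟩⟩, trivial, trivial⟩,
    ⟨trivial, trivial, tame_count ⟨⟨trivial, trivial⟩, trivial⟩⟩,
    tame_times tame_stepProgram 17⟩

theorem separation_steps {I : Instance m} {n : ℕ} {s : Memory} (h : Holds I n s) :
    separation.steps s ≤ separation.timeBound.eval (m + n + 1) := by
  have := steps_le separation tame_separation separation_safe.1.1 separation_safe.1.2 s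
  rwa [show s.reg regM = m from h.reg_m, show s.reg regClient = n from h.reg_client] at this

theorem updating_steps {I : Instance m} {n : ℕ} {s : Memory} (h : Holds I n s) :
    updating.steps s ≤ updating.timeBound.eval (m + n + 1) := by
  have := steps_le updating tame_updating updating_safe.1.1 updating_safe.1.2 s
  rwa [show s.reg regM = m from h.reg_m, show s.reg regClient = n from h.reg_client] at this

/-- A client causes at most two oracle calls and one update. -/
theorem execution_steps (hm : 2 ≤ m) (I : Instance m) (p : ℝ) (n : ℕ) :
    (execution hm I p).steps n
      ≤ (2 * separation.timeBound + updating.timeBound).eval (m + n + 1) := by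
  have h := arrived_startOf hm I p n
  have h1 := iterations_le (startOf I p n)
  have hs : ∀ k, separation.steps (iterate (startOf I p n) k)
      ≤ separation.timeBound.eval (m + n + 1) := fun k => separation_steps (h.iterate hm k).holds
  have hu := updating_steps h.separation.holds
  have e : (2 * separation.timeBound + updating.timeBound).eval (m + n + 1)
      = 2 * separation.timeBound.eval (m + n + 1) + updating.timeBound.eval (m + n + 1) := by
    simp
  rw [e]
  change (∑ k ∈ Finset.range (iterations (startOf I p n)),
    (separation.steps (iterate (startOf I p n) k)
      + updating.steps (separation.exec (iterate (startOf I p n) k))))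
    + separation.steps (iterate (startOf I p n) (iterations (startOf I p n))) ≤ _
  have h2 := hs (iterations (startOf I p n))
  rcases Nat.le_one_iff_eq_zero_or_eq_one.1 h1 with h3 | h3
  · rw [h3] at h2 ⊢
    rw [Finset.sum_range_zero]
    omega
  · rw [h3] at h2 ⊢
    rw [Finset.sum_range_one]
    have h4 := hs 0
    change _ + updating.steps (separation.exec (startOf I p n)) + _ ≤ _
    omega

/-! ## The competitive ratio -/

/-- `rows I n` includes client `n`, hence the shift to `n + 1` clients. -/
theorem objective_eq (I : Instance m) (p : ℝ) (n : ℕ) (x : Fin m → ℝ) (y : Fin m → ℕ → ℝ) :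
    objective I p (n + 1) x y = ∑ r, rows I n x y r ^ p := by
  rw [Fintype.sum_option, Fintype.sum_option, ← add_assoc]
  rfl

theorem rows_two_mul (I : Instance m) (n : ℕ) (x : Fin m → ℝ) (y : Fin m → ℕ → ℝ) (r) :
    rows I n (fun i => 2 * x i) (fun i j => 2 * y i j) r = 2 * rows I n x y r := by
  rcases r with _ | _ | i <;> simp only [rows, Finset.mul_sum]
  · exact Finset.sum_congr rfl fun i _ => by ring
  · exact Finset.sum_congr rfl fun i _ => Finset.sum_congr rfl fun j _ => by ring
  · exact Finset.sum_congr rfl fun j _ => by ring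

/-- The p-norm dominates the maximum norm. -/
theorem rows_le_objective {I : Instance m} {p : ℝ} (hp : 1 ≤ p) {n : ℕ} {x : Fin m → ℝ}
    {y : Fin m → ℕ → ℝ} (hr : ∀ r, 0 ≤ rows I n x y r) (r) :
    rows I n x y r ≤ objective I p (n + 1) x y ^ (1 / p) := by
  rw [objective_eq]
  have h1 : rows I n x y r ^ p ≤ ∑ r, rows I n x y r ^ p :=
    Finset.single_le_sum (f := fun r => rows I n x y r ^ p)
      (fun r _ => Real.rpow_nonneg (hr r) p) (Finset.mem_univ r)
  calc rows I n x y r = (rows I n x y r ^ p) ^ (1 / p) := by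
        rw [← Real.rpow_mul (hr r), mul_one_div_cancel (by linarith), Real.rpow_one]
    _ ≤ _ := Real.rpow_le_rpow (Real.rpow_nonneg (hr r) p) h1 (by positivity)

/-- Conversely, the p-norm of m + 2 rows exceeds their maximum by at most (m+2)^(1/p), and log(m+2)
≤ 2 log m ≤ 2p/a. -/
theorem objective_le {I : Instance m} {a p : ℝ} (ha : 0 < a) (hm : 2 ≤ m) (hp : 1 ≤ p)
    (hap : a * Real.log m ≤ p) {n : ℕ} {x : Fin m → ℝ} {y : Fin m → ℕ → ℝ}
    (hr : ∀ r, 0 ≤ rows I n x y r) {b : ℝ} (hb : ∀ r, rows I n x y r ≤ b) :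
    objective I p (n + 1) x y ^ (1 / p) ≤ Real.exp (2 / a) * b := by
  have hmR : (2 : ℝ) ≤ m := by exact_mod_cast hm
  have hp0 : 0 < p := by linarith
  have hb0 : 0 ≤ b := (hr none).trans (hb none)
  have hlog : 0 < Real.log m := Real.log_pos (by linarith)
  have h1 : objective I p (n + 1) x y ≤ (m + 2) * b ^ p := by
    rw [objective_eq]
    refine (Finset.sum_le_card_nsmul _ _ (b ^ p) fun r _ =>
      Real.rpow_le_rpow (hr r) (hb r) hp0.le).trans_eq ?_
    rw [Finset.card_univ, Fintype.card_option, Fintype.card_option, Fintype.card_fin,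
      nsmul_eq_mul]
    push_cast
    ring
  have h2 : ((m : ℝ) + 2) ^ (1 / p) ≤ Real.exp (2 / a) := by
    rw [Real.rpow_def_of_pos (by positivity)]
    refine Real.exp_le_exp.2 ?_
    have h3 : Real.log (m + 2) ≤ 2 * Real.log m := by
      have : Real.log (m + 2) ≤ Real.log ((m : ℝ) ^ 2) :=
        Real.log_le_log (by positivity) (by nlinarith)
      rwa [Real.log_pow] at this
    rw [mul_one_div, div_le_div_iff₀ hp0 ha]
    nlinarith
  calc objective I p (n + 1) x y ^ (1 / p) ≤ ((m + 2) * b ^ p) ^ (1 / p) := by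
        refine Real.rpow_le_rpow ?_ h1 (by positivity)
        rw [objective_eq]
        exact Finset.sum_nonneg fun r _ => Real.rpow_nonneg (hr r) p
    _ = ((m : ℝ) + 2) ^ (1 / p) * b := by
        rw [Real.mul_rpow (by positivity) (Real.rpow_nonneg hb0 p), ← Real.rpow_mul hb0,
          mul_one_div_cancel hp0.ne', Real.rpow_one]
    _ ≤ _ := mul_le_mul_of_nonneg_right h2 hb0

/-- Below the rounded-up logarithm, 2^(t-1) < 2m; additive constants are absorbed using log m ≥ log
2 > 0.69. -/
theorem clog_add_one_le {m : ℕ} (hm : 2 ≤ m) :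
    (Nat.clog 2 (2 * m) : ℝ) + 1 ≤ 7 * Real.log m := by
  have hmR : (2 : ℝ) ≤ m := by exact_mod_cast hm
  have hl2 : (0.69 : ℝ) < Real.log 2 := lt_trans (by norm_num) Real.log_two_gt_d9
  have hlm : Real.log 2 ≤ Real.log m := Real.log_le_log (by norm_num) hmR
  have hpos : 0 < Nat.clog 2 (2 * m) := Nat.clog_pos (by norm_num) (by omega)
  have h1 : 2 ^ (Nat.clog 2 (2 * m) - 1) < 2 * m :=
    (Nat.lt_clog_iff_pow_lt (by norm_num)).1 (by omega)
  obtain ⟨k, hk⟩ : ∃ k, Nat.clog 2 (2 * m) = k + 1 := ⟨_, (Nat.succ_pred_eq_of_pos hpos).symm⟩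
  rw [hk, Nat.add_sub_cancel] at h1
  have h2 : (2 : ℝ) ^ k ≤ 2 * m := by exact_mod_cast h1.le
  have h3 := Real.log_le_log (by positivity) h2
  rw [Real.log_pow, Real.log_mul (by norm_num) (by positivity)] at h3
  rw [hk]
  push_cast
  have hk0 : (0 : ℝ) ≤ k := Nat.cast_nonneg k
  nlinarith

/-- One logarithm is the exponent t + 1 ≤ 7 log m, the other is log(4m+1) ≤ 4 log m from the
potential. With θ ≤ b ≤ 2 log m · b the constant is 2 · 7 · (2 + 8 · 4) = 476. -/
theorem Inv.rows_le_log {I : Instance m} {n : ℕ} {θ : ℝ} {x : Fin m → ℝ} {y : Fin m → ℕ → ℝ}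
    (h : Inv I n (Nat.clog 2 (2 * m)) θ x y) (hm : 2 ≤ m) {xs : Fin m → ℝ}
    {ys : Fin m → ℕ → ℝ} (hf : Feasible (n + 1) xs ys) {b : ℝ}
    (hb : ∀ r, rows I n xs ys r ≤ b) (r) :
    rows I n x y r ≤ 476 * Real.log m ^ 2 * b := by
  have hmR : (2 : ℝ) ≤ m := by exact_mod_cast hm
  have hl2 : (0.69 : ℝ) < Real.log 2 := lt_trans (by norm_num) Real.log_two_gt_d9
  have hlm : Real.log 2 ≤ Real.log m := Real.log_le_log (by norm_num) hmR
  have hys : ∀ i, ∀ j ≤ n, 0 ≤ ys i j := fun i j hj => hf.2.1 i j (by omega)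
  have hb0 : 0 ≤ b := (rows_nonneg I n hf.1 hys none).trans (hb none)
  have ht2 : m + 2 ≤ 2 ^ Nat.clog 2 (2 * m) :=
    le_trans (by omega) (Nat.le_pow_clog (by norm_num) (2 * m))
  have h1 := h.rows_le ht2 hf.1 hys (fun j hj _ => hf.2.2 j (by omega)) hb r
  have h2 := h.floor_le xs ys hf b hb
  have h3 : Real.log (m * 4 + 1) ≤ 4 * Real.log m := by
    have : Real.log (m * 4 + 1) ≤ Real.log ((m : ℝ) ^ 4) := by
      refine Real.log_le_log (by positivity) ?_
      have : (m : ℝ) ^ 4 = m * (m * (m * m)) := by ring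
      have h8 : (4 : ℝ) ≤ m * m := by nlinarith
      have h9 : (8 : ℝ) ≤ m * (m * m) := by nlinarith
      nlinarith
    rwa [Real.log_pow] at this
  have h4 : θ + 8 * Real.log (m * 4 + 1) * b ≤ 34 * Real.log m * b := by
    have e1 : b ≤ 2 * Real.log m * b := le_mul_of_one_le_left hb0 (by linarith)
    have e2 : 8 * Real.log (m * 4 + 1) * b ≤ 32 * Real.log m * b :=
      mul_le_mul_of_nonneg_right (by linarith) hb0
    linarith
  have h5 : ((Nat.clog 2 (2 * m) : ℝ) + 1) * (θ + 8 * Real.log (m * 4 + 1) * b)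
      ≤ 7 * Real.log m * (34 * Real.log m * b) := by
    have := h.floor_nonneg
    have := log_mul_add_one_nonneg m (show (0 : ℝ) ≤ 4 by norm_num)
    exact mul_le_mul (clog_add_one_le hm) h4 (by positivity) (by linarith)
  have h6 := h.floor_nonneg
  linarith

end CCFL

end

theorem mainTheorem6 (a b : ℝ) (ha : 0 < a) :
    ∃ (A : CCFL.Algorithm) (C : ℝ) (Q : Polynomial ℕ),
      ∀ m : ℕ, 2 ≤ m →
      ∀ p : ℝ, 1 ≤ p → a * Real.log m ≤ p → p ≤ b * Real.log m →
      ∀ I : CCFL.Instance m, ∃ R : CCFL.Execution A I p, ∀ n : ℕ,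
        -- the separation oracle and the updates, in every iteration for client `n`
        (∀ k ≤ R.iters n, CCFL.SeparatesAt m A n (R.state n k)) ∧
        (∀ k < R.iters n, CCFL.UpdatesAt m A n (R.state n k)) ∧
        -- number of iterations and running time for client `n`
        R.iters n ≤ 4 * m ∧
        R.steps n ≤ Q.eval (m + n + 1) ∧
        -- the solution after client `n` has been served
        (∀ j ≤ n, ∀ S : Finset (Fin m),
          1 / 2 ≤ CCFL.coverage ((R.state n (R.iters n)).x m)
            ((R.state n (R.iters n)).y m) j S) ∧
        CCFL.Feasible (n + 1) (fun i => 2 * (R.state n (R.iters n)).x m i)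
          (fun i j => 2 * (R.state n (R.iters n)).y m i j) ∧
        ∀ (x : Fin m → ℝ) (y : Fin m → ℕ → ℝ), CCFL.Feasible (n + 1) x y →
          (CCFL.objective I p (n + 1) (fun i => 2 * (R.state n (R.iters n)).x m i)
              (fun i j => 2 * (R.state n (R.iters n)).y m i j)) ^ (1 / p)
            ≤ C * Real.log m ^ 2 * (CCFL.objective I p (n + 1) x y) ^ (1 / p) := by
  -- The factor 952 = 2 · 476 accounts for doubling the solution, and the exponential for passing
  -- from the largest row to the p-norm.
  refine ⟨CCFL.algorithm, Real.exp (2 / a) * 952,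
    2 * CCFL.separation.timeBound + CCFL.updating.timeBound, fun m hm p hp hap _ I =>
    ⟨CCFL.execution hm I p, fun n => ?_⟩⟩
  have hs := CCFL.arrived_startOf hm I p n
  have h1 : (CCFL.execution hm I p).iters n ≤ 1 := CCFL.iterations_le _
  have hk : ∀ k, CCFL.Arrived I n ((CCFL.execution hm I p).state n k) := fun k => hs.iterate hm k
  have hfin := hs.finished hm
  have hcov : ∀ j ≤ n, ∀ S : Finset (Fin m), 1 / 2 ≤ CCFL.coverage
      (((CCFL.execution hm I p).state n ((CCFL.execution hm I p).iters n)).x m)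
      (((CCFL.execution hm I p).state n ((CCFL.execution hm I p).iters n)).y m) j S := by
    intro j hj S
    rcases hj.lt_or_eq with h | rfl
    · exact (hk _).covered j h S
    · exact hfin.trans (CCFL.minCoverage_le _ _ _ S)
  have hinv := (hk ((CCFL.execution hm I p).iters n)).inv
  refine ⟨fun k _ => CCFL.separatesAt (hk k).holds, fun k _ => CCFL.updatesAt hm (hk k),
    by omega, CCFL.execution_steps hm I p n, hcov, ⟨?_, ?_, ?_⟩, fun x y hf => ?_⟩
  · exact fun i => mul_nonneg zero_le_two (hinv.x_nonneg i)
  · exact fun i j hj => mul_nonneg zero_le_two (hinv.y_nonneg i j (Nat.lt_succ_iff.1 hj))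
  · intro j hj S
    have h2 := hcov j (Nat.lt_succ_iff.1 hj) S
    rw [CCFL.coverage] at h2 ⊢
    rw [← Finset.mul_sum, ← Finset.mul_sum]
    linarith
  · have hr := CCFL.rows_nonneg I n hf.1 fun i j hj => hf.2.1 i j (Nat.lt_succ_iff.2 hj)
    have hopt := CCFL.rows_le_objective hp hr
    have hrows := hinv.rows_le_log hm hf hopt
    have h0 := CCFL.rows_nonneg I n hinv.x_nonneg hinv.y_nonneg
    refine (CCFL.objective_le ha hm hp hap
      (b := 952 * Real.log m ^ 2 * CCFL.objective I p (n + 1) x y ^ (1 / p))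
      (fun r => ?_) fun r => ?_).trans_eq (by ring)
    · rw [CCFL.rows_two_mul]
      exact mul_nonneg zero_le_two (h0 r)
    · rw [CCFL.rows_two_mul]
      linarith [hrows r]
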